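/- Let $\mathbb D=\{z\in\mathbb C:|z|<1\}$. A convex harmonic mapping is a complex-valued harmonic function $f$ on $\mathbb D$ that is univalent (injective) in $\mathbb D$ and whose image $f(\mathbb D)$ is convex. Write $f=h+\overline g$ with $h,g$ analytic in $\mathbb D$, let $J_f=|h'|^2-|g'|^2$ be the Jacobian of $f$, and let $P_f=\frac{\partial}{\partial z}\log|J_f|$, where $\frac{\partial}{\partial z}=\frac12\left(\frac{\partial}{\partial x}-i\frac{\partial}{\partial y}\right)$, be the pre-Schwarzian derivative of $f$. Then, for every convex harmonic mapping $f$, the Jacobian $J_f$ does not vanish in $\mathbb D$ (so that $P_f$ is well defined in $\mathbb D$), and $$\|P_f\|=\sup_{z\in\mathbb D}|P_f(z)|\,(1-|z|^2)\le 5 .$$ The constant $5$ is sharp: the half-plane harmonic mapping $$L(z)=\frac{2z-z^2}{2(1-z)^2}+\overline{\left(\frac{-z^2}{2(1-z)^2}\right)},\qquad z\in\mathbb D,$$ is a convex harmonic mapping with $\|P_L\|=5$. -/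

import Mathlib

namespace HarmonicMapping

/-- The open unit disk in the complex plane. -/
abbrev disk : Set ℂ := Metric.ball (0 : ℂ) 1

/-- The Wirtinger derivative `∂u/∂z = (1/2) (∂u/∂x - i ∂u/∂y)`. -/
noncomputable def wirtinger (u : ℂ → ℂ) (z : ℂ) : ℂ :=
  (1 / 2 : ℂ) * (fderiv ℝ u z 1 - Complex.I * fderiv ℝ u z Complex.I)

/-- The Jacobian determinant of a planar map (for `f = h + conj g` it is `|h'|² - |g'|²`). -/
noncomputable def jacobian (f : ℂ → ℂ) (z : ℂ) : ℝ :=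
  (fderiv ℝ f z).det

/-- The pre-Schwarzian derivative `P_f = (log |J_f|)_z` of a locally univalent harmonic mapping.
The absolute value covers the sense-preserving case (`J_f > 0`) and the sense-reversing case
(`J_f < 0`), where `P_f` is the pre-Schwarzian derivative of the conjugate mapping. -/
noncomputable def preSchwarzian (f : ℂ → ℂ) (z : ℂ) : ℂ :=
  wirtinger (fun w => ((Real.log |jacobian f w| : ℝ) : ℂ)) z

/-- The pre-Schwarzian norm `sup_{|z| < 1} |P_f(z)| (1 - |z|²)`, as an extended nonnegative
real number. -/
noncomputable def preSchwarzianNorm (f : ℂ → ℂ) : ENNReal :=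
  ⨆ z ∈ disk, ENNReal.ofReal (‖preSchwarzian f z‖ * (1 - ‖z‖ ^ 2))

/-- A convex harmonic mapping of the unit disk: harmonic and univalent in the disk, with
convex image. -/
structure IsConvexHarmonic (f : ℂ → ℂ) : Prop where
  harmonic : InnerProductSpace.HarmonicOnNhd f disk
  univalent : Set.InjOn f disk
  convex_image : Convex ℝ (f '' disk)

/-- The half-plane harmonic mapping `L = h + conj g`, with
`h(z) = (2z - z²) / (2(1 - z)²)` and `g(z) = -z² / (2(1 - z)²)`. -/
noncomputable def halfPlaneMap (z : ℂ) : ℂ :=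
  (2 * z - z ^ 2) / (2 * (1 - z) ^ 2) +
    (starRingEnd ℂ) (-z ^ 2 / (2 * (1 - z) ^ 2))

end HarmonicMapping

/-!
By Lewy's theorem the Jacobian of a univalent harmonic mapping has no zeros, so up to conjugation
the mapping is `h + conj g` with dilatation `ω = g' / h'`, `|ω| < 1`. Differentiating
`log (|h'|² - |g'|²)` and comparing with the shears `F = τ h + conj τ g`, `|τ| = 1`, gives
`|P_f - F'' / F'| ≤ 1 / (1 - |z|²)` by the Schwarz–Pick lemma for `ω`. Since `Im F` is the imaginary
part of `τ f`, the mapping `F` is univalent onto a region convex in the horizontal direction. Hence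
`Re (p F') ≥ 0` for some quadratic field `p` tangent to the unit circle. Replacing `τ` by `-τ`
replaces `p` by `-p`, so by connectedness some `τ` admits fields of both orientations, and their
convex combination has no rotational part about a given `z`. Carathéodory's coefficient estimate
then yields `|(1 - |z|²) F'' / F' - 2 conj z| ≤ 2`, so `(1 - |z|²) |P_f| ≤ 3 + 2 |z|`. For the
half-plane mapping equality holds at every positive `z`.
-/

namespace HarmonicMapping

open Complex Set Metric Filter Topology MeasureTheory

/-! ### Interlaced pairs of points of the circle -/

lemma one_sub_exp_mul_I (τ : ℝ) :
    1 - exp (τ * I) = ((2 * Real.sin (τ / 2) : ℝ) : ℂ) * exp (((τ - Real.pi) / 2 : ℝ) * I) := by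
  have hsq : exp (τ * I) = exp ((τ / 2 : ℝ) * I) * exp ((τ / 2 : ℝ) * I) := by
    rw [← exp_add]; congr 1; push_cast; ring
  have hrot : exp (((τ - Real.pi) / 2 : ℝ) * I) = exp ((τ / 2 : ℝ) * I) * (-I) := by
    have h : (-I : ℂ) = exp (-(Real.pi / 2 * I)) := by
      rw [← neg_mul, ← neg_div, exp_neg_pi_div_two_mul_I]
    rw [h, ← exp_add]; congr 1; push_cast; ring
  rw [hsq, hrot, exp_mul_I, ← ofReal_cos, ← ofReal_sin]
  have hcs := Real.sin_sq_add_cos_sq (τ / 2)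
  generalize Real.sin (τ / 2) = s at *
  generalize Real.cos (τ / 2) = c at *
  apply Complex.ext <;> simp only [sub_re, sub_im, one_re, one_im, mul_re, mul_im, add_re, add_im,
    neg_re, neg_im, ofReal_re, ofReal_im, I_re, I_im]
  · linear_combination -hcs
  · ring

lemma arg_one_sub_exp_mul_I {τ : ℝ} (h0 : 0 < τ) (h1 : τ < 2 * Real.pi) :
    arg (1 - exp (τ * I)) = (τ - Real.pi) / 2 := by
  rw [one_sub_exp_mul_I, arg_real_mul, arg_exp_mul_I, toIocMod_eq_self]
  · constructor <;> linarith [Real.pi_pos]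
  · have := Real.sin_pos_of_pos_of_lt_pi (x := τ / 2) (by linarith) (by linarith)
    positivity

lemma log_one_sub_exp_div_exp_im {x y : ℝ} (h0 : y < x) (h1 : x < y + 2 * Real.pi) :
    (log (1 - exp (x * I) / exp (y * I))).im = (x - y - Real.pi) / 2 := by
  rw [log_im, ← exp_sub, show (x * I - y * I : ℂ) = ((x - y : ℝ) : ℂ) * I by push_cast; ring,
    arg_one_sub_exp_mul_I (by linarith) (by linarith)]

lemma exp_add_two_pi_mul_I (x : ℝ) : exp ((x + 2 * Real.pi : ℝ) * I) = exp (x * I) := by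
  push_cast
  rw [add_mul, exp_add, exp_two_pi_mul_I, mul_one]

lemma log_one_sub_exp_div_exp_im_of_lt {x y : ℝ} (h0 : x < y) (h1 : y < x + 2 * Real.pi) :
    (log (1 - exp (x * I) / exp (y * I))).im = (x - y + Real.pi) / 2 := by
  rw [← exp_add_two_pi_mul_I x, log_one_sub_exp_div_exp_im (by linarith) (by linarith)]
  ring

lemma one_sub_div_mem_slitPlane {a v : ℂ} (ha : ‖a‖ = 1) (hv : ‖v‖ ≤ 1) (hva : v ≠ a) :
    1 - v / a ∈ slitPlane := by
  have ha0 : a ≠ 0 := norm_ne_zero_iff.1 (by rw [ha]; exact one_ne_zero)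
  have hle : (v / a).re ≤ 1 := (re_le_norm _).trans (by rwa [norm_div, ha, div_one])
  rw [mem_slitPlane_iff]
  by_contra! h
  have hone : v / a = 1 := by
    apply Complex.ext <;> simp only [sub_re, sub_im, one_re, one_im] at h ⊢ <;> linarith [h.1, h.2]
  exact hva ((div_eq_one_iff_eq ha0).1 hone)

lemma sub_eq_log_sub_log_of_exp_eq {X : Type*} [TopologicalSpace X] [PreconnectedSpace X]
    {w Λ : X → ℂ} {c : ℂ} (hΛ : Continuous Λ) (hw : Continuous w)
    (hexp : ∀ x, exp (Λ x) = c * w x) (hslit : ∀ x, w x ∈ slitPlane) (x y : X) :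
    Λ x - Λ y = log (w x) - log (w y) := by
  have hc : ∀ t, exp (Λ t - log (w t)) = c := fun t => by
    have hwt := slitPlane_ne_zero (hslit t)
    rw [exp_sub, exp_log hwt, hexp, mul_div_cancel_right₀ _ hwt]
  have hconst := isCoveringMap_exp.const_of_comp (hΛ.sub (hw.clog hslit))
    (fun s t => Subtype.ext ((hc s).trans (hc t).symm)) x y
  simp only [Pi.sub_apply] at hconst
  linear_combination hconst

lemma exists_continuous_exp_eq {E : Type*} [NormedAddCommGroup E] [NormedSpace ℝ E] {w : E → ℂ}
    (hw : Continuous w) (h0 : ∀ x, w x ≠ 0) : ∃ Λ : E → ℂ, Continuous Λ ∧ ∀ x, exp (Λ x) = w x := by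
  have hsc : IsSimplyConnected (univ : Set E) :=
    haveI : ContractibleSpace (univ : Set E) :=
      (convex_univ (𝕜 := ℝ)).contractibleSpace univ_nonempty
    inferInstanceAs (SimplyConnectedSpace (univ : Set E))
  obtain ⟨Λ, hΛ, hexp⟩ := exists_continuousOn_eqOn_exp_comp hsc isOpen_univ hw.continuousOn (by
    rintro ⟨x, -, hx⟩
    exact h0 x hx)
  exact ⟨Λ, continuousOn_univ.1 hΛ, fun x => hexp (mem_univ x)⟩

lemma sub_eq_log_one_sub_div_of_exp_eq {X : Type*} [TopologicalSpace X] [PreconnectedSpace X]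
    {w Λ : X → ℂ} {a c : ℂ} (hΛ : Continuous Λ) (hw : Continuous w)
    (hexp : ∀ x, exp (Λ x) = c * (a - w x)) (ha : ‖a‖ = 1) (hw1 : ∀ x, ‖w x‖ ≤ 1)
    (hwa : ∀ x, w x ≠ a) (x y : X) : Λ x - Λ y = log (1 - w x / a) - log (1 - w y / a) := by
  have ha0 : a ≠ 0 := norm_ne_zero_iff.1 (by rw [ha]; exact one_ne_zero)
  refine sub_eq_log_sub_log_of_exp_eq (c := c * a) hΛ (by fun_prop) (fun x => ?_)
    (fun x => one_sub_div_mem_slitPlane ha (hw1 x) (hwa x)) x y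
  rw [hexp]
  field_simp

/-- The winding of `p s - q t` around the boundary of the square of parameters is computed on each
side with the principal logarithm; it is zero for disjoint paths and `2π` for interlaced ones. -/
theorem not_joinedIn_of_interlaced {A B : Set ℂ} (hA : A ⊆ closedBall 0 1)
    (hB : B ⊆ closedBall 0 1) (hAB : Disjoint A B) {α β γ δ : ℝ} (hαβ : α < β) (hβγ : β < γ)
    (hγδ : γ < δ) (hδα : δ < α + 2 * Real.pi)
    (hjA : JoinedIn A (exp (α * I)) (exp (γ * I))) :
    ¬ JoinedIn B (exp (β * I)) (exp (δ * I)) := by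
  rintro ⟨q, hq⟩
  obtain ⟨p, hp⟩ := hjA
  have hp' : ∀ s, p.extend s ∈ A := fun s => hp _
  have hq' : ∀ t, q.extend t ∈ B := fun t => hq _
  have hne : ∀ s t, p.extend s ≠ q.extend t := fun s t => hAB.ne_of_mem (hp' s) (hq' t)
  have hp1 : ∀ s, ‖p.extend s‖ ≤ 1 := fun s => mem_closedBall_zero_iff.1 (hA (hp' s))
  have hq1 : ∀ t, ‖q.extend t‖ ≤ 1 := fun t => mem_closedBall_zero_iff.1 (hB (hq' t))
  have hpq : Continuous (fun x : ℝ × ℝ => p.extend x.1 - q.extend x.2) := by fun_prop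
  obtain ⟨Λ, hΛ, hexp⟩ := exists_continuous_exp_eq hpq fun x => sub_ne_zero.2 (hne _ _)
  have hu : ∀ x : ℝ, ‖exp (x * I)‖ = 1 := norm_exp_ofReal_mul_I
  have vertical : ∀ s x : ℝ, p.extend s = exp (x * I) → Λ (s, 1) - Λ (s, 0)
      = log (1 - exp (δ * I) / exp (x * I)) - log (1 - exp (β * I) / exp (x * I)) := by
    intro s x hs
    have := sub_eq_log_one_sub_div_of_exp_eq (Λ := fun t => Λ (s, t)) (c := 1) (by fun_prop)
      q.continuous_extend (fun t => by rw [hexp, one_mul]) (hs ▸ hu x) hq1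
      (fun t => (hne s t).symm) 1 0
    simpa only [q.extend_one, q.extend_zero, hs] using this
  have horizontal : ∀ t x : ℝ, q.extend t = exp (x * I) → Λ (1, t) - Λ (0, t)
      = log (1 - exp (γ * I) / exp (x * I)) - log (1 - exp (α * I) / exp (x * I)) := by
    intro t x ht
    have := sub_eq_log_one_sub_div_of_exp_eq (Λ := fun s => Λ (s, t)) (c := -1) (by fun_prop)
      p.continuous_extend (fun s => by rw [hexp, neg_one_mul, neg_sub]) (ht ▸ hu x)
      hp1 (fun s => hne s t) 1 0
    simpa only [p.extend_one, p.extend_zero, ht] using this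
  have left := congrArg im (vertical 0 α p.extend_zero)
  have right := congrArg im (vertical 1 γ p.extend_one)
  have bottom := congrArg im (horizontal 0 β q.extend_zero)
  have top := congrArg im (horizontal 1 δ q.extend_one)
  rw [sub_im, sub_im, log_one_sub_exp_div_exp_im (by linarith) (by linarith),
    log_one_sub_exp_div_exp_im (by linarith) (by linarith)] at left
  rw [sub_im, sub_im, log_one_sub_exp_div_exp_im hγδ (by linarith),
    log_one_sub_exp_div_exp_im_of_lt hβγ (by linarith)] at right
  rw [sub_im, sub_im, log_one_sub_exp_div_exp_im hβγ (by linarith),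
    log_one_sub_exp_div_exp_im_of_lt hαβ (by linarith)] at bottom
  rw [sub_im, sub_im, log_one_sub_exp_div_exp_im_of_lt hγδ (by linarith),
    log_one_sub_exp_div_exp_im_of_lt (by linarith) hδα] at top
  linarith [Real.pi_pos]

/-! ### Lewy's theorem -/

/-- The complex-valued harmonic mapping `h + conj g` with analytic part `h` and co-analytic part
`conj g`. -/
noncomputable def harm (h g : ℂ → ℂ) (z : ℂ) : ℂ := h z + (starRingEnd ℂ) (g z)

lemma exists_analyticAt_pow_eq {g : ℂ → ℂ} {z₀ : ℂ} (hg : AnalyticAt ℂ g z₀) (hg0 : g z₀ ≠ 0)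
    {k : ℕ} (hk : k ≠ 0) :
    ∃ ρ : ℂ → ℂ, AnalyticAt ℂ ρ z₀ ∧ ρ z₀ ≠ 0 ∧ ∀ᶠ z in 𝓝 z₀, ρ z ^ k = g z := by
  obtain ⟨c, hc⟩ := IsAlgClosed.exists_pow_nat_eq (g z₀) (Nat.pos_of_ne_zero hk)
  have hc0 : c ≠ 0 := by
    rintro rfl
    exact hg0 (by rw [← hc, zero_pow hk])
  have hkC : (k : ℂ) ≠ 0 := by exact_mod_cast hk
  have hslit : g z₀ / g z₀ ∈ slitPlane := by rw [div_self hg0]; exact one_mem_slitPlane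
  refine ⟨fun z => c * exp (log (g z / g z₀) / k), analyticAt_const.mul
    (((hg.div_const (c := g z₀)).clog hslit).div_const (c := (k : ℂ))).cexp,
    mul_ne_zero hc0 (exp_ne_zero _), ?_⟩
  filter_upwards [hg.continuousAt.eventually_ne hg0] with z hz
  rw [mul_pow, hc, ← exp_nat_mul, mul_div_cancel₀ _ hkC, exp_log (div_ne_zero hz hg0),
    mul_div_cancel₀ _ hg0]

lemma eventually_eq_or_eq_pow_of_deriv_eq_zero {F : ℂ → ℂ} {z₀ : ℂ} (hF : AnalyticAt ℂ F z₀)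
    (hd : deriv F z₀ = 0) :
    (∀ᶠ z in 𝓝 z₀, F z = F z₀) ∨ ∃ (k : ℕ) (ψ : ℂ → ℂ) (c : ℂ), 2 ≤ k ∧ ψ z₀ = 0 ∧ c ≠ 0 ∧
      HasStrictDerivAt ψ c z₀ ∧ ∀ᶠ z in 𝓝 z₀, F z - F z₀ = ψ z ^ k := by
  have hF' : AnalyticAt ℂ (fun z => F z - F z₀) z₀ := hF.sub analyticAt_const
  refine or_iff_not_imp_left.2 fun hconst => ?_
  obtain ⟨k, g, hg, hg0, hk⟩ := hF'.exists_eventuallyEq_pow_smul_nonzero_iff.2 fun h =>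
    hconst (h.mono fun z hz => sub_eq_zero.1 hz)
  simp only [smul_eq_mul] at hk
  have hk0 : k ≠ 0 := by
    rintro rfl
    have := hk.self_of_nhds
    simp only [sub_self, pow_zero, one_mul] at this
    exact hg0 this.symm
  have hk1 : k ≠ 1 := by
    rintro rfl
    have hF1 : HasDerivAt (fun z => F z - F z₀) 0 z₀ :=
      hd ▸ hF.differentiableAt.hasDerivAt.sub_const (F z₀)
    have hg1 : HasDerivAt (fun z => (z - z₀) ^ 1 * g z) (g z₀) z₀ := by
      simpa using (((hasDerivAt_id' z₀).sub_const z₀).fun_pow 1).fun_mul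
        hg.differentiableAt.hasDerivAt
    exact hg0 ((hg1.congr_of_eventuallyEq hk).unique hF1)
  obtain ⟨ρ, hρ, hρ0, hρk⟩ := exists_analyticAt_pow_eq hg hg0 hk0
  refine ⟨k, fun z => (z - z₀) * ρ z, ρ z₀, by omega, by simp, hρ0, ?_, ?_⟩
  · simpa using HasStrictDerivAt.fun_mul ((hasStrictDerivAt_id z₀).sub_const z₀) hρ.hasStrictDerivAt
  · filter_upwards [hk, hρk] with z h1 h2
    rw [h1, mul_pow, h2]

lemma image_mem_nhds_of_injOn {y : ℝ → ℝ} {ε : ℝ} (hε : 0 < ε)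
    (hy : ContinuousOn y (Icc (-ε) ε)) (hinj : InjOn y (Icc (-ε) ε)) :
    y '' Icc (-ε) ε ∈ 𝓝 (y 0) := by
  have hneg : -ε ∈ Icc (-ε) ε := ⟨le_rfl, by linarith⟩
  have hpos : ε ∈ Icc (-ε) ε := ⟨by linarith, le_rfl⟩
  have hzero : (0 : ℝ) ∈ Icc (-ε) ε := ⟨by linarith, hε.le⟩
  rcases hy.strictMonoOn_of_injOn_Icc' (by linarith) hinj with hmono | hanti
  · exact mem_of_superset (Icc_mem_nhds (hmono hneg hzero (by linarith)) (hmono hzero hpos hε))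
      (intermediate_value_Icc (by linarith) hy)
  · exact mem_of_superset (Icc_mem_nhds (hanti hzero hpos hε) (hanti hneg hzero (by linarith)))
      (intermediate_value_Icc' (by linarith) hy)

/-- A real-valued function is not injective on a cross: on an arm it takes all values close to the
one at the centre. -/
lemma not_injOn_cross {v : ℂ → ℝ} {a b : ℂ} (hab : ∀ s t : ℝ, s * a = t * b → s = 0) {ε : ℝ}
    (hε : 0 < ε) (hv : ContinuousOn v (closedBall 0 ε)) (ha : ‖a‖ = 1) (hb : ‖b‖ = 1) :
    ¬ InjOn v ({w | ∃ t : ℝ, w = t * a ∨ w = t * b} ∩ closedBall 0 ε) := by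
  intro hinj
  have hmem : ∀ t ∈ Icc (-ε) ε, ∀ c : ℂ, ‖c‖ = 1 → (t * c : ℂ) ∈ closedBall 0 ε := by
    intro t ht c hc
    rw [mem_closedBall_zero_iff, norm_mul, hc, mul_one, norm_real, Real.norm_eq_abs]
    exact abs_le.2 ht
  have hb0 : b ≠ 0 := norm_ne_zero_iff.1 (by rw [hb]; exact one_ne_zero)
  have himage := image_mem_nhds_of_injOn (y := fun t : ℝ => v (t * b)) hε
    (hv.comp (by fun_prop) fun t ht => hmem t ht b hb) fun s hs t ht hst => by
      have := hinj ⟨⟨s, Or.inr rfl⟩, hmem s hs b hb⟩ ⟨⟨t, Or.inr rfl⟩, hmem t ht b hb⟩ hst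
      exact_mod_cast mul_right_cancel₀ hb0 this
  have hx : Tendsto (fun s : ℝ => v (s * a)) (𝓝[≠] 0) (𝓝 (v ((0 : ℝ) * b))) := by
    have hcont : ContinuousAt (fun s : ℝ => v (s * a)) 0 := by
      refine ContinuousAt.comp (g := v) ?_ (by fun_prop)
      rw [ofReal_zero, zero_mul]
      exact hv.continuousAt (closedBall_mem_nhds 0 hε)
    have := hcont.tendsto.mono_left (nhdsWithin_le_nhds (s := {0}ᶜ))
    simpa only [ofReal_zero, zero_mul] using this
  have hIcc : ∀ᶠ s : ℝ in 𝓝[≠] 0, s ∈ Icc (-ε) ε :=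
    nhdsWithin_le_nhds (Icc_mem_nhds (by linarith) hε)
  obtain ⟨s, ⟨⟨t, ht, hst⟩, hs⟩, hs0⟩ :=
    ((hx.eventually himage).and hIcc |>.and self_mem_nhdsWithin).exists
  exact hs0 (hab s t (hinj ⟨⟨s, Or.inl rfl⟩, hmem s hs a ha⟩ ⟨⟨t, Or.inr rfl⟩, hmem t ht b hb⟩
    hst.symm))

lemma exp_cross_eq_zero {k : ℕ} (hk : 2 ≤ k) {s t : ℝ}
    (hst : s * exp ((Real.pi / (2 * k) : ℝ) * I) = t * exp ((3 * Real.pi / (2 * k) : ℝ) * I)) :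
    s = 0 := by
  have hkR : (2 : ℝ) ≤ k := by exact_mod_cast hk
  have hrot : (s : ℂ) = t * exp ((Real.pi / k : ℝ) * I) := by
    refine mul_right_cancel₀ (exp_ne_zero ((Real.pi / (2 * k) : ℝ) * I)) (hst.trans ?_)
    rw [mul_assoc, ← exp_add]
    congr 2
    push_cast
    field_simp
    norm_num
  have him := congrArg im hrot
  rw [ofReal_im, im_ofReal_mul, exp_ofReal_mul_I_im] at him
  have hsin : 0 < Real.sin (Real.pi / k) := Real.sin_pos_of_pos_of_lt_pi (by positivity) <| by
    rw [div_lt_iff₀ (by linarith)]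
    nlinarith [Real.pi_pos]
  have ht : t = 0 := (mul_eq_zero.1 him.symm).resolve_right hsin.ne'
  rw [ht] at hrot
  simpa only [ofReal_zero, zero_mul, ofReal_eq_zero] using hrot

lemma mul_exp_pow_re {k : ℕ} (hk : k ≠ 0) {x : ℝ} (hx : Real.cos x = 0) (t : ℝ) :
    ((t * exp ((x / k : ℝ) * I)) ^ k).re = 0 := by
  have hkC : (k : ℂ) ≠ 0 := by exact_mod_cast hk
  rw [mul_pow, ← exp_nat_mul, show (k : ℂ) * ((x / k : ℝ) * I) = x * I by push_cast; field_simp,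
    ← ofReal_pow, re_ofReal_mul, exp_ofReal_mul_I_re, hx, mul_zero]

lemma exists_coordinate_cross_of_deriv_eq_zero {F : ℂ → ℂ} {z₀ : ℂ} (hF : AnalyticAt ℂ F z₀)
    (hd : deriv F z₀ = 0) : ∃ (ψ : ℂ → ℂ) (c a b : ℂ), ψ z₀ = 0 ∧ c ≠ 0 ∧ HasStrictDerivAt ψ c z₀ ∧
      ‖a‖ = 1 ∧ ‖b‖ = 1 ∧ (∀ s t : ℝ, s * a = t * b → s = 0) ∧
      ∀ᶠ z in 𝓝 z₀, (∃ t : ℝ, ψ z = t * a ∨ ψ z = t * b) → (F z).re = (F z₀).re := by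
  have hcos : Real.cos (3 * Real.pi / 2) = 0 := Real.cos_eq_zero_iff.2 ⟨1, by push_cast; ring⟩
  rcases eventually_eq_or_eq_pow_of_deriv_eq_zero hF hd with
    hconst | ⟨k, ψ, c, hk, hψ0, hc, hψ, hpow⟩
  · refine ⟨fun z => z - z₀, 1, _, _, sub_self z₀, one_ne_zero,
      (hasStrictDerivAt_id z₀).sub_const z₀, norm_exp_ofReal_mul_I _, norm_exp_ofReal_mul_I _,
      fun s t => exp_cross_eq_zero le_rfl, ?_⟩
    filter_upwards [hconst] with z hz _
    rw [hz]
  · refine ⟨ψ, c, _, _, hψ0, hc, hψ, norm_exp_ofReal_mul_I _, norm_exp_ofReal_mul_I _,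
      fun s t => exp_cross_eq_zero hk, ?_⟩
    filter_upwards [hpow] with z hz
    rintro ⟨t, ht⟩
    rw [← sub_eq_zero, ← sub_re, hz]
    rcases ht with ht | ht <;> rw [ht, ← div_div]
    · exact mul_exp_pow_re (by omega) Real.cos_pi_div_two t
    · exact mul_exp_pow_re (by omega) hcos t

lemma exists_norm_eq_one_mul_add_conj_mul_eq_zero {a b : ℂ} (h : ‖a‖ = ‖b‖) :
    ∃ l : ℂ, ‖l‖ = 1 ∧ l * a + (starRingEnd ℂ) l * b = 0 := by
  by_cases ha : a = 0
  · have hb : b = 0 := by rw [← norm_eq_zero, ← h, ha, norm_zero]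
    exact ⟨1, by simp, by simp [ha, hb]⟩
  obtain ⟨l, hl⟩ := IsAlgClosed.exists_pow_nat_eq (-(b / a)) two_pos
  have hl1 : ‖l‖ = 1 := by
    have hsq := congrArg norm hl
    rw [norm_neg, norm_div, ← h, div_self (norm_ne_zero_iff.2 ha), norm_pow] at hsq
    exact (pow_eq_one_iff_of_nonneg (norm_nonneg _) two_ne_zero).1 hsq
  have hc : l * (starRingEnd ℂ) l = 1 := by rw [mul_conj, normSq_eq_norm_sq, hl1]; simp
  have hla : l ^ 2 * a = -b := by rw [hl]; field_simp
  exact ⟨l, hl1, by linear_combination (starRingEnd ℂ l) * hla - l * a * hc⟩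

lemma exists_deriv_eq_zero_re_eq_re_mul_harm {h g : ℂ → ℂ} {z₀ : ℂ} (hh : AnalyticAt ℂ h z₀)
    (hg : AnalyticAt ℂ g z₀) (hnorm : ‖deriv h z₀‖ = ‖deriv g z₀‖) :
    ∃ (F : ℂ → ℂ) (l : ℂ), l ≠ 0 ∧ AnalyticAt ℂ F z₀ ∧ deriv F z₀ = 0 ∧
      ∀ z, (F z).re = (l * harm h g z).re := by
  obtain ⟨l, hl, hcrit⟩ := exists_norm_eq_one_mul_add_conj_mul_eq_zero hnorm
  refine ⟨fun z => l * h z + (starRingEnd ℂ) l * g z, l, ?_,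
    (analyticAt_const.mul hh).add (analyticAt_const.mul hg), ?_, fun z => ?_⟩
  · rw [← norm_ne_zero_iff, hl]
    exact one_ne_zero
  · rw [← hcrit]
    exact ((hh.differentiableAt.hasDerivAt.const_mul l).add
      (hg.differentiableAt.hasDerivAt.const_mul ((starRingEnd ℂ) l))).deriv
  · simp only [harm, mul_add, add_re, mul_re, conj_re, conj_im]
    ring

/-- **Lewy's theorem**. -/
theorem norm_deriv_ne_of_injOn {h g : ℂ → ℂ} {z₀ : ℂ} {s : Set ℂ} (hs : s ∈ 𝓝 z₀)
    (hh : AnalyticAt ℂ h z₀) (hg : AnalyticAt ℂ g z₀)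
    (hinj : InjOn (harm h g) s) : ‖deriv h z₀‖ ≠ ‖deriv g z₀‖ := by
  intro hnorm
  obtain ⟨F, l, hl0, hF, hd, hFre⟩ := exists_deriv_eq_zero_re_eq_re_mul_harm hh hg hnorm
  set f : ℂ → ℂ := harm h g
  have hf : ∀ᶠ z in 𝓝 z₀, ContinuousAt f z := by
    filter_upwards [hh.eventually_analyticAt, hg.eventually_analyticAt] with z h1 h2
    exact h1.continuousAt.add (continuous_conj.continuousAt.comp h2.continuousAt)
  obtain ⟨ψ, c, a, b, hψ0, hc, hψ, ha, hb, hab, hlevel⟩ :=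
    exists_coordinate_cross_of_deriv_eq_zero hF hd
  have hψe := hψ.hasStrictFDerivAt_equiv hc
  set e := hψe.toOpenPartialHomeomorph ψ
  have hz₀ : z₀ ∈ e.source := hψe.mem_toOpenPartialHomeomorph_source
  have he0 : e z₀ = 0 := hψ0
  have h0 : (0 : ℂ) ∈ e.target := he0 ▸ e.map_source hz₀
  have hsymm : Tendsto e.symm (𝓝 0) (𝓝 z₀) := by
    have := e.tendsto_symm hz₀
    rwa [he0] at this
  obtain ⟨ε, hε, hball⟩ := nhds_basis_closedBall.eventually_iff.1
    ((e.open_target.eventually_mem h0).and (hsymm.eventually (hlevel.and (hf.and hs))))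
  refine not_injOn_cross (v := fun w => (l * f (e.symm w)).im) hab hε ?_ ha hb ?_
  · intro w hw
    have hfw : ContinuousAt (fun x => f (e.symm x)) w :=
      (hball hw).2.2.1.comp (e.continuousAt_symm (hball hw).1)
    exact (continuous_im.continuousAt.comp (continuousAt_const.mul hfw)).continuousWithinAt
  · have hre : ∀ w ∈ {w | ∃ t : ℝ, w = t * a ∨ w = t * b} ∩ closedBall 0 ε,
        (l * f (e.symm w)).re = (F z₀).re := by
      rintro w ⟨hcross, hw⟩
      rw [← hFre]
      refine (hball hw).2.1 ?_
      rwa [show ψ (e.symm w) = w from e.right_inv (hball hw).1]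
    intro x hx y hy hxy
    have hfxy : f (e.symm x) = f (e.symm y) :=
      mul_left_cancel₀ hl0 (Complex.ext ((hre x hx).trans (hre y hy).symm) hxy)
    rw [← e.right_inv (hball hx.2).1, ← e.right_inv (hball hy.2).1,
      hinj (hball hx.2).2.2.2 (hball hy.2).2.2.2 hfxy]

/-! ### Injective analytic and harmonic maps -/

lemma det_eq_re_im (L : ℂ →L[ℝ] ℂ) : L.det = (L 1).re * (L I).im - (L I).re * (L 1).im := by
  rw [ContinuousLinearMap.det, ← LinearMap.det_toMatrix basisOneI, Matrix.det_fin_two]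
  simp [LinearMap.toMatrix_apply]

/-- The real-linear map `v ↦ a v + conj (b v)`, which is the differential of a harmonic mapping
`h + conj g` with `h' = a` and `g' = b`. -/
noncomputable def harmLin (a b : ℂ) : ℂ →L[ℝ] ℂ :=
  (ContinuousLinearMap.toSpanSingleton ℂ a).restrictScalars ℝ +
    (conjCLE : ℂ →L[ℝ] ℂ) ∘L ((ContinuousLinearMap.toSpanSingleton ℂ b).restrictScalars ℝ)

lemma harmLin_apply (a b v : ℂ) : harmLin a b v = v * a + (starRingEnd ℂ) (v * b) := by
  simp [harmLin]

lemma det_harmLin (a b : ℂ) : (harmLin a b).det = ‖a‖ ^ 2 - ‖b‖ ^ 2 := by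
  rw [det_eq_re_im, harmLin_apply, harmLin_apply, ← normSq_eq_norm_sq, ← normSq_eq_norm_sq,
    normSq_apply, normSq_apply]
  simp only [one_mul, add_re, add_im, conj_re, conj_im, mul_re, mul_im, I_re, I_im]
  ring

section
variable {h g : ℂ → ℂ} {z : ℂ}

lemma hasStrictFDerivAt_harm (hh : AnalyticAt ℂ h z) (hg : AnalyticAt ℂ g z) :
    HasStrictFDerivAt (harm h g) (harmLin (deriv h z) (deriv g z)) z :=
  (hh.hasStrictDerivAt.hasStrictFDerivAt.restrictScalars ℝ).add
    ((conjCLE : ℂ →L[ℝ] ℂ).hasStrictFDerivAt.comp z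
      (hg.hasStrictDerivAt.hasStrictFDerivAt.restrictScalars ℝ))

lemma nhds_le_map_harm (hh : AnalyticAt ℂ h z) (hg : AnalyticAt ℂ g z)
    (hne : ‖deriv h z‖ ≠ ‖deriv g z‖) : 𝓝 (harm h g z) ≤ map (harm h g) (𝓝 z) := by
  have hdet : (harmLin (deriv h z) (deriv g z)).det ≠ 0 := by
    rw [det_harmLin, sub_ne_zero]
    exact fun h' => hne ((pow_left_inj₀ (norm_nonneg _) (norm_nonneg _) two_ne_zero).1 h')
  have hs := hasStrictFDerivAt_harm hh hg
  rw [← ContinuousLinearMap.coe_toContinuousLinearEquivOfDetNeZero _ hdet] at hs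
  exact hs.map_nhds_eq_of_equiv.ge

end

lemma continuousAt_invFunOn {X Y : Type*} [TopologicalSpace X] [Nonempty X] [TopologicalSpace Y]
    {f : X → Y} {U : Set X} (hinj : InjOn f U) {x : X} (hx : U ∈ 𝓝 x)
    (hmap : 𝓝 (f x) ≤ map f (𝓝 x)) : ContinuousAt (Function.invFunOn f U) (f x) := by
  have hinv := hinj.leftInvOn_invFunOn
  rw [ContinuousAt, hinv (mem_of_mem_nhds hx)]
  refine Tendsto.mono_left (tendsto_map'_iff.2 (tendsto_id.congr' ?_)) hmap
  filter_upwards [hx] with y hy using (hinv hy).symm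

lemma image_invFunOn {X Y : Type*} [Nonempty X] {f : X → Y} {U : Set X} (hinj : InjOn f U)
    {C : Set Y} (hC : C ⊆ f '' U) : Function.invFunOn f U '' C = U ∩ f ⁻¹' C := by
  ext x
  constructor
  · rintro ⟨y, hy, rfl⟩
    refine ⟨Function.invFunOn_mem (hC hy), ?_⟩
    rwa [mem_preimage, Function.invFunOn_eq (hC hy)]
  · rintro ⟨hx, hfx⟩
    exact ⟨f x, hfx, hinj.leftInvOn_invFunOn hx⟩

section
variable {ψ : ℂ → ℂ} {U : Set ℂ} {z : ℂ}

lemma deriv_ne_zero_of_injOn (hU : IsOpen U) (hd : DifferentiableOn ℂ ψ U) (hinj : InjOn ψ U)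
    (hz : z ∈ U) : deriv ψ z ≠ 0 := by
  have := norm_deriv_ne_of_injOn (g := fun _ => 0) (hU.mem_nhds hz)
    (hd.analyticAt (hU.mem_nhds hz)) analyticAt_const
    (hinj.congr fun w _ => by simp only [harm, map_zero, add_zero])
  simpa using this

lemma hasDerivAt_invFunOn (hU : IsOpen U) (hd : DifferentiableOn ℂ ψ U) (hinj : InjOn ψ U)
    (hz : z ∈ U) : HasDerivAt (Function.invFunOn ψ U) (deriv ψ z)⁻¹ (ψ z) := by
  have hne := deriv_ne_zero_of_injOn hU hd hinj hz
  have hstrict := (hd.analyticAt (hU.mem_nhds hz)).hasStrictDerivAt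
  have hmap := hstrict.map_nhds_eq hne
  have hinv := hinj.leftInvOn_invFunOn
  refine HasDerivAt.of_local_left_inverse (f := ψ)
    (continuousAt_invFunOn hinj (hU.mem_nhds hz) hmap.ge) ?_ hne ?_
  · rw [hinv hz]; exact hstrict.hasDerivAt
  · rw [← hmap, eventually_map]
    filter_upwards [hU.mem_nhds hz] with x hx
    rw [hinv hx]

end

section
variable {h g : ℂ → ℂ} {U : Set ℂ}

lemma continuousOn_harm (hh : DifferentiableOn ℂ h U) (hg : DifferentiableOn ℂ g U) :
    ContinuousOn (harm h g) U :=
  hh.continuousOn.add (continuous_conj.comp_continuousOn hg.continuousOn)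

variable (hU : IsOpen U) (hh : DifferentiableOn ℂ h U) (hg : DifferentiableOn ℂ g U)
  (hinj : InjOn (harm h g) U)
include hU hh hg hinj

lemma norm_deriv_ne_of_injOn_of_mem {z : ℂ} (hz : z ∈ U) : ‖deriv h z‖ ≠ ‖deriv g z‖ :=
  norm_deriv_ne_of_injOn (hU.mem_nhds hz) (hh.analyticAt (hU.mem_nhds hz))
    (hg.analyticAt (hU.mem_nhds hz)) hinj

lemma nhds_le_map_harm_of_injOn {z : ℂ} (hz : z ∈ U) :
    𝓝 (harm h g z) ≤ map (harm h g) (𝓝 z) :=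
  nhds_le_map_harm (hh.analyticAt (hU.mem_nhds hz)) (hg.analyticAt (hU.mem_nhds hz))
    (norm_deriv_ne_of_injOn_of_mem hU hh hg hinj hz)

lemma isOpen_image_harm : IsOpen (harm h g '' U) := by
  rw [isOpen_iff_mem_nhds]
  rintro _ ⟨z, hz, rfl⟩
  exact nhds_le_map_harm_of_injOn hU hh hg hinj hz (image_mem_map (hU.mem_nhds hz))

lemma continuousOn_invFunOn_harm :
    ContinuousOn (Function.invFunOn (harm h g) U) (harm h g '' U) := by
  rintro _ ⟨z, hz, rfl⟩
  exact (continuousAt_invFunOn hinj (hU.mem_nhds hz)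
    (nhds_le_map_harm_of_injOn hU hh hg hinj hz)).continuousWithinAt

lemma isSimplyConnected_inter_preimage_harm {Ω : Set ℂ} (hΩ : Convex ℝ Ω) (hne : Ω.Nonempty)
    (hsub : Ω ⊆ harm h g '' U) : IsSimplyConnected (U ∩ harm h g ⁻¹' Ω) := by
  have hmem : ∀ w ∈ Ω, Function.invFunOn (harm h g) U w ∈ U ∩ harm h g ⁻¹' Ω := fun w hw =>
    image_invFunOn hinj hsub ▸ mem_image_of_mem _ hw
  let e : ↥(U ∩ harm h g ⁻¹' Ω) ≃ₜ Ω :=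
    { toFun := fun z => ⟨harm h g z, z.2.2⟩
      invFun := fun w => ⟨Function.invFunOn (harm h g) U w, hmem w w.2⟩
      left_inv := fun z => Subtype.ext (hinj.leftInvOn_invFunOn z.2.1)
      right_inv := fun w => Subtype.ext (Function.invFunOn_eq (hsub w.2))
      continuous_toFun :=
        (((continuousOn_harm hh hg).mono inter_subset_left).domRestrict).subtype_mk _
      continuous_invFun :=
        (((continuousOn_invFunOn_harm hU hh hg hinj).mono hsub).domRestrict).subtype_mk _ }
  have : ContractibleSpace Ω := hΩ.contractibleSpace hne
  have : ContractibleSpace ↥(U ∩ harm h g ⁻¹' Ω) := e.contractibleSpace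
  exact (inferInstance : SimplyConnectedSpace ↥(U ∩ harm h g ⁻¹' Ω))

lemma isCompact_inter_preimage_harm {C : Set ℂ} (hC : IsCompact C) (hsub : C ⊆ harm h g '' U) :
    IsCompact (U ∩ harm h g ⁻¹' C) := by
  rw [← image_invFunOn hinj hsub]
  exact hC.image_of_continuousOn ((continuousOn_invFunOn_harm hU hh hg hinj).mono hsub)

lemma isPathConnected_inter_preimage_harm {C : Set ℂ} (hC : Convex ℝ C) (hne : C.Nonempty)
    (hsub : C ⊆ harm h g '' U) : IsPathConnected (U ∩ harm h g ⁻¹' C) := by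
  rw [← image_invFunOn hinj hsub]
  exact (hC.isPathConnected hne).image' ((continuousOn_invFunOn_harm hU hh hg hinj).mono hsub)

lemma forall_norm_deriv_lt_or_forall_norm_deriv_lt (hpre : IsPreconnected U) :
    (∀ z ∈ U, ‖deriv g z‖ < ‖deriv h z‖) ∨ ∀ z ∈ U, ‖deriv h z‖ < ‖deriv g z‖ := by
  by_contra! hcon
  obtain ⟨⟨x, hx, hgx⟩, ⟨y, hy, hgy⟩⟩ := hcon
  obtain ⟨z, hz, heq⟩ := hpre.intermediate_value₂ hx hy (hh.deriv hU).continuousOn.norm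
    (hg.deriv hU).continuousOn.norm hgx hgy
  exact norm_deriv_ne_of_injOn_of_mem hU hh hg hinj hz heq

end

/-! ### Automorphisms of the disk -/

/-- The automorphism `z ↦ (z - c) / (1 - conj c * z)` of the unit disk. -/
noncomputable def diskAut (c z : ℂ) : ℂ := (z - c) / (1 - (starRingEnd ℂ) c * z)

section
variable {c z : ℂ}

lemma diskAut_self (c : ℂ) : diskAut c c = 0 := by simp [diskAut]

lemma diskAut_zero (c : ℂ) : diskAut c 0 = -c := by simp [diskAut]

lemma diskAut_denom_ne_zero (hc : ‖c‖ < 1) (hz : ‖z‖ < 1) : 1 - (starRingEnd ℂ) c * z ≠ 0 := by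
  intro h
  have h1 : ‖(starRingEnd ℂ) c * z‖ = 1 := by rw [← sub_eq_zero.1 h, norm_one]
  rw [norm_mul, norm_conj] at h1
  nlinarith [norm_nonneg c, norm_nonneg z]

lemma diskAut_eq_zero_iff (hc : ‖c‖ < 1) (hz : ‖z‖ < 1) : diskAut c z = 0 ↔ z = c := by
  rw [diskAut, div_eq_zero_iff, or_iff_left (diskAut_denom_ne_zero hc hz), sub_eq_zero]

lemma norm_diskAut_lt_one (hc : ‖c‖ < 1) (hz : ‖z‖ < 1) : ‖diskAut c z‖ < 1 := by
  have hid : normSq (1 - (starRingEnd ℂ) c * z) - normSq (z - c)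
      = (1 - normSq c) * (1 - normSq z) := by
    simp only [normSq_apply, sub_re, sub_im, mul_re, mul_im, conj_re, conj_im, one_re, one_im]
    ring
  rw [diskAut, norm_div, div_lt_one (norm_pos_iff.2 (diskAut_denom_ne_zero hc hz))]
  simp only [normSq_eq_norm_sq] at hid
  have hpos : 0 < (1 - ‖c‖ ^ 2) * (1 - ‖z‖ ^ 2) := by
    apply mul_pos <;> nlinarith [norm_nonneg c, norm_nonneg z]
  exact lt_of_pow_lt_pow_left₀ 2 (norm_nonneg _) (by linarith)

lemma mapsTo_diskAut (hc : ‖c‖ < 1) : MapsTo (diskAut c) (ball 0 1) (ball 0 1) := fun _ hz =>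
  mem_ball_zero_iff.2 (norm_diskAut_lt_one hc (mem_ball_zero_iff.1 hz))

lemma diskAut_neg_diskAut (hc : ‖c‖ < 1) (hz : ‖z‖ < 1) : diskAut (-c) (diskAut c z) = z := by
  have h1 := diskAut_denom_ne_zero hc hz
  have h2 : 1 - (starRingEnd ℂ) c * c ≠ 0 := diskAut_denom_ne_zero hc hc
  have hden : 1 - (starRingEnd ℂ) (-c) * diskAut c z =
      (1 - (starRingEnd ℂ) c * c) / (1 - (starRingEnd ℂ) c * z) := by
    rw [diskAut, map_neg]; field_simp; ring
  have hnum : diskAut c z - -c = z * (1 - (starRingEnd ℂ) c * c) / (1 - (starRingEnd ℂ) c * z) := by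
    rw [diskAut, sub_neg_eq_add, div_add' _ _ _ h1]; congr 1; ring
  rw [diskAut, hden, hnum, div_div_div_cancel_right₀ h1, mul_div_assoc, div_self h2, mul_one]

lemma hasDerivAt_diskAut (hc : ‖c‖ < 1) (hz : ‖z‖ < 1) : HasDerivAt (diskAut c)
    ((1 - (starRingEnd ℂ) c * c) / (1 - (starRingEnd ℂ) c * z) ^ 2) z := by
  have h1 := diskAut_denom_ne_zero hc hz
  refine (((hasDerivAt_id' z).sub_const c).fun_div
    (((hasDerivAt_id' z).const_mul ((starRingEnd ℂ) c)).const_sub 1) h1).congr_deriv ?_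
  field_simp
  ring

lemma differentiableOn_diskAut (hc : ‖c‖ < 1) : DifferentiableOn ℂ (diskAut c) (ball 0 1) :=
  fun _ hz =>
    (hasDerivAt_diskAut hc (mem_ball_zero_iff.1 hz)).differentiableAt.differentiableWithinAt

end

lemma one_sub_conj_mul_self (c : ℂ) : 1 - (starRingEnd ℂ) c * c = ((1 - ‖c‖ ^ 2 : ℝ) : ℂ) := by
  rw [mul_comm, mul_conj, normSq_eq_norm_sq]; push_cast; ring

/-- The **Schwarz–Pick lemma**. -/
theorem norm_deriv_mul_one_sub_sq_le_of_mapsTo_ball {ω : ℂ → ℂ}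
    (hd : DifferentiableOn ℂ ω (ball 0 1)) (hmaps : MapsTo ω (ball 0 1) (ball 0 1)) {z : ℂ}
    (hz : z ∈ ball 0 1) : ‖deriv ω z‖ * (1 - ‖z‖ ^ 2) ≤ 1 - ‖ω z‖ ^ 2 := by
  have hz1 : ‖-z‖ < 1 := by rw [norm_neg]; exact mem_ball_zero_iff.1 hz
  have hω1 : ‖ω z‖ < 1 := mem_ball_zero_iff.1 (hmaps hz)
  have hin : diskAut (-z) 0 = z := by rw [diskAut_zero, neg_neg]
  have hder : HasDerivAt (diskAut (ω z) ∘ ω ∘ diskAut (-z))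
      (((1 - ‖ω z‖ ^ 2 : ℝ) : ℂ)⁻¹ * (deriv ω z * ((1 - ‖z‖ ^ 2 : ℝ) : ℂ))) 0 := by
    have h1 := hasDerivAt_diskAut hz1 (z := 0) (by simp)
    have h2 := ((hd.differentiableAt (isOpen_ball.mem_nhds hz)).hasDerivAt)
    have h3 := hasDerivAt_diskAut hω1 hω1
    rw [one_sub_conj_mul_self] at h3
    rw [one_sub_conj_mul_self, norm_neg, mul_zero, sub_zero, one_pow, div_one] at h1
    refine (h3.comp_of_eq 0 (h2.comp_of_eq 0 h1 hin.symm) (congrArg ω hin.symm)).congr_deriv ?_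
    simp only [sq, ← div_div]
    rw [div_self (by exact_mod_cast (by nlinarith [norm_nonneg (ω z)] : 1 - ‖ω z‖ * ‖ω z‖ ≠ 0)),
      one_div]
  have hbound := norm_deriv_le_div_of_mapsTo_ball
    ((differentiableOn_diskAut hω1).comp (hd.comp (differentiableOn_diskAut hz1)
      (mapsTo_diskAut hz1)) (hmaps.comp (mapsTo_diskAut hz1)))
    (R₂ := 1) (fun w hw => by
      rw [Function.comp_apply, Function.comp_apply, hin, diskAut_self]
      exact ball_subset_closedBall (mapsTo_diskAut hω1 (hmaps (mapsTo_diskAut hz1 hw)))) one_pos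
  have hpos : 0 < 1 - ‖ω z‖ ^ 2 := by nlinarith [norm_nonneg (ω z)]
  have hpos' : 0 < 1 - ‖z‖ ^ 2 := by rw [norm_neg] at hz1; nlinarith [norm_nonneg z]
  rw [hder.deriv, norm_mul, norm_mul, norm_inv, norm_real, norm_real, Real.norm_of_nonneg hpos.le,
    Real.norm_of_nonneg hpos'.le, div_one, inv_mul_le_iff₀ hpos, mul_one] at hbound
  exact hbound

lemma norm_lt_norm_of_mapsTo_ball_of_eq_zero {f : ℂ → ℂ} (hd : DifferentiableOn ℂ f (ball 0 1))
    (hmaps : MapsTo f (ball 0 1) (ball 0 1)) (h0 : f 0 = 0) {b : ℂ} (hb : b ∈ ball 0 1)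
    (hb0 : b ≠ 0) (hfb : f b = 0) {ζ : ℂ} (hζ : ζ ∈ ball 0 1) (hζ0 : ζ ≠ 0) : ‖f ζ‖ < ‖ζ‖ := by
  have hmaps' : MapsTo f (ball 0 1) (closedBall 0 1) := fun z hz =>
    ball_subset_closedBall (hmaps hz)
  refine lt_of_le_of_ne
    (norm_le_norm_of_mapsTo_ball hd hmaps' h0 (mem_ball_zero_iff.1 hζ)) fun heq => ?_
  have hslope : ‖dslope f 0 ζ‖ = 1 / 1 := by
    rw [dslope_of_ne _ hζ0, slope_def_field, h0, sub_zero, sub_zero, norm_div, heq,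
      div_self (norm_ne_zero_iff.2 hζ0), div_one]
  have haffine := affine_of_mapsTo_ball_of_norm_dslope_eq_div hd (by rwa [h0]) hζ hslope hb
  simp only [hfb, h0, sub_zero, zero_add, smul_eq_mul] at haffine
  rcases mul_eq_zero.1 haffine.symm with h | h
  · exact hb0 h
  · rw [h] at hslope; simp at hslope

/-! ### The Riemann mapping theorem for subdomains of the disk -/

lemma tendstoLocallyUniformlyOn_of_norm_le_one {U : Set ℂ} (hU : IsOpen U) {l : Filter (ℂ → ℂ)}
    [l.NeBot] {ψ : ℂ → ℂ} (hl : Tendsto id l (𝓝 ψ))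
    (hd : ∀ᶠ F in l, DifferentiableOn ℂ F U ∧ ∀ z, ‖F z‖ ≤ 1) :
    TendstoLocallyUniformlyOn (fun F : ℂ → ℂ => F) ψ l U := by
  rw [Metric.tendstoLocallyUniformlyOn_iff]
  intro ε hε x hx
  obtain ⟨r, hr, hball⟩ := Metric.isOpen_iff.1 hU x hx
  have hpt : ∀ z, Tendsto (fun F : ℂ → ℂ => F z) l (𝓝 (ψ z)) := tendsto_pi_nhds.1 hl
  have hlip : ∀ᶠ F in l, ∀ y ∈ ball x r, dist (F y) (F x) ≤ 2 / r * dist y x := by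
    filter_upwards [hd] with F hF y hy
    refine dist_le_div_mul_dist_of_mapsTo_ball (hF.1.mono hball) (fun w _ => ?_) hy
    rw [mem_closedBall, dist_eq_norm]
    linarith [norm_sub_le (F w) (F x), hF.2 w, hF.2 x]
  have hlim : ∀ y ∈ ball x r, dist (ψ y) (ψ x) ≤ 2 / r * dist y x := by
    intro y hy
    refine le_of_tendsto ((hpt y).dist (hpt x)) ?_
    filter_upwards [hlip] with F hF using hF y hy
  refine ⟨ball x (min r (ε * r / 8)),
    mem_nhdsWithin_of_mem_nhds (ball_mem_nhds _ (by positivity)), ?_⟩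
  filter_upwards [hlip, Metric.tendsto_nhds.1 (hpt x) (ε / 4) (by positivity)] with F hF hFx y hy
  rw [mem_ball, lt_min_iff] at hy
  have hsmall : 2 / r * dist y x ≤ ε / 4 := by
    rw [div_mul_eq_mul_div, div_le_iff₀ hr]; linarith
  have htri := dist_triangle4 (ψ y) (ψ x) (F x) (F y)
  rw [dist_comm (ψ x) (F x), dist_comm (F x) (F y)] at htri
  linarith [hF y hy.1, hlim y hy.1]

lemma exists_sphere_norm_sub_ge {U : Set ℂ} (hU : IsOpen U) {ψ : ℂ → ℂ} (hψ : ContinuousOn ψ U)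
    {x y : ℂ} (hy : y ∈ U) (hne : x ≠ y) (hiso : ∀ᶠ z in 𝓝[≠] y, ψ z ≠ ψ y) :
    ∃ r > 0, ∃ η > 0, closedBall y r ⊆ U ∧ x ∉ closedBall y r ∧
      ∀ z ∈ sphere y r, η ≤ dist (ψ z) (ψ y) := by
  have hnhds : ∀ᶠ z in 𝓝 y, z ∈ U ∧ z ≠ x ∧ (z ∈ ({y}ᶜ : Set ℂ) → ψ z ≠ ψ y) :=
    (hU.eventually_mem hy).and
      ((eventually_ne_nhds hne.symm).and (eventually_nhdsWithin_iff.1 hiso))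
  obtain ⟨r, hr, hball⟩ := nhds_basis_closedBall.eventually_iff.1 hnhds
  obtain ⟨z₁, hz₁, hmin⟩ := (isCompact_sphere y r).exists_isMinOn
    (NormedSpace.sphere_nonempty.2 hr.le) (f := fun z => dist (ψ z) (ψ y))
    (continuous_id.dist continuous_const |>.comp_continuousOn
      (hψ.mono fun z hz => (hball (sphere_subset_closedBall hz)).1))
  exact ⟨r, hr, dist (ψ z₁) (ψ y),
    dist_pos.2 ((hball (sphere_subset_closedBall hz₁)).2.2 (ne_of_mem_sphere hz₁ hr.ne')),
    fun z hz => (hball hz).1, fun hx => (hball hx).2.1 rfl, fun z hz => hmin hz⟩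

lemma ball_subset_image_closedBall_of_injOn {F : ℂ → ℂ} {y : ℂ} {r η : ℝ} (hr : 0 < r)
    {U : Set ℂ} (hU : IsOpen U) (hrU : closedBall y r ⊆ U) (hd : DifferentiableOn ℂ F U)
    (hinj : InjOn F U) (hη : ∀ z ∈ sphere y r, η ≤ dist (F z) (F y)) :
    ball (F y) (η / 2) ⊆ F '' closedBall y r := by
  have hy : y ∈ U := hrU (mem_closedBall_self hr.le)
  refine DiffContOnCl.ball_subset_image_closedBall ((hd.mono hrU).diffContOnCl_ball subset_rfl) hr
    (fun z hz => dist_eq_norm (F z) (F y) ▸ hη z hz) ?_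
  have hne : ∀ᶠ z in 𝓝[≠] y, F z ≠ F y := by
    filter_upwards [mem_nhdsWithin_of_mem_nhds (hU.mem_nhds hy), self_mem_nhdsWithin] with z hz hzy
    exact fun h => hzy (hinj hz hy h)
  exact hne.frequently.filter_mono nhdsWithin_le_nhds

/-- **Hurwitz's theorem** for injective functions. -/
theorem injOn_of_tendstoLocallyUniformlyOn {ι : Type*} {U : Set ℂ} (hU : IsOpen U)
    (hUc : IsPreconnected U) {l : Filter ι} [l.NeBot] {F : ι → ℂ → ℂ} {ψ : ℂ → ℂ}
    (hl : TendstoLocallyUniformlyOn F ψ l U)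
    (hF : ∀ᶠ i in l, DifferentiableOn ℂ (F i) U ∧ InjOn (F i) U)
    {a b : ℂ} (ha : a ∈ U) (hb : b ∈ U) (hab : ψ a ≠ ψ b) : InjOn ψ U := by
  have hd : DifferentiableOn ℂ ψ U := hl.differentiableOn (hF.mono fun _ h => h.1) hU
  intro x hx y hy hxy
  by_contra hne
  have han : AnalyticOnNhd ℂ ψ U := hd.analyticOnNhd hU
  have hiso : ∀ᶠ z in 𝓝[≠] y, ψ z ≠ ψ y :=
    ((han y hy).eventually_eq_or_eventually_ne analyticAt_const).resolve_left fun h => by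
      have hconst := han.eqOn_of_preconnected_of_eventuallyEq analyticOnNhd_const hUc hy h
      exact hab ((hconst ha).trans (hconst hb).symm)
  obtain ⟨r, hr, η, hη, hrU, hxr, hsphere⟩ :=
    exists_sphere_norm_sub_ge hU hd.continuousOn hy hne hiso
  have hunif : ∀ K ⊆ U, IsCompact K → ∀ᶠ i in l, ∀ z ∈ K, dist (ψ z) (F i z) < η / 16 :=
    fun K hK hKc => Metric.tendstoUniformlyOn_iff.1
      ((tendstoLocallyUniformlyOn_iff_forall_isCompact hU).1 hl K hK hKc) _ (by positivity)
  obtain ⟨i, ⟨hball, hpoint⟩, hFd, hFi⟩ := (((hunif _ hrU (isCompact_closedBall y r)).and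
    (hunif {x} (singleton_subset_iff.2 hx) isCompact_singleton)).and hF).exists
  have hy' := hball y (mem_closedBall_self hr.le)
  have hx' := hpoint x rfl
  have hsphere' : ∀ z ∈ sphere y r, η / 2 ≤ dist (F i z) (F i y) := by
    intro z hz
    have hz' := hball z (sphere_subset_closedBall hz)
    have htri := dist_triangle4 (ψ z) (F i z) (F i y) (ψ y)
    rw [dist_comm (F i y)] at htri
    linarith [hsphere z hz]
  have hmem : F i x ∈ ball (F i y) (η / 2 / 2) := by
    have htri := dist_triangle (F i x) (ψ x) (F i y)
    rw [dist_comm (F i x) (ψ x), hxy] at htri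
    rw [hxy] at hx'
    rw [mem_ball]
    linarith
  obtain ⟨z, hz, hzx⟩ := ball_subset_image_closedBall_of_injOn hr hU hrU hFd hFi hsphere' hmem
  exact hxr (hFi (hrU hz) hx hzx ▸ hz)

lemma differentiableOn_of_sq_eq {U : Set ℂ} (hU : IsOpen U) {s G : ℂ → ℂ} (hs : ContinuousOn s U)
    (hG : DifferentiableOn ℂ G U) (h : ∀ z ∈ U, s z ^ 2 = G z) (h0 : ∀ z ∈ U, G z ≠ 0) :
    DifferentiableOn ℂ s U := by
  intro z hz
  have hs0 : s z ≠ 0 := fun h' => h0 z hz (by rw [← h z hz, h', zero_pow two_ne_zero])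
  have hpow : HasStrictDerivAt (fun w : ℂ => w ^ 2) (2 * s z) (s z) := by
    simpa using hasStrictDerivAt_pow 2 (s z)
  have hne : 2 * s z ≠ 0 := mul_ne_zero two_ne_zero hs0
  have hloc : ∀ᶠ x in 𝓝 z, hpow.localInverse _ _ _ hne (G x) = s x := by
    have hc : ContinuousAt s z := hs.continuousAt (hU.mem_nhds hz)
    filter_upwards [hc.eventually (hpow.hasStrictFDerivAt_equiv hne).eventually_left_inverse,
      hU.mem_nhds hz] with x hx hxU
    rw [← h x hxU]
    exact hx
  have hinv : DifferentiableAt ℂ (hpow.localInverse _ _ _ hne) (G z) := by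
    rw [← h z hz]; exact (hpow.to_localInverse hne).hasDerivAt.differentiableAt
  exact ((hinv.comp z (hG.differentiableAt (hU.mem_nhds hz))).congr_of_eventuallyEq
    (hloc.mono fun _ hx => hx.symm)).differentiableWithinAt

/-- The competitors in the extremal problem behind the Riemann mapping theorem: injective
holomorphic maps of `U` into the closed unit disk fixing `0` and not moving `a` towards `0`. They
are required to be bounded by `1` also outside `U`, which makes them a subset of a compact product
of disks. -/
def extremalFamily (U : Set ℂ) (a : ℂ) : Set (ℂ → ℂ) :=
  {ψ | DifferentiableOn ℂ ψ U ∧ (∀ z, ‖ψ z‖ ≤ 1) ∧ InjOn ψ U ∧ ψ 0 = 0 ∧ ‖a‖ ≤ ‖ψ a‖}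

section
variable {U : Set ℂ} {a : ℂ}

lemma indicator_mem_extremalFamily {χ : ℂ → ℂ} (hd : DifferentiableOn ℂ χ U)
    (hmaps : MapsTo χ U (ball 0 1)) (hinj : InjOn χ U) (h0 : χ 0 = 0) (ha : a ∈ U)
    (hχa : ‖a‖ ≤ ‖χ a‖) : U.indicator χ ∈ extremalFamily U a := by
  have heq : EqOn (U.indicator χ) χ U := eqOn_indicator
  refine ⟨hd.congr heq, fun z => ?_, hinj.congr heq.symm, ?_, (heq ha).symm ▸ hχa⟩
  · by_cases hz : z ∈ U
    · rw [heq hz]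
      exact (mem_ball_zero_iff.1 (hmaps hz)).le
    · simp [hz]
  · exact indicator_apply_eq_zero.2 fun _ => h0

lemma isClosed_extremalFamily (hU : IsOpen U) (hUc : IsPreconnected U) (h0 : (0 : ℂ) ∈ U)
    (ha : a ∈ U) (ha0 : a ≠ 0) : IsClosed (extremalFamily U a) := by
  refine isClosed_of_closure_subset fun ψ hψ => ?_
  rw [mem_closure_iff_clusterPt] at hψ
  set l : Filter (ℂ → ℂ) := 𝓝 ψ ⊓ 𝓟 (extremalFamily U a)
  have : l.NeBot := hψ
  have hl : Tendsto id l (𝓝 ψ) := inf_le_left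
  have hK : ∀ᶠ F in l, F ∈ extremalFamily U a := mem_inf_of_right (mem_principal_self _)
  have hpt : ∀ z, Tendsto (fun F : ℂ → ℂ => F z) l (𝓝 (ψ z)) := tendsto_pi_nhds.1 hl
  have hloc := tendstoLocallyUniformlyOn_of_norm_le_one hU hl (hK.mono fun F h => ⟨h.1, h.2.1⟩)
  have hψ0 : ψ 0 = 0 := tendsto_nhds_unique (hpt 0)
    (tendsto_const_nhds.congr' (hK.mono fun F h => h.2.2.2.1.symm))
  have hψa : ‖a‖ ≤ ‖ψ a‖ := ge_of_tendsto (hpt a).norm (hK.mono fun F h => h.2.2.2.2)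
  have hne : ψ a ≠ ψ 0 := by
    rw [hψ0]
    exact norm_pos_iff.1 ((norm_pos_iff.2 ha0).trans_le hψa)
  exact ⟨hloc.differentiableOn (hK.mono fun F h => h.1) hU,
    fun z => le_of_tendsto (hpt z).norm (hK.mono fun F h => h.2.1 z),
    injOn_of_tendstoLocallyUniformlyOn hU hUc hloc (hK.mono fun F h => ⟨h.1, h.2.2.1⟩) ha h0 hne,
    hψ0, hψa⟩

lemma isCompact_extremalFamily (hU : IsOpen U) (hUc : IsPreconnected U) (h0 : (0 : ℂ) ∈ U)
    (ha : a ∈ U) (ha0 : a ≠ 0) : IsCompact (extremalFamily U a) :=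
  (isCompact_univ_pi fun _ : ℂ => isCompact_closedBall (0 : ℂ) 1).of_isClosed_subset
    (isClosed_extremalFamily hU hUc h0 ha ha0)
    fun _ hψ z _ => mem_closedBall_zero_iff.2 (hψ.2.1 z)

lemma mapsTo_ball_of_mem_extremalFamily (hU : IsOpen U) (hUc : IsPreconnected U)
    (h0 : (0 : ℂ) ∈ U) (ha : a ∈ U) (ha0 : a ≠ 0) {ψ : ℂ → ℂ} (hψ : ψ ∈ extremalFamily U a) :
    MapsTo ψ U (ball 0 1) := by
  obtain ⟨hd, hb, -, hψ0, hψa⟩ := hψ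
  have hopen : IsOpen (ψ '' U) := by
    rcases (hd.analyticOnNhd hU).is_constant_or_isOpen hUc with ⟨w, hw⟩ | h
    · have hzero : ψ a = 0 := (hw a ha).trans ((hw 0 h0).symm.trans hψ0)
      rw [hzero, norm_zero] at hψa
      exact absurd (norm_le_zero_iff.1 hψa) ha0
    · exact h U subset_rfl hU
  have hsub : ψ '' U ⊆ interior (closedBall 0 1) := interior_maximal
    (by rintro _ ⟨z, -, rfl⟩; exact mem_closedBall_zero_iff.2 (hb z)) hopen
  rw [interior_closedBall _ one_ne_zero] at hsub
  exact fun z hz => hsub (mem_image_of_mem ψ hz)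

end

lemma norm_sq_lt_one {u : ℂ} (hu : ‖u‖ < 1) : ‖u ^ 2‖ < 1 := by
  rw [norm_pow]
  exact pow_lt_one₀ (norm_nonneg _) hu two_ne_zero

/-- The inverse of a Koebe square-root step has two zeros, `0` and `diskAut c (-c)`, so it strictly
contracts towards `0`. -/
lemma norm_diskAut_sq_diskAut_lt {w c ζ : ℂ} (hw : ‖w‖ < 1) (hc : ‖c‖ < 1) (hcw : c ^ 2 = -w)
    (hc0 : c ≠ 0) (hζ : ‖ζ‖ < 1) (hζ0 : ζ ≠ 0) : ‖diskAut (-w) (diskAut (-c) ζ ^ 2)‖ < ‖ζ‖ := by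
  have hw' : ‖-w‖ < 1 := by rwa [norm_neg]
  have hc' : ‖-c‖ < 1 := by rwa [norm_neg]
  have hmaps : MapsTo (fun ζ => diskAut (-c) ζ ^ 2) (ball 0 1) (ball 0 1) := fun z hz =>
    mem_ball_zero_iff.2 (norm_sq_lt_one (norm_diskAut_lt_one hc' (mem_ball_zero_iff.1 hz)))
  refine norm_lt_norm_of_mapsTo_ball_of_eq_zero
    (f := fun ζ => diskAut (-w) (diskAut (-c) ζ ^ 2)) (b := diskAut c (-c))
    ((differentiableOn_diskAut hw').comp ((differentiableOn_diskAut hc').pow 2) hmaps)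
    ((mapsTo_diskAut hw').comp hmaps) ?_ (mapsTo_diskAut hc (mem_ball_zero_iff.2 hc')) ?_ ?_
    (mem_ball_zero_iff.2 hζ) hζ0
  · simp only [diskAut_zero, neg_neg, hcw, diskAut_self]
  · rw [Ne, diskAut_eq_zero_iff hc hc', neg_eq_iff_add_eq_zero, ← two_mul]
    exact mul_ne_zero two_ne_zero hc0
  · simp only [diskAut_neg_diskAut hc hc', neg_sq, hcw, diskAut_self]

section
variable {U : Set ℂ} {ψ : ℂ → ℂ} {w : ℂ}

lemma exists_sq_eq_diskAut_comp (hU : IsOpen U) (hsc : IsSimplyConnected U)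
    (hd : DifferentiableOn ℂ ψ U) (hmaps : MapsTo ψ U (ball 0 1)) (hw : w ∈ ball 0 1 \ ψ '' U) :
    ∃ s : ℂ → ℂ, DifferentiableOn ℂ s U ∧ ∀ z, s z ^ 2 = diskAut w (ψ z) := by
  have hw1 : ‖w‖ < 1 := mem_ball_zero_iff.1 hw.1
  have hG : DifferentiableOn ℂ (fun z => diskAut w (ψ z)) U :=
    (differentiableOn_diskAut hw1).comp hd hmaps
  have hG0 : ∀ z ∈ U, diskAut w (ψ z) ≠ 0 := fun z hz h =>
    hw.2 ⟨z, hz, (diskAut_eq_zero_iff hw1 (mem_ball_zero_iff.1 (hmaps hz))).1 h⟩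
  obtain ⟨s, hs, hsq⟩ := exists_continuousOn_pow_eq hsc hU hG.continuousOn
    (by rintro ⟨z, hz, h⟩; exact hG0 z hz h) two_ne_zero
  exact ⟨s, differentiableOn_of_sq_eq hU hs hG (fun z _ => hsq z) hG0, hsq⟩

/-- Koebe's square-root step. -/
lemma exists_norm_lt_of_notMem_image (hU : IsOpen U) (hsc : IsSimplyConnected U)
    (h0 : (0 : ℂ) ∈ U) (hd : DifferentiableOn ℂ ψ U) (hmaps : MapsTo ψ U (ball 0 1))
    (hinj : InjOn ψ U) (hψ0 : ψ 0 = 0) (hw : w ∈ ball 0 1 \ ψ '' U) :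
    ∃ χ : ℂ → ℂ, DifferentiableOn ℂ χ U ∧ MapsTo χ U (ball 0 1) ∧ InjOn χ U ∧ χ 0 = 0 ∧
      ∀ z ∈ U, z ≠ 0 → ‖ψ z‖ < ‖χ z‖ := by
  obtain ⟨s, hsd, hsq⟩ := exists_sq_eq_diskAut_comp hU hsc hd hmaps hw
  have hw1 : ‖w‖ < 1 := mem_ball_zero_iff.1 hw.1
  have hψ1 : ∀ z ∈ U, ‖ψ z‖ < 1 := fun z hz => mem_ball_zero_iff.1 (hmaps hz)
  have hs1 : MapsTo s U (ball 0 1) := fun z hz => mem_ball_zero_iff.2 <| by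
    have h1 := norm_diskAut_lt_one hw1 (hψ1 z hz)
    rw [← hsq, norm_pow] at h1
    exact (pow_lt_one_iff_of_nonneg (norm_nonneg _) two_ne_zero).1 h1
  have hc : ‖s 0‖ < 1 := mem_ball_zero_iff.1 (hs1 h0)
  have hc2 : s 0 ^ 2 = -w := by rw [hsq, hψ0, diskAut_zero]
  have hc0 : s 0 ≠ 0 := fun h => hw.2 ⟨0, h0, by
    rw [hψ0, eq_comm, ← neg_eq_zero, ← hc2, h, zero_pow two_ne_zero]⟩
  have hmapsχ : MapsTo (diskAut (s 0) ∘ s) U (ball 0 1) := (mapsTo_diskAut hc).comp hs1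
  have hχ0 : (diskAut (s 0) ∘ s) 0 = 0 := diskAut_self _
  have hback : ∀ z ∈ U, diskAut (-w) (diskAut (-(s 0)) ((diskAut (s 0) ∘ s) z) ^ 2) = ψ z := by
    intro z hz
    rw [Function.comp_apply, diskAut_neg_diskAut hc (mem_ball_zero_iff.1 (hs1 hz)), hsq,
      diskAut_neg_diskAut hw1 (hψ1 z hz)]
  have hinjχ : InjOn (diskAut (s 0) ∘ s) U := fun x hx y hy h =>
    hinj hx hy (by rw [← hback x hx, ← hback y hy, h])
  refine ⟨diskAut (s 0) ∘ s, (differentiableOn_diskAut hc).comp hsd hs1, hmapsχ, hinjχ, hχ0,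
    fun z hz hz0 => ?_⟩
  rw [← hback z hz]
  exact norm_diskAut_sq_diskAut_lt hw1 hc hc2 hc0 (mem_ball_zero_iff.1 (hmapsχ hz))
    fun h => hz0 (hinjχ hz h0 (h.trans hχ0.symm))

theorem exists_bijOn_ball (hU : IsOpen U) (hsc : IsSimplyConnected U) (hsub : U ⊆ ball 0 1)
    (h0 : (0 : ℂ) ∈ U) :
    ∃ ψ : ℂ → ℂ, DifferentiableOn ℂ ψ U ∧ BijOn ψ U (ball 0 1) ∧ ψ 0 = 0 := by
  have hUc : IsPreconnected U := hsc.isPathConnected.isConnected.isPreconnected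
  obtain ⟨a, ha0, ha⟩ : ∃ a : ℂ, a ≠ 0 ∧ a ∈ U :=
    ((eventually_mem_nhdsWithin (a := (0 : ℂ)) (s := {0}ᶜ)).and
      (mem_nhdsWithin_of_mem_nhds (hU.mem_nhds h0))).exists
  have hne : (extremalFamily U a).Nonempty := ⟨_, indicator_mem_extremalFamily
    differentiableOn_id hsub (injOn_id U) rfl ha le_rfl⟩
  obtain ⟨ψ, hψ, hmax⟩ := (isCompact_extremalFamily hU hUc h0 ha ha0).exists_isMaxOn hne
    (f := fun ψ : ℂ → ℂ => ‖ψ a‖) (continuous_apply a).norm.continuousOn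
  have hmaps := mapsTo_ball_of_mem_extremalFamily hU hUc h0 ha ha0 hψ
  obtain ⟨hd, -, hinj, hψ0, hψa⟩ := hψ
  refine ⟨ψ, hd, ⟨hmaps, hinj, fun w hw => ?_⟩, hψ0⟩
  by_contra hwn
  obtain ⟨χ, hχd, hχmaps, hχinj, hχ0, hlt⟩ :=
    exists_norm_lt_of_notMem_image hU hsc h0 hd hmaps hinj hψ0 ⟨hw, hwn⟩
  have hle : ‖U.indicator χ a‖ ≤ ‖ψ a‖ := hmax (indicator_mem_extremalFamily hχd hχmaps hχinj hχ0 ha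
    (hψa.trans (hlt a ha ha0).le))
  rw [indicator_of_mem ha] at hle
  exact (hlt a ha ha0).not_ge hle

lemma bijOn_mul_left_ball {𝕜 : Type*} [NormedField 𝕜] {u : 𝕜} (hu : ‖u‖ = 1) (r : ℝ) :
    BijOn (fun z => u * z) (ball 0 r) (ball 0 r) := by
  have hu0 : u ≠ 0 := norm_ne_zero_iff.1 (hu ▸ one_ne_zero)
  refine ⟨fun z hz => ?_, (mul_right_injective₀ hu0).injOn, fun z hz => ⟨u⁻¹ * z, ?_, ?_⟩⟩
  · rwa [mem_ball_zero_iff, norm_mul, hu, one_mul, ← mem_ball_zero_iff]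
  · rwa [mem_ball_zero_iff, norm_mul, norm_inv, hu, inv_one, one_mul, ← mem_ball_zero_iff]
  · exact mul_inv_cancel_left₀ hu0 z

/-- The **Riemann mapping theorem** for simply connected subdomains of the disk. -/
theorem exists_riemannMap (hU : IsOpen U) (hsc : IsSimplyConnected U) (hsub : U ⊆ ball 0 1)
    (h0 : (0 : ℂ) ∈ U) : ∃ ψ : ℂ → ℂ, DifferentiableOn ℂ ψ (ball 0 1) ∧ BijOn ψ (ball 0 1) U ∧
      ψ 0 = 0 ∧ deriv ψ 0 = (‖deriv ψ 0‖ : ℂ) := by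
  obtain ⟨φ, hφd, hφ, hφ0⟩ := exists_bijOn_ball hU hsc hsub h0
  set ψ : ℂ → ℂ := Function.invFunOn φ U
  have hinv : InvOn ψ φ U (ball 0 1) := hφ.invOn_invFunOn
  have hψ : BijOn ψ (ball 0 1) U := hφ.symm hinv.symm
  have hψd : DifferentiableOn ℂ ψ (ball 0 1) := by
    intro w hw
    have hder := hasDerivAt_invFunOn hU hφd hφ.injOn (hψ.mapsTo hw)
    rw [hinv.2 hw] at hder
    exact hder.differentiableAt.differentiableWithinAt
  have hψ0 : ψ 0 = 0 := by rw [← hφ0, hinv.1 h0, hφ0]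
  have hzero : (0 : ℂ) ∈ ball (0 : ℂ) 1 := mem_ball_self one_pos
  set c : ℂ := deriv ψ 0
  have hc : c ≠ 0 := deriv_ne_zero_of_injOn isOpen_ball hψd hψ.injOn hzero
  set u : ℂ := ‖c‖ / c
  have hu : ‖u‖ = 1 := by rw [norm_div, norm_real, norm_norm, div_self (norm_ne_zero_iff.2 hc)]
  have hrot := bijOn_mul_left_ball hu 1
  have hder : HasDerivAt (ψ ∘ fun z => u * z) (‖c‖ : ℂ) 0 := by
    have h1 : HasDerivAt ψ c (u * 0) := by
      rw [mul_zero]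
      exact (hψd.differentiableAt (isOpen_ball.mem_nhds hzero)).hasDerivAt
    refine (h1.comp 0 ((hasDerivAt_id' 0).const_mul u)).congr_deriv ?_
    rw [mul_one, mul_div_cancel₀ _ hc]
  refine ⟨ψ ∘ fun z => u * z, hψd.comp (by fun_prop) hrot.mapsTo, hψ.comp hrot, ?_, ?_⟩
  · rw [Function.comp_apply, mul_zero, hψ0]
  · rw [hder.deriv, norm_real, norm_norm]

end

/-! ### Radial limits -/

/-- The function `u` on the unit disk has the limit `L` along the radius ending at the boundary
point `ζ`. -/
def HasRadialLimit {E : Type*} [TopologicalSpace E] (u : ℂ → E) (ζ : ℂ) (L : E) : Prop :=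
  Tendsto (fun r : ℝ => u (r * ζ)) (𝓝[<] 1) (𝓝 L)

lemma volume_image_eq_lintegral_enorm_deriv_sq {ψ : ℂ → ℂ} {U : Set ℂ} (hU : IsOpen U)
    (hd : DifferentiableOn ℂ ψ U) (hinj : InjOn ψ U) :
    volume (ψ '' U) = ∫⁻ z in U, ‖deriv ψ z‖ₑ ^ 2 := by
  have hharm : harm ψ 0 = ψ := by ext z; simp [harm]
  have hder : ∀ z ∈ U, HasFDerivWithinAt ψ (harmLin (deriv ψ z) 0) U z := by
    intro z hz
    have h := hasStrictFDerivAt_harm (hd.analyticAt (hU.mem_nhds hz))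
      (analyticAt_const (v := (0 : ℂ)))
    rw [deriv_const] at h
    exact (hharm ▸ h.hasFDerivAt).hasFDerivWithinAt
  rw [← lintegral_abs_det_fderiv_eq_addHaar_image volume hU.measurableSet hder hinj]
  congr with z
  rw [det_harmLin, norm_zero, zero_pow two_ne_zero, sub_zero, abs_of_nonneg (sq_nonneg _),
    ENNReal.ofReal_pow (norm_nonneg _), ofReal_norm]

lemma ae_lintegral_radius_lt_top {f : ℂ → ENNReal} (hf : Measurable f)
    (hfin : ∫⁻ z, f z ≠ ⊤) : ∀ᵐ θ : ℝ ∂volume.restrict (Ioo (-Real.pi) Real.pi),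
      ∫⁻ r in Ioi (0 : ℝ), ENNReal.ofReal r * f (r * exp (θ * I)) < ⊤ := by
  have hmeas : Measurable fun p : ℝ × ℝ => ENNReal.ofReal p.1 * f (p.1 * exp (p.2 * I)) := by
    fun_prop
  have hpolar : ∫⁻ p in Ioi (0 : ℝ) ×ˢ Ioo (-Real.pi) Real.pi,
      ENNReal.ofReal p.1 * f (p.1 * exp (p.2 * I)) = ∫⁻ z, f z := by
    simp only [← Complex.lintegral_comp_polarCoord_symm f, Complex.polarCoord_symm_apply,
      exp_mul_I, smul_eq_mul, ofReal_cos, ofReal_sin]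
    rfl
  rw [Measure.volume_eq_prod, ← Measure.prod_restrict, lintegral_prod_symm _ hmeas.aemeasurable]
    at hpolar
  exact ae_lt_top hmeas.lintegral_prod_left' (hpolar ▸ hfin)

lemma ae_of_periodic {P : ℝ → Prop} {T a : ℝ} (hT : 0 < T) (hP : Function.Periodic P T)
    (h : ∀ᵐ x ∂volume.restrict (Ioc a (a + T)), P x) : ∀ᵐ x, P x := by
  have hnull : volume ({x | ¬ P x} ∩ Ioc a (a + T)) = 0 := by
    simp only [ae_restrict_iff' measurableSet_Ioc, ae_iff, Classical.not_imp, and_comm] at h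
    exact h
  refine (isAddFundamentalDomain_Ioc hT a).measure_zero_of_invariant _ (fun g => ?_) hnull
  obtain ⟨n, hn⟩ := AddSubgroup.mem_zmultiples_iff.1 g.2
  ext x
  rw [mem_vadd_set_iff_neg_vadd_mem]
  have hx : P (-g +ᵥ x) = P x := by
    rw [AddSubgroup.vadd_def, vadd_eq_add, AddSubgroup.coe_neg, ← hn, neg_add_eq_sub]
    exact hP.sub_zsmul_eq n
  exact not_congr hx.to_iff

lemma exists_tendsto_nhdsLT_of_intervalIntegrable_deriv {E : Type*} [NormedAddCommGroup E]
    [NormedSpace ℝ E] [CompleteSpace E] {γ γ' : ℝ → E} {a b : ℝ} (hab : a < b)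
    (hγ : ∀ x ∈ Ico a b, HasDerivAt γ (γ' x) x) (hint : IntervalIntegrable γ' volume a b) :
    ∃ L, Tendsto γ (𝓝[<] b) (𝓝 L) := by
  have hprim : ContinuousOn (fun x => ∫ t in a..x, γ' t) (uIcc a b) :=
    intervalIntegral.continuousOn_primitive_interval' hint left_mem_uIcc
  rw [uIcc_of_le hab.le] at hprim
  have hlim : Tendsto (fun x => γ a + ∫ t in a..x, γ' t) (𝓝[Ico a b] b)
      (𝓝 (γ a + ∫ t in a..b, γ' t)) :=
    ((hprim b (right_mem_Icc.2 hab.le)).mono Ico_subset_Icc_self).const_add _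
  rw [nhdsWithin_Ico_eq_nhdsLT hab] at hlim
  refine ⟨_, hlim.congr' ?_⟩
  filter_upwards [Ico_mem_nhdsLT hab] with x hx
  rw [intervalIntegral.integral_eq_sub_of_hasDerivAt (f := γ), add_sub_cancel]
  · rw [uIcc_of_le hx.1]
    exact fun t ht => hγ t ⟨ht.1, ht.2.trans_lt hx.2⟩
  · exact hint.mono_set (uIcc_subset_uIcc_left (by rw [uIcc_of_le hab.le]; exact ⟨hx.1, hx.2.le⟩))

section
variable {ψ : ℂ → ℂ} {θ : ℝ}

lemma norm_ofReal_mul_exp_mul_I (r : ℝ) : ‖(r * exp (θ * I) : ℂ)‖ = |r| := by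
  rw [norm_mul, norm_exp_ofReal_mul_I, mul_one, norm_real, Real.norm_eq_abs]

lemma ofReal_mul_exp_mul_I_mem_ball {r : ℝ} (hr : r ∈ Ico (0 : ℝ) 1) :
    (r * exp (θ * I) : ℂ) ∈ ball 0 1 := by
  rw [mem_ball_zero_iff, norm_ofReal_mul_exp_mul_I, abs_of_nonneg hr.1]
  exact hr.2

/-- Since `x ≤ 1 + 2 r x ^ 2` for `1 / 2 ≤ r`, a finite Dirichlet integral on the radius makes the
derivative integrable there. -/
lemma exists_radialLimit_of_lintegral_lt_top (hd : DifferentiableOn ℂ ψ (ball 0 1))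
    (hfin : ∫⁻ r in Ico (1 / 2 : ℝ) 1, ENNReal.ofReal r * ‖deriv ψ (r * exp (θ * I))‖ₑ ^ 2 < ⊤) :
    ∃ L, HasRadialLimit ψ (exp (θ * I)) L := by
  have hγ : ∀ r ∈ Ico (1 / 2 : ℝ) 1, HasDerivAt (fun r : ℝ => ψ (r * exp (θ * I)))
      (deriv ψ (r * exp (θ * I)) * exp (θ * I)) r := by
    intro r hr
    have hmem := ofReal_mul_exp_mul_I_mem_ball (θ := θ) ⟨by linarith [hr.1], hr.2⟩
    have h1 := (hd.differentiableAt (isOpen_ball.mem_nhds hmem)).hasDerivAt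
    have h2 : HasDerivAt (fun r : ℝ => (r : ℂ) * exp (θ * I)) (1 * exp (θ * I)) r :=
      (hasDerivAt_id' r).ofReal_comp.mul_const _
    exact (h1.comp r h2).congr_deriv (by rw [one_mul])
  refine exists_tendsto_nhdsLT_of_intervalIntegrable_deriv (by norm_num) hγ ?_
  rw [intervalIntegrable_iff_integrableOn_Ico_of_le (by norm_num)]
  refine ⟨(((measurable_deriv ψ).comp (by fun_prop)).mul_const _).aestronglyMeasurable, ?_⟩
  have hbound : ∀ r ∈ Ico (1 / 2 : ℝ) 1, ‖deriv ψ (r * exp (θ * I)) * exp (θ * I)‖ₑ ≤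
      1 + 2 * (ENNReal.ofReal r * ‖deriv ψ (r * exp (θ * I))‖ₑ ^ 2) := by
    intro r hr
    have hr0 : 0 ≤ r := by linarith [hr.1]
    rw [← ofReal_norm, ← ofReal_norm, norm_mul, norm_exp_ofReal_mul_I, mul_one,
      ← ENNReal.ofReal_pow (norm_nonneg _), ← ENNReal.ofReal_mul hr0, ← ENNReal.ofReal_ofNat,
      ← ENNReal.ofReal_mul zero_le_two, ← ENNReal.ofReal_one,
      ← ENNReal.ofReal_add zero_le_one (by positivity)]
    gcongr
    nlinarith [hr.1, sq_nonneg (‖deriv ψ (r * exp (θ * I))‖ - 1),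
      sq_nonneg ‖deriv ψ (r * exp (θ * I))‖]
  refine (setLIntegral_mono' measurableSet_Ico hbound).trans_lt ?_
  rw [lintegral_add_left measurable_const, lintegral_const_mul' _ _ ENNReal.ofNat_ne_top]
  exact ENNReal.add_lt_top.2 ⟨by simp, ENNReal.mul_lt_top ENNReal.ofNat_lt_top hfin⟩

theorem ae_exists_radialLimit (hd : DifferentiableOn ℂ ψ (ball 0 1)) (hinj : InjOn ψ (ball 0 1))
    (hvol : volume (ψ '' ball 0 1) ≠ ⊤) :
    ∀ᵐ θ : ℝ, ∃ L, HasRadialLimit ψ (exp (θ * I)) L := by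
  rw [volume_image_eq_lintegral_enorm_deriv_sq isOpen_ball hd hinj,
    ← lintegral_indicator measurableSet_ball] at hvol
  have hfin := ae_lintegral_radius_lt_top
    (((measurable_deriv ψ).enorm.pow_const 2).indicator measurableSet_ball) hvol
  refine ae_of_periodic (T := 2 * Real.pi) (a := -Real.pi) Real.two_pi_pos (fun θ => ?_) ?_
  · simp only [exp_add_two_pi_mul_I]
  · rw [show -Real.pi + 2 * Real.pi = Real.pi by ring, ← restrict_Ioo_eq_restrict_Ioc]
    filter_upwards [hfin] with θ hθ
    refine exists_radialLimit_of_lintegral_lt_top hd (lt_of_le_of_lt ?_ hθ)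
    calc _ = ∫⁻ r in Ico (1 / 2 : ℝ) 1, ENNReal.ofReal r * (ball 0 1).indicator
          (fun z => ‖deriv ψ z‖ₑ ^ 2) (r * exp (θ * I)) :=
          setLIntegral_congr_fun measurableSet_Ico fun r hr => by
            simp only [indicator_of_mem (ofReal_mul_exp_mul_I_mem_ball (θ := θ)
              ⟨by linarith [hr.1], hr.2⟩)]
      _ ≤ _ := lintegral_mono_set fun r hr => (by norm_num : (0 : ℝ) < 1 / 2).trans_le hr.1

end

/-! ### Boundary representation of the derivative -/

lemma sub_ne_zero_of_norm_eq_one {w ζ : ℂ} (hw : ‖w‖ < 1) (hζ : ‖ζ‖ = 1) : ζ - w ≠ 0 := by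
  rw [sub_ne_zero]
  rintro rfl
  exact hw.ne hζ

lemma one_sub_norm_le_norm_sub {w ζ : ℂ} (hζ : ‖ζ‖ = 1) : 1 - ‖w‖ ≤ ‖ζ - w‖ :=
  hζ ▸ norm_sub_norm_le ζ w

lemma continuousOn_div_sub_sq {w : ℂ} (hw : ‖w‖ < 1) :
    ContinuousOn (fun ζ : ℂ => ζ / (ζ - w) ^ 2) (sphere 0 1) :=
  continuousOn_id.div (by fun_prop) fun _ hζ =>
    pow_ne_zero 2 (sub_ne_zero_of_norm_eq_one hw (mem_sphere_zero_iff_norm.1 hζ))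

lemma circleAverage_div_sub_sq_mul {Φ : ℂ → ℂ} {U : Set ℂ} (hU : IsOpen U)
    (hsub : closedBall 0 1 ⊆ U) (hd : DifferentiableOn ℂ Φ U) {w : ℂ} (hw : w ∈ ball (0 : ℂ) 1) :
    Real.circleAverage (fun ζ => ζ / (ζ - w) ^ 2 * Φ ζ) 0 1 = deriv Φ w := by
  rw [Real.circleAverage_eq_circleIntegral one_ne_zero,
    ← two_pi_I_inv_smul_circleIntegral_sub_sq_inv_smul_of_differentiable hU hsub hd hw]
  congr 1
  refine circleIntegral.integral_congr zero_le_one fun ζ hζ => ?_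
  have hζ0 : ζ ≠ 0 := ne_of_mem_sphere hζ one_ne_zero
  simp only [sub_zero, smul_eq_mul]
  field_simp

/-- On the circle `conj (ζ / (ζ - w)²) = ζ / (1 - conj w * ζ)²` is holomorphic and vanishes at
`0`, so the mean value property applies. -/
lemma circleAverage_div_sub_sq_mul_conj {Φ : ℂ → ℂ} {U : Set ℂ}
    (hsub : closedBall 0 1 ⊆ U) (hd : DifferentiableOn ℂ Φ U) {w : ℂ} (hw : w ∈ ball (0 : ℂ) 1) :
    Real.circleAverage (fun ζ => ζ / (ζ - w) ^ 2 * (starRingEnd ℂ) (Φ ζ)) 0 1 = 0 := by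
  set Ψ : ℂ → ℂ := fun ζ => ζ / (1 - (starRingEnd ℂ) w * ζ) ^ 2 * Φ ζ with hΨ
  have hden : ∀ ζ ∈ closedBall (0 : ℂ) 1, (1 - (starRingEnd ℂ) w * ζ) ^ 2 ≠ 0 := by
    intro ζ hζ
    refine pow_ne_zero 2 (sub_ne_zero.2 fun h => ?_)
    have := congrArg norm h
    rw [norm_mul, RCLike.norm_conj, norm_one] at this
    nlinarith [norm_nonneg w, norm_nonneg ζ, mem_ball_zero_iff.1 hw, mem_closedBall_zero_iff.1 hζ]
  have hΨd : DifferentiableOn ℂ Ψ (closedBall 0 1) :=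
    (differentiableOn_id.div (by fun_prop) hden).mul (hd.mono hsub)
  have hΨ0 : Real.circleAverage Ψ 0 1 = 0 := by
    rw [DiffContOnCl.circleAverage
      (by simpa using hΨd.diffContOnCl_ball subset_rfl)]
    simp [hΨ]
  have hint : CircleIntegrable Ψ 0 1 :=
    (hΨd.continuousOn.mono sphere_subset_closedBall).circleIntegrable zero_le_one
  have hconj : Real.circleAverage (conjCLE ∘ Ψ) 0 1 = conjCLE (Real.circleAverage Ψ 0 1) :=
    ContinuousLinearMap.circleAverage_comp_comm (F := ℂ) conjCLE.toContinuousLinearMap hint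
  rw [hΨ0, map_zero] at hconj
  refine (Real.circleAverage_congr_sphere fun ζ hζ => ?_).trans hconj
  have hζ1 : ‖ζ‖ = 1 := by simpa using hζ
  have hζ0 : ζ ≠ 0 := norm_ne_zero_iff.1 (by simp [hζ1])
  have hinv : (starRingEnd ℂ) ζ = ζ⁻¹ := by rw [inv_eq_conj hζ1]
  have hne := sub_ne_zero_of_norm_eq_one (mem_ball_zero_iff.1 hw) hζ1
  have : 1 - w * ζ⁻¹ ≠ 0 := by
    rw [show 1 - w * ζ⁻¹ = (ζ - w) / ζ by field_simp]
    exact div_ne_zero hne hζ0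
  simp only [hΨ, Function.comp_apply, conjCLE_apply, map_mul,
    map_div₀, map_pow, map_sub, map_one, conj_conj, hinv]
  congr 1
  field_simp

theorem deriv_eq_circleAverage_re {Φ : ℂ → ℂ} {U : Set ℂ} (hU : IsOpen U)
    (hsub : closedBall 0 1 ⊆ U) (hd : DifferentiableOn ℂ Φ U) {w : ℂ} (hw : w ∈ ball (0 : ℂ) 1) :
    deriv Φ w = Real.circleAverage (fun ζ => 2 * ζ / (ζ - w) ^ 2 * ((Φ ζ).re : ℂ)) 0 1 := by
  have hΦ : ContinuousOn Φ (sphere 0 1) :=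
    hd.continuousOn.mono (sphere_subset_closedBall.trans hsub)
  have hk := continuousOn_div_sub_sq (mem_ball_zero_iff.1 hw)
  have hadd := Real.circleAverage_fun_add
    (f₁ := fun ζ => ζ / (ζ - w) ^ 2 * Φ ζ)
    (f₂ := fun ζ => ζ / (ζ - w) ^ 2 * (starRingEnd ℂ) (Φ ζ))
    ((hk.mul hΦ).circleIntegrable zero_le_one)
    ((hk.mul (continuous_conj.comp_continuousOn hΦ)).circleIntegrable zero_le_one)
  rw [circleAverage_div_sub_sq_mul hU hsub hd hw, circleAverage_div_sub_sq_mul_conj hsub hd hw,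
    add_zero] at hadd
  rw [← hadd]
  congr with ζ
  rw [re_eq_add_conj]
  ring

lemma circleAverage_eq_integral_exp {E : Type*} [NormedAddCommGroup E] [NormedSpace ℝ E]
    (f : ℂ → E) (a : ℝ) : Real.circleAverage f 0 1 =
      (2 * Real.pi)⁻¹ • ∫ θ in a..a + 2 * Real.pi, f (exp (θ * I)) := by
  rw [Real.circleAverage_eq_integral_add a,
    intervalIntegral.integral_comp_add_right (fun θ => f (circleMap 0 1 θ)), zero_add,
    add_comm (2 * Real.pi)]
  simp only [circleMap, ofReal_one, one_mul, zero_add]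

lemma norm_two_mul_div_sub_sq_le {w ζ : ℂ} (hw : ‖w‖ < 1) (hζ : ‖ζ‖ = 1) :
    ‖2 * ζ / (ζ - w) ^ 2‖ ≤ 2 / (1 - ‖w‖) ^ 2 := by
  rw [norm_div, norm_mul, norm_pow, hζ, norm_ofNat, mul_one]
  have := one_sub_norm_le_norm_sub (w := w) hζ
  have : 0 < 1 - ‖w‖ := by linarith
  gcongr

lemma continuous_two_mul_exp_div_sub_sq {w : ℂ} (hw : ‖w‖ < 1) :
    Continuous fun θ : ℝ => 2 * exp (θ * I) / (exp (θ * I) - w) ^ 2 :=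
  (by fun_prop : Continuous fun θ : ℝ => 2 * exp (θ * I)).div (by fun_prop) fun θ =>
    pow_ne_zero 2 (sub_ne_zero_of_norm_eq_one hw (norm_exp_ofReal_mul_I θ))

section RadialLimit

variable {Φ : ℂ → ℂ} {v : ℝ → ℝ} {M : ℝ}

lemma continuous_re_comp_radius (hd : DifferentiableOn ℂ Φ (ball 0 1)) {R : ℝ}
    (hR : R ∈ Ico (0 : ℝ) 1) : Continuous fun θ : ℝ => (Φ (R * exp (θ * I))).re :=
  continuous_re.comp (hd.continuousOn.comp_continuous (by fun_prop) fun _ =>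
    ofReal_mul_exp_mul_I_mem_ball hR)

lemma re_mul_deriv_eq_integral_of_radius (hd : DifferentiableOn ℂ Φ (ball 0 1)) {R : ℝ}
    (hR : R ∈ Ioo (0 : ℝ) 1) {w : ℂ} (hw : w ∈ ball (0 : ℂ) 1) (p : ℂ) (a : ℝ) :
    (p * (R * deriv Φ (R * w))).re = (2 * Real.pi)⁻¹ * ∫ θ in a..a + 2 * Real.pi,
      (p * (2 * exp (θ * I) / (exp (θ * I) - w) ^ 2)).re * (Φ (R * exp (θ * I))).re := by
  have hmaps : MapsTo (fun z : ℂ => R * z) (ball 0 R⁻¹) (ball 0 1) := by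
    intro z hz
    rw [mem_ball_zero_iff] at hz ⊢
    rwa [norm_mul, Complex.norm_of_nonneg hR.1.le, mul_comm, ← lt_div_iff₀ hR.1, one_div]
  have hdR : DifferentiableOn ℂ (fun z => Φ (R * z)) (ball 0 R⁻¹) :=
    hd.comp (by fun_prop) hmaps
  have hsub : closedBall (0 : ℂ) 1 ⊆ ball 0 R⁻¹ :=
    closedBall_subset_ball ((one_lt_inv₀ hR.1).2 hR.2)
  have hint : IntervalIntegrable (fun θ : ℝ => 2 * exp (θ * I) / (exp (θ * I) - w) ^ 2 *
      ((Φ (R * exp (θ * I))).re : ℂ)) volume a (a + 2 * Real.pi) :=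
    ((continuous_two_mul_exp_div_sub_sq (mem_ball_zero_iff.1 hw)).mul (continuous_ofReal.comp
      (continuous_re_comp_radius hd ⟨hR.1.le, hR.2⟩))).intervalIntegrable _ _
  have hre := (reCLM ∘L ContinuousLinearMap.mul ℝ ℂ p).intervalIntegral_comp_comm hint
  have hderiv := deriv_eq_circleAverage_re isOpen_ball hsub hdR hw
  rw [deriv_comp_mul_left, smul_eq_mul, circleAverage_eq_integral_exp _ a] at hderiv
  simp only [ContinuousLinearMap.comp_apply, ContinuousLinearMap.mul_apply', reCLM_apply] at hre
  rw [hderiv, mul_smul_comm, smul_re, ← hre, smul_eq_mul]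
  simp only [← mul_assoc, re_mul_ofReal]

lemma norm_le_of_hasRadialLimit {E : Type*} [NormedAddCommGroup E] {u : ℂ → E} {L : E} {θ : ℝ}
    (hM : ∀ z ∈ ball (0 : ℂ) 1, ‖u z‖ ≤ M) (h : HasRadialLimit u (exp (θ * I)) L) : ‖L‖ ≤ M :=
  le_of_tendsto h.norm (eventually_of_mem (Ico_mem_nhdsLT zero_lt_one) fun _ hr =>
    hM _ (ofReal_mul_exp_mul_I_mem_ball hr))

lemma aestronglyMeasurable_of_hasRadialLimit (hd : DifferentiableOn ℂ Φ (ball 0 1))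
    (hv : ∀ᵐ θ : ℝ, HasRadialLimit (fun z => (Φ z).re) (exp (θ * I)) (v θ)) :
    AEStronglyMeasurable v := by
  have hmeas : ∀ r : ℝ, AEStronglyMeasurable
      fun θ : ℝ => if r ∈ Ico (0 : ℝ) 1 then (Φ (r * exp (θ * I))).re else 0 := by
    intro r
    split_ifs with hr
    · exact (continuous_re_comp_radius hd hr).aestronglyMeasurable
    · exact aestronglyMeasurable_const
  refine aestronglyMeasurable_of_tendsto_ae (𝓝[<] (1 : ℝ)) hmeas ?_
  filter_upwards [hv] with θ hθ
  exact hθ.congr' (eventually_of_mem (Ico_mem_nhdsLT zero_lt_one) fun r hr => (if_pos hr).symm)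

lemma tendsto_integral_mul_re_of_hasRadialLimit (hd : DifferentiableOn ℂ Φ (ball 0 1))
    (hM : ∀ z ∈ ball (0 : ℂ) 1, ‖Φ z‖ ≤ M)
    (hv : ∀ᵐ θ : ℝ, HasRadialLimit (fun z => (Φ z).re) (exp (θ * I)) (v θ))
    {k : ℝ → ℝ} (hk : Continuous k) (a b : ℝ) :
    Tendsto (fun R : ℝ => ∫ θ in a..b, k θ * (Φ (R * exp (θ * I))).re) (𝓝[<] 1)
      (𝓝 (∫ θ in a..b, k θ * v θ)) := by
  refine intervalIntegral.tendsto_integral_filter_of_dominated_convergence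
    (fun θ => |k θ| * M) ?_ ?_ ((hk.abs.mul_const M).intervalIntegrable _ _) ?_
  · filter_upwards [Ico_mem_nhdsLT zero_lt_one] with R hR
    exact (hk.mul (continuous_re_comp_radius hd hR)).aestronglyMeasurable
  · filter_upwards [Ico_mem_nhdsLT zero_lt_one] with R hR
    refine ae_of_all _ fun θ _ => ?_
    rw [norm_mul, Real.norm_eq_abs, Real.norm_eq_abs]
    gcongr
    exact (abs_re_le_norm _).trans (hM _ (ofReal_mul_exp_mul_I_mem_ball hR))
  · filter_upwards [hv] with θ hθ _
    exact hθ.const_mul _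

theorem re_mul_deriv_eq_integral (hd : DifferentiableOn ℂ Φ (ball 0 1))
    (hM : ∀ z ∈ ball (0 : ℂ) 1, ‖Φ z‖ ≤ M)
    (hv : ∀ᵐ θ : ℝ, HasRadialLimit (fun z => (Φ z).re) (exp (θ * I)) (v θ))
    {w : ℂ} (hw : w ∈ ball (0 : ℂ) 1) (p : ℂ) (a : ℝ) :
    (p * deriv Φ w).re = (2 * Real.pi)⁻¹ * ∫ θ in a..a + 2 * Real.pi,
      (p * (2 * exp (θ * I) / (exp (θ * I) - w) ^ 2)).re * v θ := by
  have hkc : Continuous fun θ : ℝ => (p * (2 * exp (θ * I) / (exp (θ * I) - w) ^ 2)).re :=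
    continuous_re.comp
      (continuous_const.mul (continuous_two_mul_exp_div_sub_sq (mem_ball_zero_iff.1 hw)))
  have hleft : Tendsto (fun R : ℝ => (p * (R * deriv Φ (R * w))).re) (𝓝[<] 1)
      (𝓝 (p * deriv Φ w).re) := by
    have hcont : ContinuousAt (deriv Φ) ((1 : ℝ) * w) := by
      rw [ofReal_one, one_mul]
      exact (hd.deriv isOpen_ball).continuousOn.continuousAt (isOpen_ball.mem_nhds hw)
    have : ContinuousAt (fun R : ℝ => (p * (R * deriv Φ (R * w))).re) 1 := by
      have := hcont.comp (f := fun R : ℝ => (R : ℂ) * w) (by fun_prop)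
      exact continuous_re.continuousAt.comp (by fun_prop)
    simpa using this.tendsto.mono_left nhdsWithin_le_nhds
  have hright := tendsto_integral_mul_re_of_hasRadialLimit hd hM hv hkc a (a + 2 * Real.pi)
  refine tendsto_nhds_unique hleft ((hright.const_mul _).congr' ?_)
  filter_upwards [Ioo_mem_nhdsLT zero_lt_one] with R hR
  exact (re_mul_deriv_eq_integral_of_radius hd hR hw p a).symm

end RadialLimit

/-! ### Unimodality of boundary values -/

lemma exists_joinedIn_of_eventually_mem {S T : Set ℂ} (hST : S ⊆ T) {ζ : ℂ} (hζ : ζ ∈ T)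
    (h : ∀ᶠ r : ℝ in 𝓝[<] 1, r * ζ ∈ S) : ∃ x ∈ S, JoinedIn T x ζ := by
  obtain ⟨r, hr1, hr⟩ := mem_nhdsLT_iff_exists_Ico_subset.1 h
  refine ⟨r * ζ, hr ⟨le_rfl, hr1⟩, JoinedIn.of_segment_subset ?_⟩
  rw [segment_eq_image_lineMap]
  rintro _ ⟨t, ht, rfl⟩
  have hline : AffineMap.lineMap (r * ζ) ζ t = ((r + t * (1 - r) : ℝ) : ℂ) * ζ := by
    rw [AffineMap.lineMap_apply_module', real_smul]
    push_cast
    ring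
  rw [hline]
  rcases ht.2.eq_or_lt with rfl | ht1
  · simpa using hζ
  · have hr1' : r < 1 := hr1
    exact hST (hr ⟨by nlinarith [ht.1], by nlinarith⟩)

lemma joinedIn_of_eventually_mem {S T : Set ℂ} (hS : ∀ x ∈ S, ∀ y ∈ S, JoinedIn S x y)
    (hST : S ⊆ T) {ζ ζ' : ℂ} (hζ : ζ ∈ T) (hζ' : ζ' ∈ T) (h : ∀ᶠ r : ℝ in 𝓝[<] 1, r * ζ ∈ S)
    (h' : ∀ᶠ r : ℝ in 𝓝[<] 1, r * ζ' ∈ S) : JoinedIn T ζ ζ' := by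
  obtain ⟨x, hx, hxζ⟩ := exists_joinedIn_of_eventually_mem hST hζ h
  obtain ⟨y, hy, hyζ⟩ := exists_joinedIn_of_eventually_mem hST hζ' h'
  exact hxζ.symm.trans (((hS x hx y hy).mono hST).trans hyζ)

lemma HasRadialLimit.neg {u : ℂ → ℝ} {ζ : ℂ} {L : ℝ} (h : HasRadialLimit u ζ L) :
    HasRadialLimit (fun z => -u z) ζ (-L) := Tendsto.neg h

section Interlacing

variable {u : ℂ → ℝ}

/-- Points of the closed disk at which `u`, or its radial limit, is less than `c`. -/
def closedSublevel (u : ℂ → ℝ) (c : ℝ) : Set ℂ :=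
  {z | z ∈ ball 0 1 ∧ u z < c} ∪ {ζ | ‖ζ‖ = 1 ∧ ∃ L < c, HasRadialLimit u ζ L}

lemma closedSublevel_subset_closedBall (c : ℝ) : closedSublevel u c ⊆ closedBall 0 1 :=
  union_subset (fun _ hz => ball_subset_closedBall hz.1) fun _ hζ =>
    mem_closedBall_zero_iff.2 hζ.1.le

lemma disjoint_closedSublevel_neg (c : ℝ) :
    Disjoint (closedSublevel u c) (closedSublevel (fun z => -u z) (-c)) := by
  rw [Set.disjoint_left]
  rintro z (⟨hz, h⟩ | ⟨hz, L, hL, h⟩) (⟨hz', h'⟩ | ⟨hz', L', hL', h'⟩)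
  · exact h.not_gt (neg_lt_neg_iff.1 h')
  · exact (mem_ball_zero_iff.1 hz).ne hz'
  · exact (mem_ball_zero_iff.1 hz').ne hz
  · have := tendsto_nhds_unique h.neg h'
    linarith

lemma joinedIn_closedSublevel {c : ℝ}
    (hu : ∀ x ∈ {z ∈ ball 0 1 | u z < c}, ∀ y ∈ {z ∈ ball 0 1 | u z < c},
      JoinedIn {z ∈ ball 0 1 | u z < c} x y) {α β a b : ℝ}
    (hα : HasRadialLimit u (exp (α * I)) a) (hβ : HasRadialLimit u (exp (β * I)) b)
    (ha : a < c) (hb : b < c) : JoinedIn (closedSublevel u c) (exp (α * I)) (exp (β * I)) := by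
  have hev : ∀ {θ l : ℝ}, HasRadialLimit u (exp (θ * I)) l → l < c →
      ∀ᶠ r : ℝ in 𝓝[<] 1, (r * exp (θ * I) : ℂ) ∈ {z ∈ ball (0 : ℂ) 1 | u z < c} := by
    intro θ l hl hlc
    filter_upwards [Ico_mem_nhdsLT zero_lt_one, hl.eventually_lt_const hlc] with r hr hrc
    exact ⟨ofReal_mul_exp_mul_I_mem_ball hr, hrc⟩
  exact joinedIn_of_eventually_mem hu subset_union_left
    (.inr ⟨norm_exp_ofReal_mul_I α, a, ha, hα⟩) (.inr ⟨norm_exp_ofReal_mul_I β, b, hb, hβ⟩)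
    (hev hα ha) (hev hβ hb)

theorem min_le_max_of_hasRadialLimit
    (hlt : ∀ c, ∀ x ∈ {z ∈ ball 0 1 | u z < c}, ∀ y ∈ {z ∈ ball 0 1 | u z < c},
      JoinedIn {z ∈ ball 0 1 | u z < c} x y)
    (hgt : ∀ c, ∀ x ∈ {z ∈ ball 0 1 | c < u z}, ∀ y ∈ {z ∈ ball 0 1 | c < u z},
      JoinedIn {z ∈ ball 0 1 | c < u z} x y) {v : ℝ → ℝ} {α β γ δ : ℝ}
    (hα : HasRadialLimit u (exp (α * I)) (v α)) (hβ : HasRadialLimit u (exp (β * I)) (v β))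
    (hγ : HasRadialLimit u (exp (γ * I)) (v γ)) (hδ : HasRadialLimit u (exp (δ * I)) (v δ))
    (hαβ : α < β) (hβγ : β < γ) (hγδ : γ < δ) (hδα : δ < α + 2 * Real.pi) :
    min (v β) (v δ) ≤ max (v α) (v γ) := by
  by_contra! h
  obtain ⟨c, hc, hc'⟩ := exists_between h
  rw [max_lt_iff] at hc
  rw [lt_min_iff] at hc'
  have hgt' : ∀ x ∈ {z ∈ ball 0 1 | -u z < -c}, ∀ y ∈ {z ∈ ball 0 1 | -u z < -c},
      JoinedIn {z ∈ ball 0 1 | -u z < -c} x y := by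
    simpa only [neg_lt_neg_iff] using hgt c
  exact not_joinedIn_of_interlaced (closedSublevel_subset_closedBall c)
    (closedSublevel_subset_closedBall (-c)) (disjoint_closedSublevel_neg c) hαβ hβγ hγδ hδα
    (joinedIn_closedSublevel (hlt c) hα hγ hc.1 hc.2)
    (joinedIn_closedSublevel hgt' hβ.neg hδ.neg (neg_lt_neg hc'.1) (neg_lt_neg hc'.2))

end Interlacing

lemma abs_sub_clamp_le {l m x ε : ℝ} (hl : l ≤ x + ε) (hm : x ≤ m + ε) (hε : 0 ≤ ε) :
    |x - max l (min m x)| ≤ ε := by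
  rw [abs_sub_le_iff]
  grind

lemma exists_mem_forall_le_add {s : Set ℝ} (hs : s.Nonempty) {v : ℝ → ℝ} (hv : BddBelow (v '' s))
    {ε : ℝ} (hε : 0 < ε) : ∃ a ∈ s, ∀ x ∈ s, v a ≤ v x + ε := by
  obtain ⟨_, ⟨a, ha, rfl⟩, hlt⟩ := exists_lt_of_csInf_lt (hs.image v) (lt_add_of_pos_right _ hε)
  exact ⟨a, ha, fun x hx => by linarith [csInf_le hv (mem_image_of_mem v hx)]⟩

section Unimodality

variable {v : ℝ → ℝ} {E : Set ℝ} {T a b : ℝ}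
  (hv : ∀ α ∈ E, ∀ β ∈ E, ∀ γ ∈ E, ∀ δ ∈ E, α < β → β < γ → γ < δ → δ < α + T →
    min (v β) (v δ) ≤ max (v α) (v γ))
include hv

lemma monotoneOn_clamp (ha : a ∈ E) (hb : b ∈ E) (hbT : b < a + T) :
    MonotoneOn (fun θ => max (v a) (min (v b) (v θ))) (E ∩ Ioo a b) := by
  rintro x ⟨hx, hxab⟩ y ⟨hy, hyab⟩ hxy
  rcases hxy.eq_or_lt with rfl | hxy
  · exact le_rfl
  have := hv a ha x hx y hy b hb hxab.1 hxy hyab.2 hbT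
  grind

lemma antitoneOn_clamp (ha : a ∈ E) (hb : b ∈ E) (hab : a < b) :
    AntitoneOn (fun θ => max (v a) (min (v b) (v θ))) (E ∩ Ioo b (a + T)) := by
  rintro x ⟨hx, hxab⟩ y ⟨hy, hyab⟩ hxy
  rcases hxy.eq_or_lt with rfl | hxy
  · exact le_rfl
  have := hv a ha b hb x hx y hy hab hxab.1 hxy hyab.2
  grind

/-- The endpoints `a` and `b` are almost minimum and almost maximum points of `v`; the truncation
of `v` to the range between `v a` and `v b` is then monotone on either side of `b`. -/
theorem exists_monotone_antitone_approx {M ε : ℝ} (hT : 0 < T) (hE : ∀ᵐ θ, θ ∈ E)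
    (hM : ∀ θ ∈ E, |v θ| ≤ M) (hε : 0 < ε) :
    ∃ a b, a < b ∧ b < a + T ∧ ∃ g₁ g₂ : ℝ → ℝ, Monotone g₁ ∧ Antitone g₂ ∧
      (∀ᵐ θ, θ ∈ Ioo a b → |v θ - g₁ θ| ≤ ε) ∧
      ∀ᵐ θ, θ ∈ Ioo b (a + T) → |v θ - g₂ θ| ≤ ε := by
  have hdense : Dense E := Measure.dense_of_ae hE
  have hbelow : BddBelow (v '' E) :=
    ⟨-M, forall_mem_image.2 fun θ hθ => (abs_le.1 (hM θ hθ)).1⟩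
  have hbelow' : BddBelow ((fun θ => -v θ) '' E) :=
    ⟨-M, forall_mem_image.2 fun θ hθ => neg_le_neg (abs_le.1 (hM θ hθ)).2⟩
  obtain ⟨a, ha, hmin⟩ := exists_mem_forall_le_add hdense.nonempty hbelow hε
  obtain ⟨b, ⟨hb, hab, hbT⟩, hmax⟩ := exists_mem_forall_le_add (s := E ∩ Ioo a (a + T))
    (hdense.exists_between (lt_add_of_pos_right a hT)) (hbelow'.mono (by gcongr; simp)) hε
  have hclamp : ∀ θ ∈ E ∩ Ioo a (a + T), |v θ - max (v a) (min (v b) (v θ))| ≤ ε :=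
    fun θ hθ => abs_sub_clamp_le (hmin θ hθ.1) (by linarith [hmax θ hθ]) hε.le
  have hrange : ∀ s : Set ℝ, BddBelow ((fun θ => max (v a) (min (v b) (v θ))) '' s) ∧
      BddAbove ((fun θ => max (v a) (min (v b) (v θ))) '' s) := fun s =>
    ⟨⟨v a, forall_mem_image.2 fun _ _ => le_max_left _ _⟩, ⟨max (v a) (v b),
      forall_mem_image.2 fun _ _ => max_le_max le_rfl (min_le_left _ _)⟩⟩
  obtain ⟨g₁, hg₁, heq₁⟩ :=
    (monotoneOn_clamp hv ha hb hbT).exists_monotone_extension (hrange _).1 (hrange _).2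
  obtain ⟨g₂, hg₂, heq₂⟩ :=
    (antitoneOn_clamp hv ha hb hab).exists_antitone_extension (hrange _).1 (hrange _).2
  refine ⟨a, b, hab, hbT, g₁, g₂, hg₁, hg₂, ?_, ?_⟩
  · filter_upwards [hE] with θ hθ hθab
    rw [← heq₁ ⟨hθ, hθab⟩]
    exact hclamp θ ⟨hθ, hθab.1, hθab.2.trans hbT⟩
  · filter_upwards [hE] with θ hθ hθab
    rw [← heq₂ ⟨hθ, hθab⟩]
    exact hclamp θ ⟨hθ, hab.trans hθab.1, hθab.2⟩

end Unimodality

/-! ### A second mean value inequality -/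

lemma le_of_forall_sub_mul_le {D g : ℝ → ℝ} {a b C : ℝ} (hab : a ≤ b)
    (hD : ∀ x y, a ≤ x → x ≤ y → y ≤ b → D x - C * (y - x) * (g y - g x) ≤ D y) : D a ≤ D b := by
  have hpartition : ∀ n : ℕ, D a - C * ((b - a) / (n + 1 : ℝ)) * (g b - g a) ≤ D b := by
    intro n
    set δ := (b - a) / (n + 1 : ℝ) with hδ
    have hδ0 : 0 ≤ δ := div_nonneg (sub_nonneg.2 hab) (by positivity)
    have hn : a + (n + 1) * δ = b := by rw [hδ]; field_simp; ring
    have hstep : ∀ i : ℕ, i ≤ n + 1 → D a - C * δ * (g (a + i * δ) - g a) ≤ D (a + i * δ) := by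
      intro i
      induction i with
      | zero => simp
      | succ i ih =>
        intro hi
        have hle : ((i + 1 : ℕ) : ℝ) * δ ≤ (n + 1) * δ := by gcongr; exact_mod_cast hi
        have hmesh : a + ((i + 1 : ℕ) : ℝ) * δ - (a + i * δ) = δ := by push_cast; ring
        have := hD (a + i * δ) (a + (i + 1 : ℕ) * δ)
          (le_add_of_nonneg_right (by positivity)) (by linarith) (by linarith)
        rw [hmesh] at this
        linarith [ih (by omega)]
    simpa only [Nat.cast_add, Nat.cast_one, hn] using hstep (n + 1) le_rfl
  have hlim : Tendsto (fun n : ℕ => D a - C * ((b - a) / (n + 1 : ℝ)) * (g b - g a)) atTop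
      (𝓝 (D a - C * 0 * (g b - g a))) :=
    tendsto_const_nhds.sub ((((tendsto_const_div_atTop_nhds_zero_nat (b - a)).comp
      (tendsto_add_atTop_nat 1)).congr fun n => by simp).const_mul C |>.mul_const _)
  simpa using le_of_tendsto' hlim hpartition

section SecondMeanValue

variable {k k' g v : ℝ → ℝ} {a b C ε : ℝ}

theorem integral_deriv_mul_nonneg (hab : a ≤ b) (hk : ∀ x, HasDerivAt k (k' x) x)
    (hk' : Continuous k') (hC : ∀ x, |k' x| ≤ C) (hk0 : ∀ x ∈ Icc a b, k x ≤ 0)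
    (ha : k a = 0) (hb : k b = 0) (hg : Monotone g) : 0 ≤ ∫ x in a..b, k' x * g x := by
  have hint : ∀ x y, IntervalIntegrable (fun t => k' t * g t) volume x y := fun x y =>
    hg.intervalIntegrable.continuousOn_mul hk'.continuousOn
  set D : ℝ → ℝ := fun x => (∫ t in a..x, k' t * g t) - k x * g x with hDdef
  have hD : ∀ x y, a ≤ x → x ≤ y → y ≤ b → D x - C * (y - x) * (g y - g x) ≤ D y := by
    intro x y hax hxy hyb
    have hosc : |∫ t in x..y, k' t * (g t - g x)| ≤ C * (g y - g x) * |y - x| := by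
      refine intervalIntegral.norm_integral_le_of_norm_le_const (E := ℝ) fun t ht => ?_
      rw [uIoc_of_le hxy] at ht
      have hxt := sub_nonneg.2 (hg ht.1.le)
      rw [norm_mul, Real.norm_eq_abs, Real.norm_eq_abs, abs_of_nonneg hxt]
      exact mul_le_mul (hC t) (sub_le_sub_right (hg ht.2) _) hxt ((abs_nonneg _).trans (hC t))
    have hsplit : ∫ t in x..y, k' t * (g t - g x) =
        (∫ t in x..y, k' t * g t) - (k y - k x) * g x := by
      simp only [mul_sub]
      rw [intervalIntegral.integral_sub (hint x y) ((hk'.mul_const _).intervalIntegrable _ _),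
        intervalIntegral.integral_mul_const,
        intervalIntegral.integral_eq_sub_of_hasDerivAt (fun t _ => hk t)
          (hk'.intervalIntegrable _ _)]
    have hadj := intervalIntegral.integral_add_adjacent_intervals (hint a x) (hint x y)
    rw [hsplit, abs_of_nonneg (sub_nonneg.2 hxy)] at hosc
    have hky := mul_nonneg (neg_nonneg.2 (hk0 y ⟨hax.trans hxy, hyb⟩)) (sub_nonneg.2 (hg hxy))
    simp only [hDdef, ← hadj]
    linarith [(abs_le.1 hosc).1]
  simpa [hDdef, ha, hb] using le_of_forall_sub_mul_le hab hD

lemma neg_le_integral_deriv_mul_of_monotone (hab : a ≤ b) (hk : ∀ x, HasDerivAt k (k' x) x)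
    (hk' : Continuous k') (hC : ∀ x, |k' x| ≤ C) (hk0 : ∀ x ∈ Icc a b, k x ≤ 0)
    (ha : k a = 0) (hb : k b = 0) (hg : Monotone g)
    (hv : IntervalIntegrable v volume a b)
    (hvg : ∀ᵐ x, x ∈ Ioo a b → |v x - g x| ≤ ε) :
    -(C * ε * (b - a)) ≤ ∫ x in a..b, k' x * v x := by
  have hintg : IntervalIntegrable g volume a b := hg.intervalIntegrable
  have hsplit : ∫ x in a..b, k' x * v x =
      (∫ x in a..b, k' x * g x) + ∫ x in a..b, k' x * (v x - g x) := by
    rw [← intervalIntegral.integral_add (hintg.continuousOn_mul hk'.continuousOn)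
      ((hv.sub hintg).continuousOn_mul hk'.continuousOn)]
    simp only [mul_sub, add_sub_cancel]
  have herr : |∫ x in a..b, k' x * (v x - g x)| ≤ C * ε * |b - a| := by
    refine intervalIntegral.norm_integral_le_of_norm_le_const_ae (E := ℝ) ?_
    filter_upwards [hvg, compl_mem_ae_iff.2 (measure_singleton b)] with x hx hxb hxab
    rw [uIoc_of_le hab] at hxab
    rw [norm_mul, Real.norm_eq_abs, Real.norm_eq_abs]
    exact mul_le_mul (hC x) (hx ⟨hxab.1, hxab.2.lt_of_ne hxb⟩) (abs_nonneg _)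
      ((abs_nonneg _).trans (hC x))
  rw [abs_of_nonneg (sub_nonneg.2 hab)] at herr
  linarith [integral_deriv_mul_nonneg hab hk hk' hC hk0 ha hb hg, (abs_le.1 herr).1]

lemma neg_le_integral_deriv_mul_of_antitone (hab : a ≤ b) (hk : ∀ x, HasDerivAt k (k' x) x)
    (hk' : Continuous k') (hC : ∀ x, |k' x| ≤ C) (hk0 : ∀ x ∈ Icc a b, 0 ≤ k x)
    (ha : k a = 0) (hb : k b = 0) (hg : Antitone g)
    (hv : IntervalIntegrable v volume a b)
    (hvg : ∀ᵐ x, x ∈ Ioo a b → |v x - g x| ≤ ε) :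
    -(C * ε * (b - a)) ≤ ∫ x in a..b, k' x * v x := by
  have h := neg_le_integral_deriv_mul_of_monotone (k := fun x => -k x) (k' := fun x => -k' x)
    (v := fun x => -v x) (g := fun x => -g x) (ε := ε) hab (fun x => (hk x).neg) hk'.neg
    (fun x => (abs_neg _).trans_le (hC x)) (fun x hx => neg_nonpos.2 (hk0 x hx)) (by simp [ha])
    (by simp [hb]) hg.neg hv.neg (by simpa only [← neg_sub', abs_neg] using hvg)
  simpa only [neg_mul_neg] using h

end SecondMeanValue

/-! ### Holomorphic fields tangent to the unit circle -/

/-- The quadratic holomorphic vector field `c z² + i s z - c̄`. For real `s` it is tangent to the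
unit circle; if `|s| < 2 |c|` it vanishes at two points of the circle and reverses direction
between them. -/
def tangentField (c : ℂ) (s : ℝ) (z : ℂ) : ℂ := c * z ^ 2 + I * s * z - (starRingEnd ℂ) c

/-- The parameters of the normalised tangent fields, a compact set. -/
def tangentParams : Set (ℂ × ℝ) := sphere 0 1 ×ˢ Icc (-2) 2

lemma isCompact_tangentParams : IsCompact tangentParams :=
  (isCompact_sphere 0 1).prod isCompact_Icc

lemma continuous_tangentField (z : ℂ) :
    Continuous fun q : ℂ × ℝ => tangentField q.1 q.2 z := by
  unfold tangentField
  fun_prop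

lemma norm_tangentField_le {q : ℂ × ℝ} (hq : q ∈ tangentParams) {z : ℂ} (hz : ‖z‖ ≤ 1) :
    ‖tangentField q.1 q.2 z‖ ≤ 4 := by
  obtain ⟨hc, hs⟩ := hq
  rw [mem_sphere_zero_iff_norm] at hc
  have hs' : ‖(q.2 : ℂ)‖ ≤ 2 := by simpa using abs_le.2 hs
  calc ‖tangentField q.1 q.2 z‖
    _ ≤ ‖q.1 * z ^ 2‖ + ‖I * q.2 * z‖ + ‖(starRingEnd ℂ) q.1‖ :=
        (norm_sub_le _ _).trans (by gcongr; exact norm_add_le _ _)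
    _ = ‖z‖ ^ 2 + ‖(q.2 : ℂ)‖ * ‖z‖ + 1 := by
        simp only [norm_mul, norm_pow, norm_I, RCLike.norm_conj, hc, one_mul]
    _ ≤ 1 ^ 2 + 2 * 1 + 1 := by gcongr
    _ = 4 := by norm_num

lemma re_two_mul_div_sub {w ζ : ℂ} (hw : ‖w‖ < 1) (hζ : ‖ζ‖ = 1) :
    (2 * ζ / (ζ - w)).re = poissonKernel 0 w ζ + 1 := by
  have hne := sub_ne_zero_of_norm_eq_one hw hζ
  have hsplit : 2 * ζ / (ζ - w) = herglotzRieszKernel 0 w ζ + 1 := by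
    simp only [herglotzRieszKernel, sub_zero]
    field_simp
    ring
  rw [hsplit, add_re, one_re, poissonKernel_eq_re_herglotzRieszKernel, Function.comp_apply]

lemma poissonKernel_zero_nonneg {w ζ : ℂ} (hw : ‖w‖ < 1) (hζ : ‖ζ‖ = 1) :
    0 ≤ poissonKernel 0 w ζ := by
  simp only [poissonKernel, sub_zero, hζ]
  have : ‖w‖ ^ 2 ≤ 1 ^ 2 := by gcongr
  exact div_nonneg (sub_nonneg.2 this) (sq_nonneg _)

lemma tangentField_of_norm_eq_one (c : ℂ) (s : ℝ) {ζ : ℂ} (hζ : ‖ζ‖ = 1) :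
    tangentField c s ζ = I * ζ * (2 * (c * ζ).im + s : ℝ) := by
  have hζζ : (starRingEnd ℂ) ζ * ζ = 1 := by
    rw [conj_mul', hζ, ofReal_one, one_pow]
  have him : (2 * (c * ζ).im : ℝ) * I = c * ζ - (starRingEnd ℂ) c * (starRingEnd ℂ) ζ := by
    rw [← map_mul, sub_conj]
  rw [tangentField, ofReal_add]
  linear_combination (-ζ) * him + (starRingEnd ℂ) c * hζζ

lemma re_two_I_mul_tangentField_div (c : ℂ) (s : ℝ) {w ζ : ℂ} (hw : ‖w‖ < 1) (hζ : ‖ζ‖ = 1) :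
    (2 * I * tangentField c s w / (ζ - w)).re =
      s + 2 * (c * w).im - (2 * (c * ζ).im + s) * poissonKernel 0 w ζ := by
  have hne := sub_ne_zero_of_norm_eq_one hw hζ
  have hsplit : 2 * I * tangentField c s w / (ζ - w) =
      2 * I * tangentField c s ζ / (ζ - w) - 2 * I * (c * (ζ + w) + I * s) := by
    unfold tangentField
    field_simp
    ring
  have hboundary : 2 * I * tangentField c s ζ / (ζ - w) =
      -(2 * (c * ζ).im + s : ℝ) * (2 * ζ / (ζ - w)) := by
    rw [tangentField_of_norm_eq_one c s hζ]
    linear_combination (2 * ζ * (2 * (c * ζ).im + s : ℝ) / (ζ - w)) * I_mul_I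
  have hregular : (2 * I * (c * (ζ + w) + I * s)).re = -2 * ((c * ζ).im + (c * w).im + s) := by
    simp only [mul_add, add_re, mul_re, I_re, I_im, re_ofNat, im_ofNat, mul_im, ofReal_re,
      ofReal_im]
    ring
  rw [hsplit, hboundary, sub_re, ← ofReal_neg, re_ofReal_mul, re_two_mul_div_sub hw hζ, hregular]
  ring

/-- The parameters of the tangent field with zeros `exp (i a)` and `exp (i b)`. -/
noncomputable def chordParams (a b : ℝ) : ℂ × ℝ :=
  (I * exp (-((a + b) / 2 : ℝ) * I), -2 * Real.cos ((b - a) / 2))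

lemma chordParams_mem (a b : ℝ) : chordParams a b ∈ tangentParams := by
  refine ⟨?_, ?_⟩
  · rw [mem_sphere_zero_iff_norm, chordParams, norm_mul, norm_I, one_mul, ← ofReal_neg,
      norm_exp_ofReal_mul_I]
  · simp only [chordParams, mem_Icc]
    constructor <;> linarith [Real.neg_one_le_cos ((b - a) / 2), Real.cos_le_one ((b - a) / 2)]

lemma two_mul_im_add_chordParams (a b θ : ℝ) :
    2 * ((chordParams a b).1 * exp (θ * I)).im + (chordParams a b).2 =
      4 * (Real.sin ((θ - a) / 2) * Real.sin ((b - θ) / 2)) := by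
  have him : ((chordParams a b).1 * exp (θ * I)).im = Real.cos (θ - (a + b) / 2) := by
    rw [chordParams, mul_assoc, ← Complex.exp_add, I_mul_im, ← add_mul, neg_add_eq_sub,
      ← ofReal_sub, exp_ofReal_mul_I_re]
  have hprod := Real.cos_sub_cos (θ - (a + b) / 2) ((b - a) / 2)
  rw [show (θ - (a + b) / 2 + (b - a) / 2) / 2 = (θ - a) / 2 by ring,
    show (θ - (a + b) / 2 - (b - a) / 2) / 2 = -((b - θ) / 2) by ring, Real.sin_neg] at hprod
  rw [him]
  simp only [chordParams]
  linarith

/-- The kernel whose derivative in `θ`, the real part of `2 p(w) exp (i θ) / (exp (i θ) - w)²` for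
the tangent field `p`, represents `Re (p(w) Φ'(w))` by the boundary values of `Re Φ`. The constant
of integration makes the kernel vanish at the zeros of `p`. -/
noncomputable def tangentKernel (q : ℂ × ℝ) (w : ℂ) (θ : ℝ) : ℝ :=
  (2 * I * tangentField q.1 q.2 w / (exp (θ * I) - w)).re - (q.2 + 2 * (q.1 * w).im)

lemma hasDerivAt_tangentKernel (q : ℂ × ℝ) {w : ℂ} (hw : ‖w‖ < 1) (θ : ℝ) :
    HasDerivAt (tangentKernel q w)
      (tangentField q.1 q.2 w * (2 * exp (θ * I) / (exp (θ * I) - w) ^ 2)).re θ := by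
  have hne := sub_ne_zero_of_norm_eq_one hw (norm_exp_ofReal_mul_I θ)
  have hexp : HasDerivAt (fun θ : ℝ => exp (θ * I)) (exp (θ * I) * I) θ := by
    simpa using (((hasDerivAt_id θ).ofReal_comp).mul_const I).cexp
  have hquot := ((hasDerivAt_const θ (2 * I * tangentField q.1 q.2 w)).div
    (hexp.sub_const w) hne)
  refine ((reCLM.hasFDerivAt.comp_hasDerivAt θ hquot).sub_const _).congr_deriv ?_
  rw [reCLM_apply]
  congr 1
  linear_combination (-2 * tangentField q.1 q.2 w * exp (θ * I) / (exp (θ * I) - w) ^ 2) * I_mul_I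

lemma tangentKernel_chordParams (a b : ℝ) {w : ℂ} (hw : ‖w‖ < 1) (θ : ℝ) :
    tangentKernel (chordParams a b) w θ =
      -(4 * (Real.sin ((θ - a) / 2) * Real.sin ((b - θ) / 2))) *
        poissonKernel 0 w (exp (θ * I)) := by
  rw [tangentKernel, re_two_I_mul_tangentField_div _ _ hw (norm_exp_ofReal_mul_I θ),
    two_mul_im_add_chordParams]
  ring

lemma tangentKernel_chordParams_nonpos {a b : ℝ} (hb : b < a + 2 * Real.pi) {w : ℂ} (hw : ‖w‖ < 1)
    {θ : ℝ} (hθ : θ ∈ Icc a b) : tangentKernel (chordParams a b) w θ ≤ 0 := by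
  obtain ⟨haθ, hθb⟩ := hθ
  have hP := poissonKernel_zero_nonneg hw (norm_exp_ofReal_mul_I θ)
  have h₁ : 0 ≤ Real.sin ((θ - a) / 2) := Real.sin_nonneg_of_nonneg_of_le_pi
    (by linarith) (by linarith)
  have h₂ : 0 ≤ Real.sin ((b - θ) / 2) := Real.sin_nonneg_of_nonneg_of_le_pi
    (by linarith) (by linarith)
  rw [tangentKernel_chordParams a b hw, neg_mul, neg_nonpos]
  positivity

lemma tangentKernel_chordParams_nonneg {a b : ℝ} (hab : a < b) {w : ℂ} (hw : ‖w‖ < 1)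
    {θ : ℝ} (hθ : θ ∈ Icc b (a + 2 * Real.pi)) : 0 ≤ tangentKernel (chordParams a b) w θ := by
  obtain ⟨hbθ, hθa⟩ := hθ
  have hP := poissonKernel_zero_nonneg hw (norm_exp_ofReal_mul_I θ)
  have h₁ : 0 ≤ Real.sin ((θ - a) / 2) := Real.sin_nonneg_of_nonneg_of_le_pi
    (by linarith) (by linarith)
  have h₂ : Real.sin ((b - θ) / 2) ≤ 0 := Real.sin_nonpos_of_nonpos_of_neg_pi_le
    (by linarith) (by linarith)
  rw [tangentKernel_chordParams a b hw]
  exact mul_nonneg (neg_nonneg.2 (mul_nonpos_of_nonneg_of_nonpos zero_le_four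
    (mul_nonpos_of_nonneg_of_nonpos h₁ h₂))) hP

lemma tangentKernel_chordParams_eq_zero (a b : ℝ) {w : ℂ} (hw : ‖w‖ < 1) {θ : ℝ}
    (hθ : θ = a ∨ θ = b ∨ θ = a + 2 * Real.pi) : tangentKernel (chordParams a b) w θ = 0 := by
  rw [tangentKernel_chordParams a b hw]
  rcases hθ with rfl | rfl | rfl <;> simp

section Unimodal

variable {Φ : ℂ → ℂ} {v : ℝ → ℝ} {M : ℝ}

theorem neg_le_re_tangentField_chordParams_mul_deriv (hd : DifferentiableOn ℂ Φ (ball 0 1))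
    (hM : ∀ z ∈ ball (0 : ℂ) 1, ‖Φ z‖ ≤ M)
    (hv : ∀ᵐ θ : ℝ, HasRadialLimit (fun z => (Φ z).re) (exp (θ * I)) (v θ))
    {a b ε : ℝ} (hab : a < b) (hb : b < a + 2 * Real.pi) {g₁ g₂ : ℝ → ℝ}
    (hg₁ : Monotone g₁) (hg₂ : Antitone g₂)
    (hvg₁ : ∀ᵐ θ, θ ∈ Ioo a b → |v θ - g₁ θ| ≤ ε)
    (hvg₂ : ∀ᵐ θ, θ ∈ Ioo b (a + 2 * Real.pi) → |v θ - g₂ θ| ≤ ε)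
    {w : ℂ} (hw : w ∈ ball (0 : ℂ) 1) :
    -(8 * ε / (1 - ‖w‖) ^ 2) ≤
      (tangentField (chordParams a b).1 (chordParams a b).2 w * deriv Φ w).re := by
  have hw' := mem_ball_zero_iff.1 hw
  have hk := hasDerivAt_tangentKernel (chordParams a b) hw'
  have hk' : Continuous fun θ : ℝ => (tangentField (chordParams a b).1 (chordParams a b).2 w *
      (2 * exp (θ * I) / (exp (θ * I) - w) ^ 2)).re :=
    continuous_re.comp (continuous_const.mul (continuous_two_mul_exp_div_sub_sq hw'))
  have hC : ∀ θ : ℝ, |(tangentField (chordParams a b).1 (chordParams a b).2 w *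
      (2 * exp (θ * I) / (exp (θ * I) - w) ^ 2)).re| ≤ 4 * (2 / (1 - ‖w‖) ^ 2) := fun θ => by
    refine (abs_re_le_norm _).trans (norm_mul_le_of_le ?_ ?_)
    · exact norm_tangentField_le (chordParams_mem a b) hw'.le
    · exact norm_two_mul_div_sub_sq_le hw' (norm_exp_ofReal_mul_I θ)
  have hint : ∀ x y, IntervalIntegrable v volume x y := fun x y => by
    refine (intervalIntegrable_const (c := M)).mono_fun
      (aestronglyMeasurable_of_hasRadialLimit hd hv).restrict (ae_restrict_of_ae ?_)
    filter_upwards [hv] with θ hθ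
    refine (norm_le_of_hasRadialLimit (fun z hz => ?_) hθ).trans (le_abs_self M)
    exact (abs_re_le_norm _).trans (hM z hz)
  have hrise := neg_le_integral_deriv_mul_of_monotone hab.le hk hk' hC
    (fun θ => tangentKernel_chordParams_nonpos hb hw')
    (tangentKernel_chordParams_eq_zero a b hw' (by simp))
    (tangentKernel_chordParams_eq_zero a b hw' (by simp)) hg₁ (hint a b) hvg₁
  have hfall := neg_le_integral_deriv_mul_of_antitone hb.le hk hk' hC
    (fun θ => tangentKernel_chordParams_nonneg hab hw')
    (tangentKernel_chordParams_eq_zero a b hw' (by simp))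
    (tangentKernel_chordParams_eq_zero a b hw' (by simp)) hg₂ (hint b _) hvg₂
  rw [re_mul_deriv_eq_integral hd hM hv hw _ a, ← intervalIntegral.integral_add_adjacent_intervals
    ((hint a b).continuousOn_mul hk'.continuousOn) ((hint b _).continuousOn_mul hk'.continuousOn),
    ← div_eq_inv_mul, le_div_iff₀ Real.two_pi_pos]
  refine le_of_eq_of_le ?_ (add_le_add hrise hfall)
  ring

theorem exists_forall_neg_le_re_tangentField_mul_deriv (hd : DifferentiableOn ℂ Φ (ball 0 1))
    (hM : ∀ z ∈ ball (0 : ℂ) 1, ‖Φ z‖ ≤ M)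
    (hv : ∀ᵐ θ : ℝ, ∃ L, HasRadialLimit (fun z => (Φ z).re) (exp (θ * I)) L)
    (hlt : ∀ c, ∀ x ∈ {z ∈ ball (0 : ℂ) 1 | (Φ z).re < c},
      ∀ y ∈ {z ∈ ball (0 : ℂ) 1 | (Φ z).re < c}, JoinedIn {z ∈ ball (0 : ℂ) 1 | (Φ z).re < c} x y)
    (hgt : ∀ c, ∀ x ∈ {z ∈ ball (0 : ℂ) 1 | c < (Φ z).re},
      ∀ y ∈ {z ∈ ball (0 : ℂ) 1 | c < (Φ z).re}, JoinedIn {z ∈ ball (0 : ℂ) 1 | c < (Φ z).re} x y)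
    {ε : ℝ} (hε : 0 < ε) :
    ∃ q ∈ tangentParams, ∀ w ∈ ball (0 : ℂ) 1,
      -(8 * ε / (1 - ‖w‖) ^ 2) ≤ (tangentField q.1 q.2 w * deriv Φ w).re := by
  obtain ⟨v, hv⟩ : ∃ v : ℝ → ℝ, ∀ᵐ θ : ℝ,
      HasRadialLimit (fun z => (Φ z).re) (exp (θ * I)) (v θ) := by
    classical
    refine ⟨fun θ => if h : ∃ L, HasRadialLimit (fun z => (Φ z).re) (exp (θ * I)) L
      then h.choose else 0, hv.mono fun θ hθ => ?_⟩
    simpa only [dif_pos hθ] using hθ.choose_spec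
  have hvM : ∀ θ : ℝ, HasRadialLimit (fun z => (Φ z).re) (exp (θ * I)) (v θ) → |v θ| ≤ M :=
    fun θ hθ => norm_le_of_hasRadialLimit (fun z hz => (abs_re_le_norm _).trans (hM z hz)) hθ
  obtain ⟨a, b, hab, hb, g₁, g₂, hg₁, hg₂, hvg₁, hvg₂⟩ :=
    exists_monotone_antitone_approx (v := v) (M := M)
      (E := {θ | HasRadialLimit (fun z => (Φ z).re) (exp (θ * I)) (v θ)})
      (fun α hα β hβ γ hγ δ hδ => min_le_max_of_hasRadialLimit hlt hgt hα hβ hγ hδ)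
      Real.two_pi_pos hv
      (fun θ hθ => hvM θ hθ) hε
  exact ⟨chordParams a b, chordParams_mem a b, fun w hw =>
    neg_le_re_tangentField_chordParams_mul_deriv hd hM hv hab hb hg₁ hg₂ hvg₁ hvg₂ hw⟩

lemma exists_forall_nonneg_re_tangentField_mul_of_tendsto {φ : ℕ → ℂ → ℂ} {φ₀ : ℂ → ℂ} {s : Set ℂ}
    {δ : ℕ → ℂ → ℝ} (hφ : ∀ w ∈ s, Tendsto (fun n => φ n w) atTop (𝓝 (φ₀ w)))
    (hδ : ∀ w ∈ s, Tendsto (fun n => δ n w) atTop (𝓝 0))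
    (h : ∀ n, ∃ q ∈ tangentParams, ∀ w ∈ s, δ n w ≤ (tangentField q.1 q.2 w * φ n w).re) :
    ∃ q ∈ tangentParams, ∀ w ∈ s, 0 ≤ (tangentField q.1 q.2 w * φ₀ w).re := by
  choose q hq hqδ using h
  obtain ⟨q₀, hq₀, ν, hν, hlim⟩ := isCompact_tangentParams.tendsto_subseq hq
  refine ⟨q₀, hq₀, fun w hw => ?_⟩
  have hfield := (continuous_tangentField w).continuousAt.tendsto.comp hlim
  exact le_of_tendsto_of_tendsto' ((hδ w hw).comp hν.tendsto_atTop)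
    (continuous_re.continuousAt.tendsto.comp (hfield.mul ((hφ w hw).comp hν.tendsto_atTop)))
    fun n => hqδ (ν n) w hw

end Unimodal

/-! ### Exhausting a convex image from inside -/

lemma exists_isOpen_convex_between {E : Type*} [NormedAddCommGroup E] [NormedSpace ℝ E]
    [FiniteDimensional ℝ E] {Ω K : Set E} (hΩ : IsOpen Ω) (hconv : Convex ℝ Ω) (hK : IsCompact K)
    (hKΩ : K ⊆ Ω) :
    ∃ V C : Set E, IsOpen V ∧ Convex ℝ V ∧ IsCompact C ∧ K ⊆ V ∧ V ⊆ C ∧ C ⊆ Ω := by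
  classical
  have hlocal : ∀ x ∈ Ω, ∃ u : Finset E, x ∈ interior (convexHull ℝ (u : Set E)) ∧
      convexHull ℝ (u : Set E) ⊆ Ω := fun x hx => by
    simpa using (convex_singleton x).exists_subset_interior_convexHull_finset_of_isCompact
      isCompact_singleton (hΩ.mem_nhdsSet.2 (singleton_subset_iff.2 hx))
  choose! u hu huΩ using hlocal
  obtain ⟨t, ht, hcover⟩ := hK.elim_nhds_subcover (fun x => interior (convexHull ℝ (u x : Set E)))
    fun x hx => isOpen_interior.mem_nhds (hu x (hKΩ hx))
  set P : Set E := convexHull ℝ (t.biUnion u : Finset E)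
  have hPΩ : P ⊆ Ω := convexHull_min (fun y hy => by
    obtain ⟨x, hx, hyx⟩ := Finset.mem_biUnion.1 (Finset.mem_coe.1 hy)
    exact huΩ x (hKΩ (ht x hx)) (subset_convexHull ℝ _ hyx)) hconv
  refine ⟨interior P, P, isOpen_interior, (convex_convexHull ℝ _).interior,
    (Finset.finite_toSet _).isCompact_convexHull ℝ, fun y hy => ?_, interior_subset, hPΩ⟩
  obtain ⟨x, hx, hyx⟩ := mem_iUnion₂.1 (hcover hy)
  refine interior_mono (convexHull_mono ?_) hyx
  exact_mod_cast Finset.subset_biUnion_of_mem u hx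

section NearIdentity

lemma norm_sub_self_le_of_mapsTo_ball {ψ : ℂ → ℂ} (hd : DifferentiableOn ℂ ψ (ball 0 1))
    (hmaps : MapsTo ψ (ball 0 1) (ball 0 1)) (h0 : ψ 0 = 0) {z : ℂ} (hz : z ∈ ball (0 : ℂ) 1) :
    ‖ψ z - z‖ ≤ ‖1 - deriv ψ 0‖ * (1 + ‖z‖) / (1 - ‖z‖) := by
  have hz' : ‖z‖ < 1 := mem_ball_zero_iff.1 hz
  have hzero : (0 : ℂ) ∈ ball (0 : ℂ) 1 := mem_ball_self one_pos
  set q : ℂ → ℂ := fun z => dslope ψ 0 z - 1 with hq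
  have hqd : DifferentiableOn ℂ q (ball 0 1) :=
    ((differentiableOn_dslope (isOpen_ball.mem_nhds hzero)).2 hd).sub_const 1
  have hqre : ∀ z ∈ ball (0 : ℂ) 1, (q z).re ≤ 0 := fun z hz => by
    have h := norm_dslope_le_div_of_mapsTo_ball hd (R₂ := 1)
      (by rw [h0]; exact hmaps.mono_right ball_subset_closedBall) hz
    rw [div_one] at h
    rw [hq, sub_re, one_re, sub_nonpos]
    exact (re_le_norm _).trans h
  have hψ : ψ z - z = z * q z := by
    have := sub_smul_dslope ψ 0 z
    rw [h0, sub_zero, sub_zero, smul_eq_mul] at this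
    rw [hq, mul_sub, mul_one, this]
  have hbound : ∀ M : ℝ, 0 < M →
      ‖q z‖ ≤ 2 * M * ‖z‖ / (1 - ‖z‖) + ‖q 0‖ * (1 + ‖z‖) / (1 - ‖z‖) := fun M hM =>
    borelCaratheodory hM hqd (fun z hz => (hqre z hz).trans hM.le) one_pos hz
  have hlim : ‖q z‖ ≤ ‖q 0‖ * (1 + ‖z‖) / (1 - ‖z‖) := by
    have hcont : Continuous fun M : ℝ =>
        2 * M * ‖z‖ / (1 - ‖z‖) + ‖q 0‖ * (1 + ‖z‖) / (1 - ‖z‖) := by fun_prop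
    refine ge_of_tendsto (x := 𝓝[>] (0 : ℝ)) ?_ (eventually_mem_nhdsWithin.mono hbound)
    simpa using (hcont.tendsto 0).mono_left nhdsWithin_le_nhds
  calc ‖ψ z - z‖ = ‖z‖ * ‖q z‖ := by rw [hψ, norm_mul]
    _ ≤ ‖q z‖ := mul_le_of_le_one_left (norm_nonneg _) hz'.le
    _ ≤ ‖1 - deriv ψ 0‖ * (1 + ‖z‖) / (1 - ‖z‖) := by
      rwa [norm_sub_rev (1 : ℂ), ← dslope_same ψ 0]

lemma tendstoLocallyUniformlyOn_id_of_deriv {ψ : ℕ → ℂ → ℂ}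
    (hd : ∀ n, DifferentiableOn ℂ (ψ n) (ball 0 1))
    (hmaps : ∀ n, MapsTo (ψ n) (ball 0 1) (ball 0 1)) (h0 : ∀ n, ψ n 0 = 0)
    (hderiv : Tendsto (fun n => deriv (ψ n) 0) atTop (𝓝 1)) :
    TendstoLocallyUniformlyOn ψ id atTop (ball 0 1) := by
  rw [tendstoLocallyUniformlyOn_iff_forall_isCompact isOpen_ball]
  intro K hK hKc
  rw [Metric.tendstoUniformlyOn_iff]
  intro ε hε
  have hcont : ContinuousOn (fun z : ℂ => (1 + ‖z‖) / (1 - ‖z‖)) K :=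
    (by fun_prop : Continuous fun z : ℂ => 1 + ‖z‖).continuousOn.div (by fun_prop) fun z hz =>
      (sub_pos.2 (mem_ball_zero_iff.1 (hK hz))).ne'
  obtain ⟨B, hB⟩ := hKc.bddAbove_image hcont
  have hsmall : Tendsto (fun n => ‖1 - deriv (ψ n) 0‖ * B) atTop (𝓝 0) := by
    simpa using (hderiv.const_sub 1).norm.mul_const B
  filter_upwards [hsmall.eventually_lt_const hε] with n hn z hz
  rw [dist_comm, dist_eq_norm, id_eq]
  calc ‖ψ n z - z‖ ≤ ‖1 - deriv (ψ n) 0‖ * ((1 + ‖z‖) / (1 - ‖z‖)) := by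
        rw [← mul_div_assoc]
        exact norm_sub_self_le_of_mapsTo_ball (hd n) (hmaps n) (h0 n) (hK hz)
    _ ≤ ‖1 - deriv (ψ n) 0‖ * B := by gcongr; exact hB (mem_image_of_mem _ hz)
    _ < ε := hn

lemma tendsto_deriv_comp_of_tendsto_deriv {ψ : ℕ → ℂ → ℂ} {F : ℂ → ℂ}
    (hF : DifferentiableOn ℂ F (ball 0 1))
    (hd : ∀ n, DifferentiableOn ℂ (ψ n) (ball 0 1))
    (hmaps : ∀ n, MapsTo (ψ n) (ball 0 1) (ball 0 1)) (h0 : ∀ n, ψ n 0 = 0)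
    (hderiv : Tendsto (fun n => deriv (ψ n) 0) atTop (𝓝 1)) {w : ℂ} (hw : w ∈ ball (0 : ℂ) 1) :
    Tendsto (fun n => deriv (F ∘ ψ n) w) atTop (𝓝 (deriv F w)) := by
  have hunif := tendstoLocallyUniformlyOn_id_of_deriv hd hmaps h0 hderiv
  have hψ : Tendsto (fun n => ψ n w) atTop (𝓝 w) := hunif.tendsto_at hw
  have hψ' : Tendsto (fun n => deriv (ψ n) w) atTop (𝓝 1) := by
    have := (hunif.deriv (.of_forall hd) isOpen_ball).tendsto_at hw
    simpa [Function.comp_def] using this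
  have hchain : ∀ n, deriv (F ∘ ψ n) w = deriv F (ψ n w) * deriv (ψ n) w := fun n =>
    deriv_comp w (hF.differentiableAt (isOpen_ball.mem_nhds (hmaps n hw)))
      ((hd n).differentiableAt (isOpen_ball.mem_nhds hw))
  simp only [hchain]
  have hF' := (hF.deriv isOpen_ball).continuousOn.continuousAt (isOpen_ball.mem_nhds hw)
  simpa using (hF'.tendsto.comp hψ).mul hψ'

end NearIdentity

section ConvexImage

variable {h g ψ : ℂ → ℂ} {U V C : Set ℂ}

/-- The analytic shear of the harmonic function `f = h + conj g` in the direction `τ`: the analytic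
function with real part `Re (τ f)`. -/
def shear (h g : ℂ → ℂ) (τ : ℂ) (z : ℂ) : ℂ := τ * h z + (starRingEnd ℂ) τ * g z

lemma re_shear (h g : ℂ → ℂ) (τ z : ℂ) : (shear h g τ z).re = (τ * harm h g z).re := by
  simp only [shear, harm, mul_add, add_re, mul_re, conj_re, conj_im]
  ring

lemma differentiableOn_shear (hh : DifferentiableOn ℂ h U) (hg : DifferentiableOn ℂ g U) (τ : ℂ) :
    DifferentiableOn ℂ (shear h g τ) U :=
  (hh.const_mul τ).add (hg.const_mul _)

lemma isPathConnected_inter_preimage_of_bijOn (hd : DifferentiableOn ℂ ψ (ball 0 1))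
    (hψ : BijOn ψ (ball 0 1) U) {S : Set ℂ} (hS : IsPathConnected S) (hSU : S ⊆ U) :
    IsPathConnected (ball 0 1 ∩ ψ ⁻¹' S) := by
  rw [← hψ.image_eq] at hSU
  rw [← image_invFunOn hψ.injOn hSU]
  refine hS.image' fun y hy => ?_
  obtain ⟨z, hz, rfl⟩ := hSU hy
  exact (hasDerivAt_invFunOn isOpen_ball hd hψ.injOn hz).continuousAt.continuousWithinAt

lemma isPathConnected_setOf_re_shear_comp_mem (hh : DifferentiableOn ℂ h (ball 0 1))
    (hg : DifferentiableOn ℂ g (ball 0 1)) (hinj : InjOn (harm h g) (ball 0 1))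
    (hV : Convex ℝ V) (hVsub : V ⊆ harm h g '' ball 0 1) (hd : DifferentiableOn ℂ ψ (ball 0 1))
    (hψ : BijOn ψ (ball 0 1) (ball 0 1 ∩ harm h g ⁻¹' V)) (τ : ℂ) {J : Set ℝ} (hJ : Convex ℝ J)
    (hne : {z ∈ ball (0 : ℂ) 1 | ((shear h g τ ∘ ψ) z).re ∈ J}.Nonempty) :
    IsPathConnected {z ∈ ball (0 : ℂ) 1 | ((shear h g τ ∘ ψ) z).re ∈ J} := by
  set H : Set ℂ := {w | (τ * w).re ∈ J} with hH
  have hHconv : Convex ℝ H :=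
    hJ.linear_preimage (reLm ∘ₗ LinearMap.mulLeft ℝ τ)
  have hset : {z ∈ ball (0 : ℂ) 1 | ((shear h g τ ∘ ψ) z).re ∈ J} =
      ball 0 1 ∩ ψ ⁻¹' (ball 0 1 ∩ harm h g ⁻¹' (V ∩ H)) := by
    ext z
    simp only [Function.comp_apply, re_shear, mem_inter_iff, mem_preimage, hH,
      mem_ofPred_eq]
    exact ⟨fun hz => ⟨hz.1, (hψ.mapsTo hz.1).1, (hψ.mapsTo hz.1).2, hz.2⟩,
      fun hz => ⟨hz.1, hz.2.2.2⟩⟩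
  rw [hset] at hne ⊢
  obtain ⟨z, -, hz⟩ := hne
  exact isPathConnected_inter_preimage_of_bijOn hd hψ
    (isPathConnected_inter_preimage_harm isOpen_ball hh hg hinj (hV.inter hHconv) ⟨_, hz.2⟩
      (inter_subset_left.trans hVsub)) (by gcongr; exact inter_subset_left)

theorem exists_tangentField_comp (hh : DifferentiableOn ℂ h (ball 0 1))
    (hg : DifferentiableOn ℂ g (ball 0 1)) (hinj : InjOn (harm h g) (ball 0 1))
    (hV : Convex ℝ V) (hC : IsCompact C) (hVC : V ⊆ C) (hCsub : C ⊆ harm h g '' ball 0 1)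
    (hd : DifferentiableOn ℂ ψ (ball 0 1))
    (hψ : BijOn ψ (ball 0 1) (ball 0 1 ∩ harm h g ⁻¹' V)) (τ : ℂ) :
    ∃ q ∈ tangentParams, ∀ w ∈ ball (0 : ℂ) 1,
      0 ≤ (tangentField q.1 q.2 w * deriv (shear h g τ ∘ ψ) w).re := by
  have hK := isCompact_inter_preimage_harm isOpen_ball hh hg hinj hC hCsub
  have hψK : MapsTo ψ (ball 0 1) (ball 0 1 ∩ harm h g ⁻¹' C) :=
    hψ.mapsTo.mono_right (by gcongr)
  have hshear := differentiableOn_shear hh hg τ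
  have hd' : DifferentiableOn ℂ (shear h g τ ∘ ψ) (ball 0 1) :=
    hshear.comp hd (hψK.mono_right inter_subset_left)
  obtain ⟨M, hM⟩ := hK.exists_bound_of_continuousOn (hshear.continuousOn.mono inter_subset_left)
  have hlimits : ∀ᵐ θ : ℝ, ∃ L,
      HasRadialLimit (fun z => ((shear h g τ ∘ ψ) z).re) (exp (θ * I)) L := by
    have hvol : volume (ψ '' ball 0 1) ≠ ⊤ :=
      ((measure_mono hψK.image_subset).trans_lt hK.measure_lt_top).ne
    filter_upwards [ae_exists_radialLimit hd hψ.injOn hvol] with θ ⟨L, hL⟩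
    have hLK : L ∈ ball (0 : ℂ) 1 ∩ harm h g ⁻¹' C :=
      hK.isClosed.mem_of_tendsto hL (eventually_of_mem (Ico_mem_nhdsLT zero_lt_one) fun r hr =>
        hψK (ofReal_mul_exp_mul_I_mem_ball hr))
    have hcont := hshear.continuousOn.continuousAt (isOpen_ball.mem_nhds hLK.1)
    exact ⟨_, (continuous_re.continuousAt.tendsto.comp hcont.tendsto).comp hL⟩
  have hjoined : ∀ {J : Set ℝ}, Convex ℝ J →
      ∀ x ∈ {z ∈ ball (0 : ℂ) 1 | ((shear h g τ ∘ ψ) z).re ∈ J},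
      ∀ y ∈ {z ∈ ball (0 : ℂ) 1 | ((shear h g τ ∘ ψ) z).re ∈ J},
        JoinedIn {z ∈ ball (0 : ℂ) 1 | ((shear h g τ ∘ ψ) z).re ∈ J} x y :=
    fun hJ x hx y hy => (isPathConnected_setOf_re_shear_comp_mem hh hg hinj hV (hVC.trans hCsub)
      hd hψ τ hJ ⟨x, hx⟩).joinedIn x hx y hy
  refine exists_forall_nonneg_re_tangentField_mul_of_tendsto
    (φ := fun _ => deriv (shear h g τ ∘ ψ))
    (δ := fun n w => -(8 * (1 / ((n : ℝ) + 1)) / (1 - ‖w‖) ^ 2))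
    (fun _ _ => tendsto_const_nhds) (fun w _ => ?_) fun n =>
      exists_forall_neg_le_re_tangentField_mul_deriv hd' (fun z hz => hM _ (hψK hz)) hlimits
        (fun c => hjoined (convex_Iio c)) (fun c => hjoined (convex_Ioi c)) (by positivity)
  simpa only [mul_zero, zero_div, neg_zero] using
    ((tendsto_one_div_add_atTop_nhds_zero_nat (𝕜 := ℝ).const_mul 8).div_const ((1 - ‖w‖) ^ 2)).neg

lemma le_norm_deriv_of_bijOn (hd : DifferentiableOn ℂ ψ (ball 0 1)) (hψ : BijOn ψ (ball 0 1) U)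
    (hψ0 : ψ 0 = 0) {r : ℝ} (hr : 0 < r) (hrU : ball 0 r ⊆ U) : r ≤ ‖deriv ψ 0‖ := by
  set φ : ℂ → ℂ := Function.invFunOn ψ (ball 0 1)
  have h0 : (0 : ℂ) ∈ ball (0 : ℂ) 1 := mem_ball_self one_pos
  have hφ0 : φ 0 = 0 := by
    conv_lhs => rw [← hψ0]
    exact hψ.injOn.leftInvOn_invFunOn h0
  have hφ : MapsTo φ (ball 0 r) (closedBall (φ 0) 1) := by
    rw [hφ0]
    exact fun y hy => ball_subset_closedBall (hψ.surjOn.mapsTo_invFunOn (hrU hy))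
  have hφd : DifferentiableOn ℂ φ (ball 0 r) := fun y hy => by
    obtain ⟨z, hz, rfl⟩ := hψ.surjOn (hrU hy)
    exact (hasDerivAt_invFunOn isOpen_ball hd hψ.injOn hz).differentiableAt.differentiableWithinAt
  have hderiv : deriv φ 0 = (deriv ψ 0)⁻¹ := by
    conv_lhs => rw [← hψ0]
    exact (hasDerivAt_invFunOn isOpen_ball hd hψ.injOn h0).deriv
  have hpos : 0 < ‖deriv ψ 0‖ := norm_pos_iff.2 (deriv_ne_zero_of_injOn isOpen_ball hd hψ.injOn h0)
  have hschwarz := norm_deriv_le_div_of_mapsTo_ball hφd hφ hr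
  rwa [hderiv, norm_inv, one_div, inv_le_inv₀ hpos hr] at hschwarz

lemma exists_riemannMap_preimage_convex (hh : DifferentiableOn ℂ h (ball 0 1))
    (hg : DifferentiableOn ℂ g (ball 0 1)) (hinj : InjOn (harm h g) (ball 0 1))
    (hconv : Convex ℝ (harm h g '' ball 0 1)) {r : ℝ} (hr : r ∈ Ioo (0 : ℝ) 1) :
    ∃ (V C : Set ℂ) (ψ : ℂ → ℂ), Convex ℝ V ∧ IsCompact C ∧ V ⊆ C ∧ C ⊆ harm h g '' ball 0 1 ∧
      DifferentiableOn ℂ ψ (ball 0 1) ∧ BijOn ψ (ball 0 1) (ball 0 1 ∩ harm h g ⁻¹' V) ∧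
      ψ 0 = 0 ∧ ‖1 - deriv ψ 0‖ ≤ 1 - r := by
  obtain ⟨hr0, hr1⟩ := hr
  have hsub : closedBall (0 : ℂ) r ⊆ ball 0 1 := closedBall_subset_ball hr1
  obtain ⟨V, C, hVo, hV, hC, hKV, hVC, hCsub⟩ := exists_isOpen_convex_between
    (isOpen_image_harm isOpen_ball hh hg hinj) hconv
    ((isCompact_closedBall (0 : ℂ) r).image_of_continuousOn ((continuousOn_harm hh hg).mono hsub))
    (image_mono hsub)
  set W := ball (0 : ℂ) 1 ∩ harm h g ⁻¹' V
  have hrW : closedBall 0 r ⊆ W := fun z hz => ⟨hsub hz, hKV (mem_image_of_mem _ hz)⟩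
  have h0W : (0 : ℂ) ∈ W := hrW (mem_closedBall_self hr0.le)
  obtain ⟨ψ, hd, hψ, hψ0, hψpos⟩ := exists_riemannMap
    ((continuousOn_harm hh hg).isOpen_inter_preimage isOpen_ball hVo)
    (isSimplyConnected_inter_preimage_harm isOpen_ball hh hg hinj hV ⟨_, h0W.2⟩
      (hVC.trans hCsub)) inter_subset_left h0W
  refine ⟨V, C, ψ, hV, hC, hVC, hCsub, hd, hψ, hψ0, ?_⟩
  have hle : ‖deriv ψ 0‖ ≤ 1 := by
    simpa using norm_deriv_le_div_of_mapsTo_ball (R₂ := 1) hd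
      (by rw [hψ0]; exact hψ.mapsTo.mono_right (inter_subset_left.trans ball_subset_closedBall))
      one_pos
  have hge : r ≤ ‖deriv ψ 0‖ := le_norm_deriv_of_bijOn hd hψ hψ0 hr0
    (ball_subset_closedBall.trans hrW)
  rw [hψpos, ← ofReal_one, ← ofReal_sub, norm_real, Real.norm_of_nonneg (sub_nonneg.2 hle)]
  linarith

theorem exists_tangentField_shear (hh : DifferentiableOn ℂ h (ball 0 1))
    (hg : DifferentiableOn ℂ g (ball 0 1)) (hinj : InjOn (harm h g) (ball 0 1))
    (hconv : Convex ℝ (harm h g '' ball 0 1)) (τ : ℂ) :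
    ∃ q ∈ tangentParams, ∀ w ∈ ball (0 : ℂ) 1,
      0 ≤ (tangentField q.1 q.2 w * deriv (shear h g τ) w).re := by
  obtain ⟨r, -, hr, hlim⟩ := exists_seq_strictMono_tendsto' (zero_lt_one (α := ℝ))
  choose V C ψ hV hC hVC hCsub hd hψ hψ0 hψ' using fun n =>
    exists_riemannMap_preimage_convex hh hg hinj hconv (hr n)
  have hderiv : Tendsto (fun n => deriv (ψ n) 0) atTop (𝓝 1) := by
    rw [tendsto_iff_norm_sub_tendsto_zero]
    refine squeeze_zero (fun _ => norm_nonneg _) (fun n => ?_) (by simpa using hlim.const_sub 1)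
    rw [norm_sub_rev]
    exact hψ' n
  exact exists_forall_nonneg_re_tangentField_mul_of_tendsto (δ := fun _ _ => 0)
    (fun w hw => tendsto_deriv_comp_of_tendsto_deriv (differentiableOn_shear hh hg τ) hd
      (fun n => (hψ n).mapsTo.mono_right inter_subset_left) hψ0 hderiv hw)
    (fun _ _ => tendsto_const_nhds) fun n =>
      exists_tangentField_comp hh hg hinj (hV n) (hC n) (hVC n) (hCsub n) (hd n) (hψ n) τ

end ConvexImage

/-! ### The pre-Schwarzian derivative of an analytic shear -/

lemma norm_add_one_sq_sub (p : ℂ) : ‖p + 1‖ ^ 2 - ‖p - 1‖ ^ 2 = 4 * p.re := by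
  simp only [← normSq_eq_norm_sq, normSq_apply, add_re, sub_re, add_im, sub_im, one_re, one_im]
  ring

lemma norm_deriv_mul_one_sub_sq_le_of_re_pos {p : ℂ → ℂ} (hd : DifferentiableOn ℂ p (ball 0 1))
    (hp : ∀ z ∈ ball (0 : ℂ) 1, 0 < (p z).re) {z : ℂ} (hz : z ∈ ball (0 : ℂ) 1) :
    ‖deriv p z‖ * (1 - ‖z‖ ^ 2) ≤ 2 * (p z).re := by
  have hne : ∀ z ∈ ball (0 : ℂ) 1, p z + 1 ≠ 0 := fun z hz h => by
    have := congrArg re h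
    rw [add_re, one_re, zero_re] at this
    linarith [hp z hz]
  set ω : ℂ → ℂ := fun z => (p z - 1) / (p z + 1)
  have hωd : DifferentiableOn ℂ ω (ball 0 1) := (hd.sub_const 1).div (hd.add_const 1) hne
  have hω : MapsTo ω (ball 0 1) (ball 0 1) := fun z hz => by
    rw [mem_ball_zero_iff, norm_div, div_lt_one (norm_pos_iff.2 (hne z hz))]
    refine lt_of_pow_lt_pow_left₀ 2 (norm_nonneg _) ?_
    linarith [norm_add_one_sq_sub (p z), hp z hz]
  have hderiv : deriv ω z = 2 * deriv p z / (p z + 1) ^ 2 := by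
    have hpz := (hd.differentiableAt (isOpen_ball.mem_nhds hz)).hasDerivAt
    have hωz : HasDerivAt ω _ z := (hpz.sub_const 1).div (hpz.add_const 1) (hne z hz)
    rw [hωz.deriv]
    ring
  have hpick := norm_deriv_mul_one_sub_sq_le_of_mapsTo_ball hωd hω hz
  have hpos : 0 < ‖p z + 1‖ ^ 2 := pow_pos (norm_pos_iff.2 (hne z hz)) 2
  rw [hderiv, norm_div, norm_mul, norm_pow, norm_ofNat, norm_div, div_pow,
    one_sub_div hpos.ne', norm_add_one_sq_sub, div_mul_eq_mul_div,
    div_le_div_iff_of_pos_right hpos] at hpick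
  linarith

lemma norm_deriv_mul_one_sub_sq_le_of_re_nonneg {p : ℂ → ℂ} (hd : DifferentiableOn ℂ p (ball 0 1))
    (hp : ∀ z ∈ ball (0 : ℂ) 1, 0 ≤ (p z).re) {z : ℂ} (hz : z ∈ ball (0 : ℂ) 1) :
    ‖deriv p z‖ * (1 - ‖z‖ ^ 2) ≤ 2 * (p z).re := by
  refine le_of_forall_pos_le_add fun ε hε => ?_
  have h := norm_deriv_mul_one_sub_sq_le_of_re_pos (hd.add_const ((ε / 2 : ℝ) : ℂ))
    (fun z hz => by rw [add_re, ofReal_re]; linarith [hp z hz]) hz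
  rw [deriv_add_const, add_re, ofReal_re] at h
  linarith

/-- The rotation of the tangent field seen from `z`: if `z` is moved to the origin by a disk
automorphism, the transported field has parameter `s = tangentMoment q z / (1 - |z|²)`. -/
noncomputable def tangentMoment (q : ℂ × ℝ) (z : ℂ) : ℝ := 4 * (q.1 * z).im + q.2 * (1 + ‖z‖ ^ 2)

lemma hasDerivAt_tangentField (c : ℂ) (s : ℝ) (z : ℂ) :
    HasDerivAt (tangentField c s) (2 * c * z + I * s) z := by
  have h := (((hasDerivAt_pow 2 z).const_mul c).add ((hasDerivAt_id z).const_mul (I * s))).sub_const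
    ((starRingEnd ℂ) c)
  refine h.congr_deriv ?_
  norm_num
  ring

lemma one_sub_sq_mul_deriv_tangentField (q : ℂ × ℝ) (z : ℂ) :
    (1 - ‖z‖ ^ 2) * (2 * q.1 * z + I * q.2) =
      I * tangentMoment q z - 2 * (starRingEnd ℂ) z * tangentField q.1 q.2 z := by
  have him : ((2 * (q.1 * z).im : ℝ) : ℂ) * I =
      q.1 * z - (starRingEnd ℂ) q.1 * (starRingEnd ℂ) z := by
    rw [← map_mul, sub_conj]
  have hnorm : ((‖z‖ : ℝ) : ℂ) ^ 2 = (starRingEnd ℂ) z * z := (conj_mul' z).symm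
  simp only [tangentMoment, tangentField, ofReal_add, ofReal_mul, ofReal_pow, hnorm] at him ⊢
  push_cast at him ⊢
  linear_combination (-2) * him

lemma four_mul_norm_tangentField_sq {q : ℂ × ℝ} (hq : ‖q.1‖ = 1) (z : ℂ) :
    4 * ‖tangentField q.1 q.2 z‖ ^ 2 =
      tangentMoment q z ^ 2 + (4 - q.2 ^ 2) * (1 - ‖z‖ ^ 2) ^ 2 := by
  have hc : q.1.re * q.1.re + q.1.im * q.1.im = 1 := by
    rw [← normSq_apply, normSq_eq_norm_sq, hq, one_pow]
  rw [← normSq_eq_norm_sq, tangentMoment, ← normSq_eq_norm_sq]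
  simp only [tangentField, normSq_apply, sub_re, add_re, mul_re, sub_im, add_im, mul_im, I_re, I_im,
    ofReal_re, ofReal_im, conj_re, conj_im, sq z]
  linear_combination 4 * (1 - (z.re * z.re + z.im * z.im)) ^ 2 * hc

lemma abs_tangentMoment_le {q : ℂ × ℝ} (hq : q ∈ tangentParams) (z : ℂ) :
    |tangentMoment q z| ≤ 2 * ‖tangentField q.1 q.2 z‖ := by
  obtain ⟨hc, hs⟩ := hq
  refine abs_le_of_sq_le_sq' ?_ (by positivity) |> abs_le.2
  have hs' : 0 ≤ 4 - q.2 ^ 2 := by nlinarith [hs.1, hs.2]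
  linarith [four_mul_norm_tangentField_sq (mem_sphere_zero_iff_norm.1 hc) z,
    mul_nonneg hs' (sq_nonneg (1 - ‖z‖ ^ 2))]

lemma tangentField_ne_zero {q : ℂ × ℝ} (hq : q ∈ tangentParams) {z : ℂ}
    (hz : z ∈ ball (0 : ℂ) 1) : tangentField q.1 q.2 z ≠ 0 := by
  intro h0
  have hz' := mem_ball_zero_iff.1 hz
  have hm : tangentMoment q z = 0 := by simpa [h0] using abs_tangentMoment_le hq z
  have hc : ‖q.1‖ = 1 := mem_sphere_zero_iff_norm.1 hq.1
  have hs : q.2 ^ 2 = 4 := by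
    have h := four_mul_norm_tangentField_sq hc z
    rw [h0, hm, norm_zero, zero_pow two_ne_zero, mul_zero, zero_add, zero_eq_mul,
      pow_eq_zero_iff two_ne_zero, sub_eq_zero, sub_eq_zero] at h
    refine (h.resolve_right fun h1 => ?_).symm
    nlinarith [norm_nonneg z]
  have him : |(q.1 * z).im| ≤ ‖z‖ := by
    simpa [hc] using abs_im_le_norm (q.1 * z)
  rw [tangentMoment] at hm
  obtain ⟨h₁, h₂⟩ := abs_le.1 him
  rcases sq_eq_sq_iff_eq_or_eq_neg.1 (hs.trans (by norm_num : (4 : ℝ) = 2 ^ 2)) with h | h <;>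
  · rw [h] at hm
    nlinarith

lemma norm_le_two_of_norm_mul_mul_le {a p A : ℂ} (ha : a ≠ 0) (hp : p ≠ 0)
    (h : ‖a * (p * A)‖ ≤ 2 * (a * p).re) : ‖A‖ ≤ 2 := by
  have := h.trans (mul_le_mul_of_nonneg_left (re_le_norm _) zero_le_two)
  rw [← mul_assoc, norm_mul, mul_comm] at this
  exact le_of_mul_le_mul_right this (norm_pos_iff.2 (mul_ne_zero ha hp))

lemma norm_le_two_of_norm_mul_add_le {a p₁ p₂ A : ℂ} {m₁ m₂ : ℝ} (ha : a ≠ 0) (hp₁ : p₁ ≠ 0)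
    (hp₂ : p₂ ≠ 0) (hm₁ : 0 ≤ m₁) (hm₂ : m₂ ≤ 0) (hmp₂ : |m₂| ≤ 2 * ‖p₂‖)
    (h₁ : ‖a * (p₁ * A + I * m₁)‖ ≤ 2 * (a * p₁).re)
    (h₂ : ‖a * (p₂ * A + I * m₂)‖ ≤ 2 * (a * p₂).re) : ‖A‖ ≤ 2 := by
  rcases hm₁.eq_or_lt with rfl | hm₁
  · exact norm_le_two_of_norm_mul_mul_le ha hp₁ (by simpa using h₁)
  have hcancel : ‖a * ((m₁ * p₂ - m₂ * p₁) * A)‖ ≤ 2 * (a * (m₁ * p₂ - m₂ * p₁)).re := by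
    calc ‖a * ((m₁ * p₂ - m₂ * p₁) * A)‖
      _ = ‖m₁ * (a * (p₂ * A + I * m₂)) + (-m₂ : ℝ) * (a * (p₁ * A + I * m₁))‖ := by
          congr 1; push_cast; ring
      _ ≤ m₁ * (2 * (a * p₂).re) + -m₂ * (2 * (a * p₁).re) := by
          refine norm_add_le_of_le ?_ ?_ <;>
          rw [norm_mul, norm_real, Real.norm_of_nonneg (by linarith)] <;> gcongr
          linarith
      _ = 2 * (a * (m₁ * p₂ - m₂ * p₁)).re := by
          simp only [mul_re, mul_im, sub_re, sub_im, ofReal_re, ofReal_im]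
          ring
  by_cases hP : (m₁ * p₂ - m₂ * p₁ : ℂ) = 0
  · have hre₁ : 0 ≤ (a * p₁).re := by linarith [(norm_nonneg _).trans h₁]
    have hre : m₁ * (a * p₂).re = m₂ * (a * p₁).re := by
      rw [← re_ofReal_mul, ← re_ofReal_mul, mul_left_comm, sub_eq_zero.1 hP, mul_left_comm]
    have hre₂ : (a * p₂).re ≤ 0 :=
      nonpos_of_mul_nonpos_right (hre.trans_le (mul_nonpos_of_nonpos_of_nonneg hm₂ hre₁)) hm₁
    have hzero : p₂ * A + I * m₂ = 0 := by
      have := norm_le_zero_iff.1 (h₂.trans (by linarith))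
      exact (mul_eq_zero.1 this).resolve_left ha
    have hnorm : ‖A‖ * ‖p₂‖ = |m₂| := by
      rw [mul_comm, ← norm_mul, eq_neg_of_add_eq_zero_left hzero, norm_neg, norm_mul, norm_I,
        one_mul, norm_real, Real.norm_eq_abs]
    exact le_of_mul_le_mul_right (hnorm.trans_le hmp₂) (norm_pos_iff.2 hp₂)
  · exact norm_le_two_of_norm_mul_mul_le ha hP hcancel

theorem exists_mem_sphere_nonneg_nonpos_of_neg_mem {E F : Type*} [NormedAddCommGroup E]
    [NormedSpace ℝ E] (hE : 1 < Module.rank ℝ E) [TopologicalSpace F] [Neg F] {K : Set (E × F)}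
    (hK : IsCompact K) (hneg : ∀ p ∈ K, -p ∈ K) (hsurj : sphere 0 1 ⊆ Prod.fst '' K) {m : F → ℝ}
    (hm : Continuous m) (hodd : ∀ q, m (-q) = -m q) :
    ∃ τ ∈ sphere (0 : E) 1, (∃ q, (τ, q) ∈ K ∧ 0 ≤ m q) ∧ ∃ q, (τ, q) ∈ K ∧ m q ≤ 0 := by
  set S₁ : Set E := Prod.fst '' (K ∩ {p | 0 ≤ m p.2})
  set S₂ : Set E := Prod.fst '' (K ∩ {p | m p.2 ≤ 0})
  have hclosed₁ : IsClosed S₁ := ((hK.inter_right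
    (isClosed_le continuous_const (hm.comp continuous_snd))).image continuous_fst).isClosed
  have hclosed₂ : IsClosed S₂ := ((hK.inter_right
    (isClosed_le (hm.comp continuous_snd) continuous_const)).image continuous_fst).isClosed
  have hcover : sphere 0 1 ⊆ S₁ ∪ S₂ := hsurj.trans <| by
    rw [← image_union, ← inter_union_distrib_left]
    exact image_mono fun p hp => ⟨hp, le_total 0 (m p.2)⟩
  have hswap₁ : ∀ τ ∈ S₁, -τ ∈ S₂ := by
    rintro _ ⟨p, ⟨hpK, hp⟩, rfl⟩
    exact ⟨-p, ⟨hneg p hpK, (hodd _).trans_le (neg_nonpos.2 hp)⟩, rfl⟩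
  have hswap₂ : ∀ τ ∈ S₂, -τ ∈ S₁ := by
    rintro _ ⟨p, ⟨hpK, hp⟩, rfl⟩
    exact ⟨-p, ⟨hneg p hpK, (neg_nonneg.2 hp).trans_eq (hodd _).symm⟩, rfl⟩
  have hne : (sphere (0 : E) 1 ∩ S₁).Nonempty ∧ (sphere (0 : E) 1 ∩ S₂).Nonempty := by
    have : Nontrivial E := (rank_pos_iff_nontrivial (R := ℝ)).1 (zero_lt_one.trans hE)
    obtain ⟨τ, hτ⟩ : (sphere (0 : E) 1).Nonempty := NormedSpace.sphere_nonempty.2 zero_le_one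
    have hτ' : -τ ∈ sphere (0 : E) 1 := by simpa using hτ
    rcases hcover hτ with h | h
    · exact ⟨⟨τ, hτ, h⟩, ⟨-τ, hτ', hswap₁ τ h⟩⟩
    · exact ⟨⟨-τ, hτ', hswap₂ τ h⟩, ⟨τ, hτ, h⟩⟩
  obtain ⟨τ, hτ, ⟨⟨_, q₁⟩, ⟨hK₁, hq₁⟩, rfl⟩, ⟨⟨_, q₂⟩, ⟨hK₂, hq₂⟩, rfl⟩⟩ :=
    isPreconnected_closed_iff.1 (isPreconnected_sphere hE 0 1) S₁ S₂ hclosed₁ hclosed₂ hcover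
      hne.1 hne.2
  exact ⟨_, hτ, ⟨q₁, hK₁, hq₁⟩, q₂, hK₂, hq₂⟩

lemma neg_mem_tangentParams {q : ℂ × ℝ} (hq : q ∈ tangentParams) : -q ∈ tangentParams := by
  obtain ⟨hc, hs⟩ := hq
  exact ⟨by simpa using hc, neg_le_neg hs.2, by simpa using neg_le_neg hs.1⟩

lemma tangentField_neg (c : ℂ) (s : ℝ) (z : ℂ) :
    tangentField (-c) (-s) z = -tangentField c s z := by
  simp only [tangentField, map_neg, ofReal_neg]
  ring

lemma tangentMoment_neg (q : ℂ × ℝ) (z : ℂ) : tangentMoment (-q) z = -tangentMoment q z := by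
  simp only [tangentMoment, Prod.fst_neg, Prod.snd_neg, neg_mul, neg_im]
  ring

section Shear

variable {h g : ℂ → ℂ} {U : Set ℂ} {z : ℂ}

lemma shear_neg (h g : ℂ → ℂ) (τ z : ℂ) : shear h g (-τ) z = -shear h g τ z := by
  simp only [shear, map_neg]
  ring

lemma deriv_shear (hU : IsOpen U) (hh : DifferentiableOn ℂ h U) (hg : DifferentiableOn ℂ g U)
    (hz : z ∈ U) (τ : ℂ) :
    deriv (shear h g τ) z = shear (deriv h) (deriv g) τ z := by
  have hh' := (hh.differentiableAt (hU.mem_nhds hz)).hasDerivAt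
  have hg' := (hg.differentiableAt (hU.mem_nhds hz)).hasDerivAt
  exact ((hh'.const_mul τ).add (hg'.const_mul _)).deriv

lemma shear_ne_zero (hne : ‖h z‖ ≠ ‖g z‖) {τ : ℂ} (hτ : τ ≠ 0) : shear h g τ z ≠ 0 := by
  intro h0
  have := congrArg norm (eq_neg_of_add_eq_zero_left h0)
  rw [norm_neg, norm_mul, norm_mul, RCLike.norm_conj] at this
  exact hne (mul_left_cancel₀ (norm_ne_zero_iff.2 hτ) this)

/-- The pairs of a direction `τ` and parameters of a normalised tangent field `p` such that
`Re (p F) ≥ 0` in the disk for the analytic shear `F` of `h + conj g` in the direction `τ`. -/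
def shearFields (h g : ℂ → ℂ) : Set (ℂ × (ℂ × ℝ)) :=
  sphere 0 1 ×ˢ tangentParams ∩
    ⋂ w ∈ ball (0 : ℂ) 1, {p | 0 ≤ (tangentField p.2.1 p.2.2 w * shear h g p.1 w).re}

lemma mem_shearFields_iff {τ : ℂ} {q : ℂ × ℝ} :
    (τ, q) ∈ shearFields h g ↔ (τ ∈ sphere (0 : ℂ) 1 ∧ q ∈ tangentParams) ∧
      ∀ w ∈ ball (0 : ℂ) 1, 0 ≤ (tangentField q.1 q.2 w * shear h g τ w).re := by
  simp only [shearFields, mem_inter_iff, mem_prod, mem_iInter₂, mem_ofPred_eq]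

lemma isCompact_shearFields (h g : ℂ → ℂ) : IsCompact (shearFields h g) := by
  refine ((isCompact_sphere 0 1).prod isCompact_tangentParams).inter_right
    (isClosed_biInter fun w _ => isClosed_le continuous_const ?_)
  have := (continuous_tangentField w).comp (continuous_snd (X := ℂ))
  unfold shear
  simp only [Function.comp_def] at this
  fun_prop

lemma neg_mem_shearFields {p : ℂ × (ℂ × ℝ)} (hp : p ∈ shearFields h g) :
    -p ∈ shearFields h g := by
  obtain ⟨τ, q⟩ := p
  obtain ⟨⟨hτ, hq⟩, hre⟩ := mem_shearFields_iff.1 hp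
  refine mem_shearFields_iff.2 ⟨⟨by simpa using hτ, neg_mem_tangentParams hq⟩, fun w hw => ?_⟩
  rw [shear_neg, Prod.fst_neg, Prod.snd_neg, tangentField_neg, neg_mul_neg]
  exact hre w hw

theorem exists_tangentField_shear_nonneg_nonpos (hh : DifferentiableOn ℂ h (ball 0 1))
    (hg : DifferentiableOn ℂ g (ball 0 1)) (hinj : InjOn (harm h g) (ball 0 1))
    (hconv : Convex ℝ (harm h g '' ball 0 1)) (z : ℂ) :
    ∃ τ ∈ sphere (0 : ℂ) 1, ∃ q₁ ∈ tangentParams, ∃ q₂ ∈ tangentParams,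
      0 ≤ tangentMoment q₁ z ∧ tangentMoment q₂ z ≤ 0 ∧
      (∀ w ∈ ball 0 1, 0 ≤ (tangentField q₁.1 q₁.2 w * deriv (shear h g τ) w).re) ∧
      ∀ w ∈ ball 0 1, 0 ≤ (tangentField q₂.1 q₂.2 w * deriv (shear h g τ) w).re := by
  have hderiv : ∀ w ∈ ball (0 : ℂ) 1, ∀ τ, deriv (shear h g τ) w = shear (deriv h) (deriv g) τ w :=
    fun w hw => deriv_shear isOpen_ball hh hg hw
  have hsurj : sphere 0 1 ⊆ Prod.fst '' shearFields (deriv h) (deriv g) := fun τ hτ => by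
    obtain ⟨q, hq, hτq⟩ := exists_tangentField_shear hh hg hinj hconv τ
    exact ⟨(τ, q), mem_shearFields_iff.2 ⟨⟨hτ, hq⟩, fun w hw => hderiv w hw τ ▸ hτq w hw⟩, rfl⟩
  have hm : Continuous fun q : ℂ × ℝ => tangentMoment q z := by
    unfold tangentMoment
    fun_prop
  obtain ⟨τ, hτ, ⟨q₁, hmem₁, hq₁⟩, q₂, hmem₂, hq₂⟩ := exists_mem_sphere_nonneg_nonpos_of_neg_mem
    (by rw [rank_real_complex]; norm_num) (isCompact_shearFields (deriv h) (deriv g))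
    (fun _ => neg_mem_shearFields) hsurj hm fun q => tangentMoment_neg q z
  obtain ⟨⟨-, hq₁'⟩, h₁⟩ := mem_shearFields_iff.1 hmem₁
  obtain ⟨⟨-, hq₂'⟩, h₂⟩ := mem_shearFields_iff.1 hmem₂
  exact ⟨τ, hτ, q₁, hq₁', q₂, hq₂', hq₁, hq₂, fun w hw => (hderiv w hw τ).symm ▸ h₁ w hw,
    fun w hw => (hderiv w hw τ).symm ▸ h₂ w hw⟩

end Shear

section PreSchwarzian

variable {F : ℂ → ℂ} {z : ℂ}

lemma norm_deriv_mul_tangentField_add_le (hF : DifferentiableOn ℂ F (ball 0 1)) {q : ℂ × ℝ}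
    (hq : ∀ w ∈ ball 0 1, 0 ≤ (tangentField q.1 q.2 w * deriv F w).re)
    (hz : z ∈ ball (0 : ℂ) 1) (hne : deriv F z ≠ 0) :
    ‖deriv F z * (tangentField q.1 q.2 z *
        ((1 - ‖z‖ ^ 2) * (deriv (deriv F) z / deriv F z) - 2 * (starRingEnd ℂ) z) +
        I * tangentMoment q z)‖ ≤ 2 * (deriv F z * tangentField q.1 q.2 z).re := by
  have hF' := hF.deriv isOpen_ball
  have hdiff := hF'.differentiableAt (isOpen_ball.mem_nhds hz)
  have hfield := hasDerivAt_tangentField q.1 q.2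
  have hp : DifferentiableOn ℂ (tangentField q.1 q.2) (ball 0 1) :=
    fun w _ => (hfield w).differentiableAt.differentiableWithinAt
  have hbound := norm_deriv_mul_one_sub_sq_le_of_re_nonneg (hp.mul hF') hq hz
  have hderiv : HasDerivAt (tangentField q.1 q.2 * deriv F) _ z :=
    (hfield z).mul hdiff.hasDerivAt
  have hpos : 0 ≤ 1 - ‖z‖ ^ 2 := by
    nlinarith [norm_nonneg z, mem_ball_zero_iff.1 hz]
  rw [Pi.mul_apply, mul_comm (tangentField _ _ _)] at hbound
  refine le_of_eq_of_le ?_ hbound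
  rw [hderiv.deriv, ← Real.norm_of_nonneg hpos, ← norm_real, ← norm_mul]
  congr 1
  have := one_sub_sq_mul_deriv_tangentField q z
  push_cast
  field_simp
  linear_combination (-deriv F z) * this

theorem one_sub_sq_mul_norm_deriv_deriv_div_le (hF : DifferentiableOn ℂ F (ball 0 1))
    {q₁ q₂ : ℂ × ℝ} (hq₁ : q₁ ∈ tangentParams) (hq₂ : q₂ ∈ tangentParams)
    (hm₁ : 0 ≤ tangentMoment q₁ z) (hm₂ : tangentMoment q₂ z ≤ 0)
    (h₁ : ∀ w ∈ ball 0 1, 0 ≤ (tangentField q₁.1 q₁.2 w * deriv F w).re)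
    (h₂ : ∀ w ∈ ball 0 1, 0 ≤ (tangentField q₂.1 q₂.2 w * deriv F w).re)
    (hz : z ∈ ball (0 : ℂ) 1) (hne : deriv F z ≠ 0) :
    (1 - ‖z‖ ^ 2) * ‖deriv (deriv F) z / deriv F z‖ ≤ 2 + 2 * ‖z‖ := by
  have hpos : 0 ≤ 1 - ‖z‖ ^ 2 := by
    nlinarith [norm_nonneg z, mem_ball_zero_iff.1 hz]
  have hA := norm_le_two_of_norm_mul_add_le hne (tangentField_ne_zero hq₁ hz)
    (tangentField_ne_zero hq₂ hz) hm₁ hm₂ (abs_tangentMoment_le hq₂ z)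
    (norm_deriv_mul_tangentField_add_le hF h₁ hz hne)
    (norm_deriv_mul_tangentField_add_le hF h₂ hz hne)
  calc (1 - ‖z‖ ^ 2) * ‖deriv (deriv F) z / deriv F z‖
    _ = ‖(1 - ‖z‖ ^ 2) * (deriv (deriv F) z / deriv F z)‖ := by
        rw [norm_mul, ← Real.norm_of_nonneg hpos, ← norm_real]
        push_cast
        rfl
    _ ≤ 2 + ‖2 * (starRingEnd ℂ) z‖ := by
        rw [← sub_add_cancel ((1 - ‖z‖ ^ 2) * (deriv (deriv F) z / deriv F z))]
        exact norm_add_le_of_le hA le_rfl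
    _ = 2 + 2 * ‖z‖ := by rw [norm_mul, norm_ofNat, RCLike.norm_conj]

end PreSchwarzian

/-! ### The pre-Schwarzian derivative of a convex harmonic mapping -/

lemma norm_wronskian_mul_one_sub_sq_le {H G : ℂ → ℂ} (hH : DifferentiableOn ℂ H (ball 0 1))
    (hG : DifferentiableOn ℂ G (ball 0 1)) (hlt : ∀ w ∈ ball (0 : ℂ) 1, ‖G w‖ < ‖H w‖) {z : ℂ}
    (hz : z ∈ ball (0 : ℂ) 1) :
    ‖deriv G z * H z - G z * deriv H z‖ * (1 - ‖z‖ ^ 2) ≤ ‖H z‖ ^ 2 - ‖G z‖ ^ 2 := by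
  have hpos : ∀ w ∈ ball (0 : ℂ) 1, 0 < ‖H w‖ := fun w hw => (norm_nonneg _).trans_lt (hlt w hw)
  have hne : ∀ w ∈ ball (0 : ℂ) 1, H w ≠ 0 := fun w hw => norm_pos_iff.1 (hpos w hw)
  have hmaps : MapsTo (G / H) (ball 0 1) (ball 0 1) := fun w hw => by
    rw [mem_ball_zero_iff, Pi.div_apply, norm_div, div_lt_one (hpos w hw)]
    exact hlt w hw
  have hpick := norm_deriv_mul_one_sub_sq_le_of_mapsTo_ball (hG.div hH hne) hmaps hz
  have hn := isOpen_ball.mem_nhds hz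
  have hsq : 0 < ‖H z‖ ^ 2 := pow_pos (hpos z hz) 2
  rwa [deriv_div (hG.differentiableAt hn) (hH.differentiableAt hn) (hne z hz), Pi.div_apply,
    norm_div, norm_div, norm_pow, div_pow, one_sub_div hsq.ne', div_mul_eq_mul_div,
    div_le_div_iff_of_pos_right hsq] at hpick

section

variable {h g : ℂ → ℂ} {z : ℂ}

/-- The pre-Schwarzian derivative of `h + conj g`, expressed through `h` and `g`. -/
noncomputable def harmPreSchwarzian (h g : ℂ → ℂ) (z : ℂ) : ℂ :=
  (deriv (deriv h) z * (starRingEnd ℂ) (deriv h z) -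
    deriv (deriv g) z * (starRingEnd ℂ) (deriv g z)) /
      ((‖deriv h z‖ ^ 2 - ‖deriv g z‖ ^ 2 : ℝ) : ℂ)

lemma norm_harmPreSchwarzian_sub_div_shear (hne : ‖deriv h z‖ ≠ ‖deriv g z‖) {τ : ℂ} (hτ : τ ≠ 0) :
    ‖harmPreSchwarzian h g z -
        shear (deriv (deriv h)) (deriv (deriv g)) τ z / shear (deriv h) (deriv g) τ z‖ =
      ‖deriv (deriv g) z * deriv h z - deriv g z * deriv (deriv h) z‖ /
        |‖deriv h z‖ ^ 2 - ‖deriv g z‖ ^ 2| := by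
  have hD := shear_ne_zero hne hτ
  have hJ : ((‖deriv h z‖ ^ 2 - ‖deriv g z‖ ^ 2 : ℝ) : ℂ) ≠ 0 := by
    rw [ofReal_ne_zero, sub_ne_zero]
    exact fun h' => hne ((pow_left_inj₀ (norm_nonneg _) (norm_nonneg _) two_ne_zero).1 h')
  have hquot : harmPreSchwarzian h g z -
        shear (deriv (deriv h)) (deriv (deriv g)) τ z / shear (deriv h) (deriv g) τ z =
      -(deriv (deriv g) z * deriv h z - deriv g z * deriv (deriv h) z) *
          (starRingEnd ℂ) (shear (deriv h) (deriv g) τ z) /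
        (((‖deriv h z‖ ^ 2 - ‖deriv g z‖ ^ 2 : ℝ) : ℂ) * shear (deriv h) (deriv g) τ z) := by
    rw [harmPreSchwarzian, div_sub_div _ _ hJ hD]
    congr 1
    simp only [shear, map_add, map_mul, conj_conj]
    push_cast
    rw [← mul_conj', ← mul_conj']
    ring
  rw [hquot, norm_div, norm_mul, norm_mul, norm_neg, RCLike.norm_conj,
    mul_div_mul_right _ _ (norm_ne_zero_iff.2 hD), norm_real, Real.norm_eq_abs]

variable (hh : DifferentiableOn ℂ h (ball 0 1)) (hg : DifferentiableOn ℂ g (ball 0 1))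
  (hinj : InjOn (harm h g) (ball 0 1)) (hz : z ∈ ball (0 : ℂ) 1)
include hh hg hinj hz

lemma norm_wronskian_deriv_mul_one_sub_sq_le :
    ‖deriv (deriv g) z * deriv h z - deriv g z * deriv (deriv h) z‖ * (1 - ‖z‖ ^ 2) ≤
      |‖deriv h z‖ ^ 2 - ‖deriv g z‖ ^ 2| := by
  have hh' := hh.deriv isOpen_ball
  have hg' := hg.deriv isOpen_ball
  rcases forall_norm_deriv_lt_or_forall_norm_deriv_lt isOpen_ball hh hg hinj
    (convex_ball 0 1).isPreconnected with hlt | hlt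
  · exact (norm_wronskian_mul_one_sub_sq_le hh' hg' hlt hz).trans (le_abs_self _)
  · rw [norm_sub_rev, abs_sub_comm, mul_comm (deriv (deriv g) z), mul_comm (deriv g z)]
    exact (norm_wronskian_mul_one_sub_sq_le hg' hh' hlt hz).trans (le_abs_self _)

theorem norm_harmPreSchwarzian_mul_one_sub_sq_le (hconv : Convex ℝ (harm h g '' ball 0 1)) :
    ‖harmPreSchwarzian h g z‖ * (1 - ‖z‖ ^ 2) ≤ 3 + 2 * ‖z‖ := by
  have hne := norm_deriv_ne_of_injOn_of_mem isOpen_ball hh hg hinj hz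
  have hpos : 0 < 1 - ‖z‖ ^ 2 := by nlinarith [norm_nonneg z, mem_ball_zero_iff.1 hz]
  obtain ⟨τ, hτ, q₁, hq₁, q₂, hq₂, hm₁, hm₂, h₁, h₂⟩ :=
    exists_tangentField_shear_nonneg_nonpos hh hg hinj hconv z
  have hτ0 : τ ≠ 0 := ne_zero_of_mem_unit_sphere ⟨τ, hτ⟩
  have hF' := deriv_shear isOpen_ball hh hg hz τ
  have hF'' : deriv (deriv (shear h g τ)) z = shear (deriv (deriv h)) (deriv (deriv g)) τ z := by
    have hev : deriv (shear h g τ) =ᶠ[𝓝 z] shear (deriv h) (deriv g) τ :=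
      (isOpen_ball.eventually_mem hz).mono fun w hw => deriv_shear isOpen_ball hh hg hw τ
    rw [hev.deriv_eq, deriv_shear isOpen_ball (hh.deriv isOpen_ball) (hg.deriv isOpen_ball) hz]
  have hshear := one_sub_sq_mul_norm_deriv_deriv_div_le (differentiableOn_shear hh hg τ) hq₁ hq₂
    hm₁ hm₂ h₁ h₂ hz (hF' ▸ shear_ne_zero hne hτ0)
  have hdiff := norm_harmPreSchwarzian_sub_div_shear hne hτ0
  rw [← hF', ← hF''] at hdiff
  have hwronskian : ‖deriv (deriv g) z * deriv h z - deriv g z * deriv (deriv h) z‖ /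
      |‖deriv h z‖ ^ 2 - ‖deriv g z‖ ^ 2| * (1 - ‖z‖ ^ 2) ≤ 1 := by
    rw [div_mul_eq_mul_div]
    exact div_le_one_of_le₀ (norm_wronskian_deriv_mul_one_sub_sq_le hh hg hinj hz) (abs_nonneg _)
  have htri := norm_le_norm_add_norm_sub' (harmPreSchwarzian h g z)
    (deriv (deriv (shear h g τ)) z / deriv (shear h g τ) z)
  rw [hdiff] at htri
  linarith [mul_le_mul_of_nonneg_right htri hpos.le]

end

/-! ### Wirtinger derivatives of real-valued functions -/

/-- The differential `v ↦ 2 Re (c v)` of a real-valued function with Wirtinger derivative `c`. -/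
noncomputable def realDifferential (c : ℂ) : ℂ →L[ℝ] ℝ :=
  2 • reCLM ∘L ContinuousLinearMap.mul ℝ ℂ c

lemma realDifferential_apply (c v : ℂ) : realDifferential c v = 2 * (c * v).re := by
  simp [realDifferential]

lemma realDifferential_sub (a b : ℂ) :
    realDifferential a - realDifferential b = realDifferential (a - b) := by
  ext v
  simp only [sub_apply, realDifferential_apply, sub_mul, sub_re, mul_sub]

lemma smul_realDifferential (t : ℝ) (c : ℂ) :
    t • realDifferential c = realDifferential (t * c) := by
  ext v
  simp only [smul_apply, realDifferential_apply, mul_assoc, re_ofReal_mul,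
    smul_eq_mul, mul_left_comm t]

lemma wirtinger_ofReal {u : ℂ → ℝ} {c z : ℂ} (hu : HasFDerivAt u (realDifferential c) z) :
    wirtinger (fun w => (u w : ℂ)) z = c := by
  have hu' : HasFDerivAt (fun w => (u w : ℂ)) (ofRealCLM ∘L realDifferential c) z :=
    ofRealCLM.hasFDerivAt.comp z hu
  rw [wirtinger, hu'.fderiv]
  simp only [ContinuousLinearMap.comp_apply, realDifferential_apply, ofRealCLM_apply, mul_one,
    mul_I_re]
  apply Complex.ext <;> simp

lemma hasFDerivAt_norm_sq_of_hasDerivAt {F : ℂ → ℂ} {F' z : ℂ} (hF : HasDerivAt F F' z) :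
    HasFDerivAt (fun w => ‖F w‖ ^ 2) (realDifferential (F' * (starRingEnd ℂ) (F z))) z := by
  refine (hF.hasFDerivAt.restrictScalars ℝ).norm_sq.congr_fderiv ?_
  ext v
  simp only [realDifferential_apply, Complex.inner, smul_apply,
    ContinuousLinearMap.comp_apply, ContinuousLinearMap.coe_restrictScalars',
    ContinuousLinearMap.toSpanSingleton_apply, innerSL_apply_apply, smul_eq_mul, nsmul_eq_mul,
    mul_re, mul_im, conj_re, conj_im]
  push_cast
  ring

lemma exists_eqOn_harm {f : ℂ → ℂ} (hf : InnerProductSpace.HarmonicOnNhd f disk) :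
    ∃ h g : ℂ → ℂ, DifferentiableOn ℂ h disk ∧ DifferentiableOn ℂ g disk ∧
      EqOn f (harm h g) disk := by
  obtain ⟨F, hF, hFre⟩ := (hf.comp_CLM reCLM).exists_analyticOnNhd_ball_re_eq
  obtain ⟨K, hK, hKre⟩ := (hf.comp_CLM imCLM).exists_analyticOnNhd_ball_re_eq
  refine ⟨fun z => (F z + I * K z) / 2, fun z => (F z - I * K z) / 2,
    (hF.differentiableOn.add (hK.differentiableOn.const_mul I)).div_const 2,
    (hF.differentiableOn.sub (hK.differentiableOn.const_mul I)).div_const 2, fun z hz => ?_⟩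
  have hre : (F z).re = (f z).re := hFre hz
  have him : (K z).re = (f z).im := hKre hz
  simp only [harm, map_div₀, map_sub, map_mul, conj_I, conj_ofNat]
  apply Complex.ext
  · simp only [← hre, add_re, sub_re, mul_re, neg_re, neg_im, I_re, I_im, conj_re, conj_im,
      div_ofNat_re]
    ring
  · simp only [← him, add_im, sub_im, mul_im, neg_re, neg_im, I_re, I_im, conj_re, conj_im,
      div_ofNat_im]
    ring

section

variable {f h g : ℂ → ℂ} {z : ℂ} (hh : DifferentiableOn ℂ h disk) (hg : DifferentiableOn ℂ g disk)
  (hf : EqOn f (harm h g) disk) (hz : z ∈ disk)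
include hh hg hf hz

lemma jacobian_eq_of_eqOn_harm : jacobian f z = ‖deriv h z‖ ^ 2 - ‖deriv g z‖ ^ 2 := by
  have hn := isOpen_ball.mem_nhds hz
  rw [jacobian, (hf.eventuallyEq_of_mem hn).fderiv_eq,
    (hasStrictFDerivAt_harm (hh.analyticAt hn) (hg.analyticAt hn)).hasFDerivAt.fderiv, det_harmLin]

lemma jacobian_ne_zero_iff_of_eqOn_harm : jacobian f z ≠ 0 ↔ ‖deriv h z‖ ≠ ‖deriv g z‖ := by
  rw [jacobian_eq_of_eqOn_harm hh hg hf hz, sub_ne_zero, Ne,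
    pow_left_inj₀ (norm_nonneg _) (norm_nonneg _) two_ne_zero]

lemma preSchwarzian_eq_of_eqOn_harm (hne : ‖deriv h z‖ ≠ ‖deriv g z‖) :
    preSchwarzian f z = harmPreSchwarzian h g z := by
  have hn := isOpen_ball.mem_nhds hz
  have hJ := (jacobian_ne_zero_iff_of_eqOn_harm hh hg hf hz).2 hne
  rw [jacobian_eq_of_eqOn_harm hh hg hf hz] at hJ
  have hnorm : ∀ {k : ℂ → ℂ}, DifferentiableOn ℂ k disk → HasFDerivAt (fun w => ‖deriv k w‖ ^ 2)
      (realDifferential (deriv (deriv k) z * (starRingEnd ℂ) (deriv k z))) z := fun hk =>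
    hasFDerivAt_norm_sq_of_hasDerivAt
      ((hk.deriv isOpen_ball).differentiableAt hn).hasDerivAt
  have hlog := ((hnorm hh).sub (hnorm hg)).log hJ
  rw [realDifferential_sub, smul_realDifferential] at hlog
  have hev : (fun w => Real.log |jacobian f w|) =ᶠ[𝓝 z]
      fun w => Real.log (‖deriv h w‖ ^ 2 - ‖deriv g w‖ ^ 2) := by
    filter_upwards [hn] with w hw
    rw [jacobian_eq_of_eqOn_harm hh hg hf hw, Real.log_abs]
  rw [preSchwarzian, wirtinger_ofReal (hlog.congr_of_eventuallyEq hev), harmPreSchwarzian,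
    ofReal_inv, inv_mul_eq_div]
  rfl

end

theorem IsConvexHarmonic.exists_eqOn_harm {f : ℂ → ℂ} (hf : IsConvexHarmonic f) :
    ∃ h g : ℂ → ℂ, DifferentiableOn ℂ h disk ∧ DifferentiableOn ℂ g disk ∧
      EqOn f (harm h g) disk ∧ InjOn (harm h g) disk ∧ Convex ℝ (harm h g '' disk) := by
  obtain ⟨h, g, hh, hg, hfe⟩ := HarmonicMapping.exists_eqOn_harm hf.harmonic
  exact ⟨h, g, hh, hg, hfe, hf.univalent.congr hfe, hfe.image_eq ▸ hf.convex_image⟩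

theorem IsConvexHarmonic.jacobian_ne_zero {f : ℂ → ℂ} (hf : IsConvexHarmonic f) {z : ℂ}
    (hz : z ∈ disk) : jacobian f z ≠ 0 := by
  obtain ⟨h, g, hh, hg, hfe, hinj, -⟩ := hf.exists_eqOn_harm
  exact (jacobian_ne_zero_iff_of_eqOn_harm hh hg hfe hz).2
    (norm_deriv_ne_of_injOn_of_mem isOpen_ball hh hg hinj hz)

theorem IsConvexHarmonic.norm_preSchwarzian_mul_one_sub_sq_le {f : ℂ → ℂ}
    (hf : IsConvexHarmonic f) {z : ℂ} (hz : z ∈ disk) :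
    ‖preSchwarzian f z‖ * (1 - ‖z‖ ^ 2) ≤ 3 + 2 * ‖z‖ := by
  obtain ⟨h, g, hh, hg, hfe, hinj, hconv⟩ := hf.exists_eqOn_harm
  rw [preSchwarzian_eq_of_eqOn_harm hh hg hfe hz
    (norm_deriv_ne_of_injOn_of_mem isOpen_ball hh hg hinj hz)]
  exact norm_harmPreSchwarzian_mul_one_sub_sq_le hh hg hinj hz hconv

theorem IsConvexHarmonic.preSchwarzianNorm_le {f : ℂ → ℂ} (hf : IsConvexHarmonic f) :
    preSchwarzianNorm f ≤ 5 := by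
  refine iSup₂_le fun z hz => ?_
  rw [← ENNReal.ofReal_ofNat 5]
  exact ENNReal.ofReal_le_ofReal (by
    linarith [hf.norm_preSchwarzian_mul_one_sub_sq_le hz, mem_ball_zero_iff.1 hz])

lemma harmPreSchwarzian_of_dilatation {h g ω : ℂ → ℂ} {z ω' : ℂ}
    (hh : DifferentiableAt ℂ (deriv h) z) (hω : HasDerivAt ω ω' z)
    (hdil : deriv g =ᶠ[𝓝 z] ω * deriv h) (hh' : deriv h z ≠ 0) (hω1 : ‖ω z‖ < 1) :
    harmPreSchwarzian h g z = deriv (deriv h) z / deriv h z -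
      ω' * (starRingEnd ℂ) (ω z) / ((1 - ‖ω z‖ ^ 2 : ℝ) : ℂ) := by
  have hpos : 0 < 1 - ‖ω z‖ ^ 2 := by nlinarith [norm_nonneg (ω z)]
  have hJ : ((1 - ‖ω z‖ ^ 2 : ℝ) : ℂ) ≠ 0 := ofReal_ne_zero.2 hpos.ne'
  have hconj : (starRingEnd ℂ) (deriv h z) ≠ 0 := (map_ne_zero _).2 hh'
  rw [harmPreSchwarzian, hdil.deriv_eq, (hω.mul hh.hasDerivAt).deriv, hdil.self_of_nhds,
    Pi.mul_apply, norm_mul, mul_pow, ← one_sub_mul, mul_comm (1 - _)]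
  rw [ofReal_mul, ofReal_pow, ← mul_conj', map_mul, div_sub_div _ _ hh' hJ,
    div_eq_div_iff (mul_ne_zero (mul_ne_zero hh' hconj) hJ) (mul_ne_zero hh' hJ)]
  push_cast
  rw [← mul_conj']
  ring

/-! ### The half-plane mapping -/

/-- The analytic part of the half-plane mapping. -/
noncomputable def halfPlaneAnalytic (z : ℂ) : ℂ := (2 * z - z ^ 2) / (2 * (1 - z) ^ 2)

/-- The conjugate of the co-analytic part of the half-plane mapping. -/
noncomputable def halfPlaneCoanalytic (z : ℂ) : ℂ := -z ^ 2 / (2 * (1 - z) ^ 2)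

lemma halfPlaneMap_eq_harm : halfPlaneMap = harm halfPlaneAnalytic halfPlaneCoanalytic := rfl

lemma one_sub_inv_mem_disk_iff {w : ℂ} (hw : w ≠ 0) : 1 - w⁻¹ ∈ disk ↔ 1 / 2 < w.re := by
  have hnorm : ‖w - 1‖ ^ 2 = ‖w‖ ^ 2 - 2 * w.re + 1 := by
    simp only [← normSq_eq_norm_sq, normSq_apply, sub_re, sub_im, one_re, one_im]
    ring
  rw [mem_ball_zero_iff, show 1 - w⁻¹ = (w - 1) / w by field_simp, norm_div,
    div_lt_one (norm_pos_iff.2 hw),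
    ← pow_lt_pow_iff_left₀ (norm_nonneg _) (norm_nonneg _) two_ne_zero, hnorm]
  constructor <;> intro h <;> linarith

lemma hasDerivAt_two_mul_one_sub_sq (z : ℂ) :
    HasDerivAt (fun z : ℂ => 2 * (1 - z) ^ 2) (-4 * (1 - z)) z := by
  refine ((((hasDerivAt_id z).const_sub 1).pow 2).const_mul 2).congr_deriv ?_
  simp only [id]
  norm_num
  ring

section

variable {z : ℂ} (hz : z ∈ disk)
include hz

lemma one_sub_ne_zero_of_mem_disk : 1 - z ≠ 0 := by
  rintro h
  rw [mem_ball_zero_iff, ← sub_eq_zero.1 h, norm_one] at hz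
  exact lt_irrefl _ hz

lemma half_lt_re_inv_one_sub : 1 / 2 < ((1 - z)⁻¹).re := by
  rw [← one_sub_inv_mem_disk_iff (inv_ne_zero (one_sub_ne_zero_of_mem_disk hz)), inv_inv,
    sub_sub_cancel]
  exact hz

/-- In the half-plane coordinate `w = (1 - z)⁻¹`, the parts of the mapping are `(w² - 1) / 2` and
`-(w - 1)² / 2`. -/
lemma halfPlaneMap_eq :
    halfPlaneMap z = ⟨((1 - z)⁻¹).re - 1, ((1 - z)⁻¹).im * (2 * ((1 - z)⁻¹).re - 1)⟩ := by
  have h0 := one_sub_ne_zero_of_mem_disk hz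
  set w := (1 - z)⁻¹ with hw
  have han : (2 * z - z ^ 2) / (2 * (1 - z) ^ 2) = (w ^ 2 - 1) / 2 := by
    rw [hw]
    field_simp
    ring
  have hco : -z ^ 2 / (2 * (1 - z) ^ 2) = -(w - 1) ^ 2 / 2 := by
    rw [hw]
    field_simp
    ring
  rw [halfPlaneMap, han, hco]
  apply Complex.ext <;>
  · simp only [sq, add_re, add_im, conj_re, conj_im, div_ofNat_re, div_ofNat_im, neg_re, neg_im,
      mul_re, mul_im, sub_re, sub_im, one_re, one_im]
    ring

lemma hasDerivAt_halfPlaneAnalytic : HasDerivAt halfPlaneAnalytic (1 / (1 - z) ^ 3) z := by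
  have h0 := one_sub_ne_zero_of_mem_disk hz
  have hnum : HasDerivAt (fun z : ℂ => 2 * z - z ^ 2) (2 - 2 * z) z := by
    simpa using ((hasDerivAt_id z).const_mul 2).fun_sub (hasDerivAt_pow 2 z)
  refine (hnum.div (hasDerivAt_two_mul_one_sub_sq z)
    (mul_ne_zero two_ne_zero (pow_ne_zero 2 h0))).congr_deriv ?_
  field_simp
  ring

lemma hasDerivAt_halfPlaneCoanalytic :
    HasDerivAt halfPlaneCoanalytic (-z / (1 - z) ^ 3) z := by
  have h0 := one_sub_ne_zero_of_mem_disk hz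
  have hnum : HasDerivAt (fun z : ℂ => -z ^ 2) (-2 * z) z := by
    simpa using (hasDerivAt_pow 2 z).fun_neg
  refine (hnum.div (hasDerivAt_two_mul_one_sub_sq z)
    (mul_ne_zero two_ne_zero (pow_ne_zero 2 h0))).congr_deriv ?_
  field_simp
  ring

lemma hasDerivAt_deriv_halfPlaneAnalytic :
    HasDerivAt (deriv halfPlaneAnalytic) (3 / (1 - z) ^ 4) z := by
  have h0 := one_sub_ne_zero_of_mem_disk hz
  have hev : deriv halfPlaneAnalytic =ᶠ[𝓝 z] fun z => ((1 - z) ^ 3)⁻¹ := by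
    filter_upwards [isOpen_ball.mem_nhds hz] with w hw
    rw [(hasDerivAt_halfPlaneAnalytic hw).deriv, one_div]
  refine (((((hasDerivAt_id z).const_sub 1).pow 3).inv
    (pow_ne_zero 3 h0)).congr_of_eventuallyEq hev).congr_deriv ?_
  simp only [id, Pi.pow_apply]
  field_simp
  ring

end

lemma differentiableOn_halfPlaneAnalytic : DifferentiableOn ℂ halfPlaneAnalytic disk := fun _ hz =>
  (hasDerivAt_halfPlaneAnalytic hz).differentiableAt.differentiableWithinAt

lemma differentiableOn_halfPlaneCoanalytic : DifferentiableOn ℂ halfPlaneCoanalytic disk :=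
  fun _ hz => (hasDerivAt_halfPlaneCoanalytic hz).differentiableAt.differentiableWithinAt

lemma injOn_halfPlaneMap : InjOn halfPlaneMap disk := by
  intro x hx y hy hxy
  rw [halfPlaneMap_eq hx, halfPlaneMap_eq hy, Complex.mk.injEq] at hxy
  obtain ⟨hre, him⟩ := hxy
  replace hre := sub_left_injective hre
  rw [← hre] at him
  have hfactor : 2 * ((1 - x)⁻¹).re - 1 ≠ 0 := by linarith [half_lt_re_inv_one_sub hx]
  exact sub_right_injective
    (inv_injective (Complex.ext hre (mul_right_cancel₀ hfactor him)))

lemma image_halfPlaneMap : halfPlaneMap '' disk = {w : ℂ | -1 / 2 < w.re} := by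
  apply Subset.antisymm
  · rintro _ ⟨z, hz, rfl⟩
    rw [halfPlaneMap_eq hz]
    change -1 / 2 < ((1 - z)⁻¹).re - 1
    linarith [half_lt_re_inv_one_sub hz]
  · intro v (hv : -1 / 2 < v.re)
    have hre : 2 * v.re + 1 ≠ 0 := by linarith
    set w : ℂ := ⟨v.re + 1, v.im / (2 * v.re + 1)⟩
    have hw : w ≠ 0 := fun h => by linarith [show v.re + 1 = 0 from congrArg re h]
    have hdisk : 1 - w⁻¹ ∈ disk := (one_sub_inv_mem_disk_iff hw).2 (by simp only [w]; linarith)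
    refine ⟨1 - w⁻¹, hdisk, ?_⟩
    rw [halfPlaneMap_eq hdisk, sub_sub_cancel, inv_inv]
    refine Complex.ext (add_sub_cancel_right _ _) ?_
    simp only [w]
    rw [show 2 * (v.re + 1) - 1 = 2 * v.re + 1 by ring, div_mul_cancel₀ _ hre]

theorem isConvexHarmonic_halfPlaneMap : IsConvexHarmonic halfPlaneMap where
  harmonic z hz := by
    have hn := isOpen_ball.mem_nhds hz
    exact (differentiableOn_halfPlaneAnalytic.analyticAt hn).harmonicAt.add
      ((differentiableOn_halfPlaneCoanalytic.analyticAt hn).harmonicAt.comp_CLM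
        (conjCLE : ℂ →L[ℝ] ℂ))
  univalent := injOn_halfPlaneMap
  convex_image := by
    rw [image_halfPlaneMap]
    exact convex_halfSpace_re_gt _

lemma preSchwarzian_halfPlaneMap {z : ℂ} (hz : z ∈ disk) :
    preSchwarzian halfPlaneMap z = 3 / (1 - z) - (starRingEnd ℂ) z / ((1 - ‖z‖ ^ 2 : ℝ) : ℂ) := by
  have h0 := one_sub_ne_zero_of_mem_disk hz
  have hdil : deriv halfPlaneCoanalytic =ᶠ[𝓝 z] (fun w => -w) * deriv halfPlaneAnalytic := by
    filter_upwards [isOpen_ball.mem_nhds hz] with w hw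
    rw [Pi.mul_apply, (hasDerivAt_halfPlaneCoanalytic hw).deriv,
      (hasDerivAt_halfPlaneAnalytic hw).deriv, mul_one_div]
  have hderiv := hasDerivAt_deriv_halfPlaneAnalytic hz
  have hne : deriv halfPlaneAnalytic z ≠ 0 := by
    rw [(hasDerivAt_halfPlaneAnalytic hz).deriv]
    exact one_div_ne_zero (pow_ne_zero 3 h0)
  rw [preSchwarzian_eq_of_eqOn_harm differentiableOn_halfPlaneAnalytic
      differentiableOn_halfPlaneCoanalytic (fun _ _ => congrFun halfPlaneMap_eq_harm _) hz
      (norm_deriv_ne_of_injOn_of_mem isOpen_ball differentiableOn_halfPlaneAnalytic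
        differentiableOn_halfPlaneCoanalytic injOn_halfPlaneMap hz),
    harmPreSchwarzian_of_dilatation hderiv.differentiableAt (hasDerivAt_neg z) hdil hne
      (by rw [norm_neg]; exact mem_ball_zero_iff.1 hz),
    hderiv.deriv, (hasDerivAt_halfPlaneAnalytic hz).deriv, norm_neg, map_neg, neg_mul_neg, one_mul]
  congr 1
  field_simp

lemma norm_preSchwarzian_halfPlaneMap_ofReal {r : ℝ} (hr : r ∈ Ioo 0 1) :
    ‖preSchwarzian halfPlaneMap r‖ * (1 - ‖(r : ℂ)‖ ^ 2) = 3 + 2 * r := by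
  obtain ⟨hr0, hr1⟩ := hr
  have hnorm : ‖(r : ℂ)‖ = r := Complex.norm_of_nonneg hr0.le
  have hsub : 0 < 1 - r := sub_pos.2 hr1
  have hsq : 0 < 1 - r ^ 2 := by nlinarith
  have hvalue : preSchwarzian halfPlaneMap r = ((3 + 2 * r) / (1 - r ^ 2) : ℝ) := by
    rw [preSchwarzian_halfPlaneMap (mem_ball_zero_iff.2 (hnorm.trans_lt hr1)), hnorm, conj_ofReal]
    norm_cast
    rw [div_sub_div _ _ hsub.ne' hsq.ne', div_eq_div_iff (by positivity) hsq.ne']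
    ring
  rw [hvalue, hnorm, Complex.norm_of_nonneg (by positivity), div_mul_cancel₀ _ hsq.ne']

theorem preSchwarzianNorm_halfPlaneMap : preSchwarzianNorm halfPlaneMap = 5 := by
  refine le_antisymm isConvexHarmonic_halfPlaneMap.preSchwarzianNorm_le ?_
  have hlim : Tendsto (fun r : ℝ => ENNReal.ofReal (3 + 2 * r)) (𝓝[<] 1)
      (𝓝 (ENNReal.ofReal (3 + 2 * 1))) :=
    ENNReal.tendsto_ofReal ((Continuous.tendsto (f := fun r : ℝ => 3 + 2 * r)
      (by fun_prop) 1).mono_left nhdsWithin_le_nhds)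
  rw [show (3 + 2 * 1 : ℝ) = 5 by norm_num, ENNReal.ofReal_ofNat] at hlim
  refine le_of_tendsto hlim ?_
  filter_upwards [Ioo_mem_nhdsLT (zero_lt_one' ℝ)] with r hr
  rw [← norm_preSchwarzian_halfPlaneMap_ofReal hr]
  refine le_iSup₂_of_le (r : ℂ) ?_ le_rfl
  rw [mem_ball_zero_iff, Complex.norm_of_nonneg hr.1.le]
  exact hr.2

end HarmonicMapping

theorem mainTheorem7 :
    (∀ f : ℂ → ℂ, HarmonicMapping.IsConvexHarmonic f →
      (∀ z ∈ HarmonicMapping.disk, HarmonicMapping.jacobian f z ≠ 0) ∧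
        HarmonicMapping.preSchwarzianNorm f ≤ 5) ∧
    HarmonicMapping.IsConvexHarmonic HarmonicMapping.halfPlaneMap ∧
    HarmonicMapping.preSchwarzianNorm HarmonicMapping.halfPlaneMap = 5 :=
  ⟨fun _ hf => ⟨fun _ hz => hf.jacobian_ne_zero hz, hf.preSchwarzianNorm_le⟩,
    HarmonicMapping.isConvexHarmonic_halfPlaneMap, HarmonicMapping.preSchwarzianNorm_halfPlaneMap⟩
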